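/- Let $\Omega=\bigcup_{i=1}^M\Omega_i\subset\mathbb R^2$ be a finite union of bounded simply connected domains with disjoint closures, each $\partial\Omega_i$ being a simple closed regular curve with a periodic arc length parametrization of class $C^4$. Let $n$ be the unit normal on $\partial\Omega$ pointing to the exterior, $\tau$ the unit tangent, $\kappa$ the signed curvature ($\gamma''=-\kappa n$ for an arc length parametrization $\gamma$) and $dS$ arc length. For $k>0$ let $$G(x,y)=\frac1{2k^2}\Big[\frac i4H_0^{(1)}(k\|x-y\|)-\frac1{2\pi}K_0(k\|x-y\|)\Big]$$ be the Green's function of $\Delta^2-k^4$, where $H_0^{(1)}$ is the Hankel function and, in this formula only, $K_0$ is the modified Bessel function. Subscripts $n_x,n_y,\tau_y$ denote contractions of the derivative tensors of $G$ in $x$ or $y$ with the corresponding vectors. Put $$K_1=G_{n_yn_yn_y}+3G_{n_y\tau_y\tau_y},\qquad K_2=-G_{n_yn_y}+G_{\tau_y\tau_y},$$ $\mathcal K_j[\sigma](x)=\int_{\partial\Omega}K_j(x,y)\sigma(y)\,dS(y)$ for $x\notin\partial\Omega$, and, on $\partial\Omega\times\partial\Omega$ off the diagonal, $$K_{11}=K_1,\quad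 K_{12}=K_2,\quad K_{21}=n(x)\cdot\nabla_xK_1,\quad K_{22}=n(x)\cdot\nabla_xK_2 ,$$ with $\mathcal K_{ij}[\sigma](x_0)=\mathrm{p.v.}\!\int_{\partial\Omega}K_{ij}(x_0,y)\sigma(y)\,dS(y)$ for $x_0\in\partial\Omega$. Then: (a) Each $K_{ij}$ extends to a continuous function on $\partial\Omega\times\partial\Omega$, and for $\sigma\in L^2(\partial\Omega)$ the principal values exist at every $x_0\in\partial\Omega$. (b) For every $C^1$ density $\sigma:\partial\Omega\to\mathbb C$, the potentials $\mathcal K_1[\sigma]$ and $\mathcal K_2[\sigma]$ are well defined (absolutely convergent) and differentiable off $\partial\Omega$, and for every $x_0\in\partial\Omega$, with limits along the normal from the exterior ($x_0^+$) and from the interior ($x_0^-$), $$\lim_{x\to x_0^\pm}\mathcal K_1[\sigma](x)=\mp\tfrac12\sigma(x_0)+\mathcal K_{11}[\sigma](x_0),\qquad \lim_{x\to x_0^\pm}\mathcal K_2[\sigma](x)=\mathcal K_{12}[\sigma](x_0),$$ $$\lim_{x\to x_0^\pm}n(x_0)\cdot\nabla\mathcal K_1[\sigma](x)=\pm\kappa(x_0)\sigma(x_0)+\mathcal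 K_{21}[\sigma](x_0),\qquad \lim_{x\to x_0^\pm}n(x_0)\cdot\nabla\mathcal K_2[\sigma](x)=\mp\tfrac12\sigma(x_0)+\mathcal K_{22}[\sigma](x_0).$$ (c) Consequently, for $C^1$ densities $\rho_1,\rho_2$ and $u=\mathcal K_1[\rho_1]+\mathcal K_2[\rho_2]$, the exterior (upper sign) and interior (lower sign) limits of $u$ and of $n\cdot\nabla u$ at $\partial\Omega$ are the two rows of $$\begin{pmatrix}\mp\frac12 I&0\\ \pm\kappa&\mp\frac12 I\end{pmatrix}\begin{pmatrix}\rho_1\\ \rho_2\end{pmatrix}+\begin{pmatrix}\mathcal K_{11}&\mathcal K_{12}\\ \mathcal K_{21}&\mathcal K_{22}\end{pmatrix}\begin{pmatrix}\rho_1\\ \rho_2\end{pmatrix},$$ and both of these systems are second kind on $L^2(\partial\Omega)\times L^2(\partial\Omega)$: the first matrix acts as a bounded operator with bounded inverse, and the second matrix acts as a compact operator. -/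

import Mathlib

open MeasureTheory Filter Topology Set

noncomputable section

/-! ### Bessel functions of order zero and the flexural Green's function -/

/-- The Bessel function `J₀` (power series). -/
def besselJ0 (z : ℝ) : ℝ :=
  ∑' m : ℕ, (-1) ^ m * (z ^ 2 / 4) ^ m / (m.factorial : ℝ) ^ 2

/-- The modified Bessel function `I₀` (power series). -/
def besselI0 (z : ℝ) : ℝ :=
  ∑' m : ℕ, (z ^ 2 / 4) ^ m / (m.factorial : ℝ) ^ 2

/-- The Bessel function of the second kind `Y₀`, for `z > 0`. -/
def besselY0 (z : ℝ) : ℝ :=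
  2 / Real.pi * (Real.log (z / 2) + Real.eulerMascheroniConstant) * besselJ0 z
    - 2 / Real.pi * ∑' m : ℕ,
        (-1) ^ m * ((harmonic m : ℚ) : ℝ) * (z ^ 2 / 4) ^ m / (m.factorial : ℝ) ^ 2

/-- The modified Bessel function of the second kind `K₀`, for `z > 0`. -/
def besselK0 (z : ℝ) : ℝ :=
  -(Real.log (z / 2) + Real.eulerMascheroniConstant) * besselI0 z
    + ∑' m : ℕ, ((harmonic m : ℚ) : ℝ) * (z ^ 2 / 4) ^ m / (m.factorial : ℝ) ^ 2

/-- The Hankel function of the first kind `H₀⁽¹⁾ = J₀ + i Y₀`, for `z > 0`. -/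
def hankelH0 (z : ℝ) : ℂ :=
  (besselJ0 z : ℂ) + Complex.I * (besselY0 z : ℂ)

/-- The Euclidean plane. -/
abbrev Plane : Type := EuclideanSpace ℝ (Fin 2)

/-- The outgoing Green's function of `Δ² - k⁴`. -/
def flexuralGreen (k : ℝ) (x y : Plane) : ℂ :=
  1 / (2 * (k : ℂ) ^ 2) *
    (Complex.I / 4 * hankelH0 (k * ‖x - y‖)
      - 1 / (2 * (Real.pi : ℂ)) * (besselK0 (k * ‖x - y‖) : ℂ))

/-- The derivative of `f` at `p` in the (fixed) direction `v`, i.e. `v · ∇ f (p)`. -/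
def dirDeriv (v : Plane) (f : Plane → ℂ) (p : Plane) : ℂ := fderiv ℝ f p v

/-! ### The geometry -/

/-- A finite collection of bounded simply connected plane domains with disjoint closures, each
bounded by a simple closed `C⁴` curve. Each curve is given by a periodic arc length
parametrization, oriented so that the tangent rotated by `-π/2` is the outward normal. -/
structure PlateGeometry (M : ℕ) where
  /-- the components of the domain -/
  dom : Fin M → Set Plane
  /-- the lengths of the boundary curves -/
  len : Fin M → ℝ
  /-- the arc length parametrizations of the boundary curves -/
  γ : Fin M → ℝ → Plane
  isOpen_dom : ∀ i, IsOpen (dom i)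
  isBounded_dom : ∀ i, Bornology.IsBounded (dom i)
  isSimplyConnected_dom : ∀ i, IsSimplyConnected (dom i)
  disjoint_closure : ∀ i j, i ≠ j → Disjoint (closure (dom i)) (closure (dom j))
  len_pos : ∀ i, 0 < len i
  contDiff_γ : ∀ i, ContDiff ℝ 4 (γ i)
  periodic_γ : ∀ i, Function.Periodic (γ i) (len i)
  unit_speed : ∀ i s, ‖deriv (γ i) s‖ = 1
  injOn_γ : ∀ i, InjOn (γ i) (Ico 0 (len i))
  frontier_dom : ∀ i, frontier (dom i) = range (γ i)
  outward : ∀ i s, ∀ᶠ h : ℝ in 𝓝[>] 0,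
    γ i s + h • (!₂[deriv (γ i) s 1, -deriv (γ i) s 0] : Plane) ∉ closure (dom i) ∧
    γ i s - h • (!₂[deriv (γ i) s 1, -deriv (γ i) s 0] : Plane) ∈ dom i

namespace PlateGeometry

variable {M : ℕ} (B : PlateGeometry M)

/-- The domain `Ω`. -/
def domain : Set Plane := ⋃ i, B.dom i

/-- The boundary `∂Ω`, as the union of the boundary curves. -/
def bdry : Set Plane := ⋃ i, range (B.γ i)

theorem bdry_eq_frontier : B.bdry = frontier B.domain := by
  have hopen : IsOpen B.domain := isOpen_iUnion B.isOpen_dom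
  rw [hopen.frontier_eq, domain, closure_iUnion_of_finite, bdry]
  ext x
  simp only [← B.frontier_dom, (B.isOpen_dom _).frontier_eq, mem_iUnion, Set.mem_sdiff, not_exists]
  constructor
  · rintro ⟨i, hi, hn⟩
    refine ⟨⟨i, hi⟩, fun j hj => ?_⟩
    by_cases hij : i = j
    · exact hn (hij ▸ hj)
    · exact disjoint_left.1 (B.disjoint_closure i j hij) hi (subset_closure hj)
  · rintro ⟨⟨i, hi⟩, hn⟩
    exact ⟨i, hi, hn i⟩

/-- Arc length measure `dS` on `∂Ω` (a measure on the plane, carried by `∂Ω`). -/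
def arcLength : Measure Plane :=
  ∑ i, Measure.map (B.γ i) (volume.restrict (Ioc 0 (B.len i)))

/-- Unit tangent, as a function of the parameter. -/
def tangentAt (p : Fin M × ℝ) : Plane := deriv (B.γ p.1) p.2

/-- Outward unit normal, as a function of the parameter. -/
def normalAt (p : Fin M × ℝ) : Plane :=
  !₂[deriv (B.γ p.1) p.2 1, -deriv (B.γ p.1) p.2 0]

/-- Signed curvature `κ = -γ'' · n`, as a function of the parameter. -/
def curvatureAt (p : Fin M × ℝ) : ℝ :=
  -inner ℝ (deriv (deriv (B.γ p.1)) p.2) (B.normalAt p)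

/-- A function of the curve parameters, regarded as a function of the point of `∂Ω`
(and extended by `0` to the plane). -/
def ofParam {α : Type} [Zero α] (f : Fin M × ℝ → α) : Plane → α :=
  Function.extend (fun p : Fin M × ℝ => B.γ p.1 p.2) f 0

/-- Unit tangent `τ` at a point of `∂Ω`. -/
def tangent : Plane → Plane := B.ofParam B.tangentAt

/-- Outward unit normal `n` at a point of `∂Ω`. -/
def normal : Plane → Plane := B.ofParam B.normalAt

/-- Signed curvature `κ` at a point of `∂Ω` (positive where the domain is convex). -/
def curvature : Plane → ℝ := B.ofParam B.curvatureAt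

theorem param_unique {p q : Fin M × ℝ} (h : B.γ p.1 p.2 = B.γ q.1 q.2) :
    p.1 = q.1 ∧ ∃ m : ℤ, p.2 = q.2 + m * B.len p.1 := by
  obtain ⟨i, s⟩ := p
  obtain ⟨j, t⟩ := q
  simp only at h ⊢
  have hij : i = j := by
    by_contra hij
    have hi : B.γ i s ∈ closure (B.dom i) :=
      frontier_subset_closure (B.frontier_dom i ▸ mem_range_self s)
    have hj : B.γ j t ∈ closure (B.dom j) :=
      frontier_subset_closure (B.frontier_dom j ▸ mem_range_self t)
    exact disjoint_left.1 (B.disjoint_closure i j hij) hi (h ▸ hj)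
  subst hij
  refine ⟨rfl, ?_⟩
  have hl := B.len_pos i
  have key : ∀ r, B.γ i (toIcoMod hl 0 r) = B.γ i r := fun r => by
    rw [toIcoMod]
    exact (B.periodic_γ i).sub_zsmul_eq _
  have hm : ∀ r, toIcoMod hl 0 r ∈ Ico 0 (B.len i) := fun r => by
    simpa using toIcoMod_mem_Ico hl 0 r
  have he : toIcoMod hl 0 s = toIcoMod hl 0 t :=
    B.injOn_γ i (hm s) (hm t) (by rw [key, key, h])
  refine ⟨toIcoDiv hl 0 s - toIcoDiv hl 0 t, ?_⟩
  simp only [toIcoMod, zsmul_eq_mul] at he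
  push_cast
  linarith

/-- Periodic functions of the parameters give well-defined functions on `∂Ω`. -/
theorem ofParam_γ {α : Type} [Zero α] (f : Fin M × ℝ → α)
    (hf : ∀ i, Function.Periodic (fun s => f (i, s)) (B.len i)) (i : Fin M) (s : ℝ) :
    B.ofParam f (B.γ i s) = f (i, s) := by
  have hfac : Function.FactorsThrough f (fun p : Fin M × ℝ => B.γ p.1 p.2) := by
    rintro ⟨j, t⟩ ⟨l, u⟩ h
    obtain ⟨h1, m, h2⟩ := B.param_unique h
    simp only at h1 h2
    subst h1
    rw [h2]
    exact (hf j).int_mul m u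
  exact hfac.extend_apply 0 (i, s)

theorem periodic_deriv_γ (i : Fin M) : Function.Periodic (deriv (B.γ i)) (B.len i) := fun s => by
  have h : (fun t => B.γ i (t + B.len i)) = B.γ i := funext (B.periodic_γ i)
  rw [← deriv_comp_add_const, h]

theorem tangent_γ (i : Fin M) (s : ℝ) : B.tangent (B.γ i s) = deriv (B.γ i) s :=
  B.ofParam_γ B.tangentAt (fun j => B.periodic_deriv_γ j) i s

theorem normal_γ (i : Fin M) (s : ℝ) :
    B.normal (B.γ i s) = !₂[deriv (B.γ i) s 1, -deriv (B.γ i) s 0] :=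
  B.ofParam_γ B.normalAt (fun j t => by simp [normalAt, B.periodic_deriv_γ j t]) i s

theorem curvature_γ (i : Fin M) (s : ℝ) :
    B.curvature (B.γ i s) =
      -inner ℝ (deriv (deriv (B.γ i)) s) (!₂[deriv (B.γ i) s 1, -deriv (B.γ i) s 0] : Plane) := by
  refine B.ofParam_γ B.curvatureAt (fun j t => ?_) i s
  have h : (fun t => deriv (B.γ j) (t + B.len j)) = deriv (B.γ j) :=
    funext (B.periodic_deriv_γ j)
  have h2 : deriv (deriv (B.γ j)) (t + B.len j) = deriv (deriv (B.γ j)) t := by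
    rw [← deriv_comp_add_const, h]
  simp [curvatureAt, normalAt, B.periodic_deriv_γ j t, h2]

/-- A continuously differentiable density on `∂Ω`. -/
def IsC1Density (σ : Plane → ℂ) : Prop :=
  ∀ i, ContDiff ℝ 1 (fun s => σ (B.γ i s))

/-! ### Kernels and layer potentials -/

/-- `K₁ = G_{nnn} + 3 G_{nττ}`, derivatives in the source `y`, directions frozen at `y`. -/
def K1 (k : ℝ) (x y : Plane) : ℂ :=
  dirDeriv (B.normal y) (dirDeriv (B.normal y) (dirDeriv (B.normal y)
      (fun z => flexuralGreen k x z))) y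
    + 3 * dirDeriv (B.normal y) (dirDeriv (B.tangent y) (dirDeriv (B.tangent y)
      (fun z => flexuralGreen k x z))) y

/-- `K₂ = -G_{nn} + G_{ττ}`, derivatives in the source `y`, directions frozen at `y`. -/
def K2 (k : ℝ) (x y : Plane) : ℂ :=
  -dirDeriv (B.normal y) (dirDeriv (B.normal y) (fun z => flexuralGreen k x z)) y
    + dirDeriv (B.tangent y) (dirDeriv (B.tangent y) (fun z => flexuralGreen k x z)) y

/-- The boundary kernels: the first row is `K₁, K₂`, the second row consists of their normal
derivatives in the target `x`. -/
def bdryKernel (k : ℝ) : Fin 2 → Fin 2 → Plane → Plane → ℂ :=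
  ![![B.K1 k, B.K2 k],
    ![fun x y => dirDeriv (B.normal x) (fun w => B.K1 k w y) x,
      fun x y => dirDeriv (B.normal x) (fun w => B.K2 k w y) x]]

/-- The layer potential `∫_{∂Ω} K(x, y) σ(y) dS(y)`. -/
def layerPotential (K : Plane → Plane → ℂ) (σ : Plane → ℂ) (x : Plane) : ℂ :=
  ∫ y, K x y * σ y ∂B.arcLength

/-- The integral over `∂Ω` without the part at distance at most `ε` from `x₀`. -/
def truncatedIntegral (K : Plane → Plane → ℂ) (σ : Plane → ℂ) (x₀ : Plane) (ε : ℝ) : ℂ :=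
  ∫ y in {y | ε < dist y x₀}, K x₀ y * σ y ∂B.arcLength

/-- The principal value integral at `x₀` converges to `v`. -/
def HasPV (K : Plane → Plane → ℂ) (σ : Plane → ℂ) (x₀ : Plane) (v : ℂ) : Prop :=
  Tendsto (B.truncatedIntegral K σ x₀) (𝓝[>] 0) (𝓝 v)

/-- The boundary operator `p.v. ∫_{∂Ω} K(x₀, y) σ(y) dS(y)`. -/
def bdryOp (K : Plane → Plane → ℂ) (σ : Plane → ℂ) (x₀ : Plane) : ℂ :=
  limUnder (𝓝[>] 0) (B.truncatedIntegral K σ x₀)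

/-- The kernel, off the diagonal of `∂Ω × ∂Ω`, is the restriction of a continuous function
on all of `∂Ω × ∂Ω`. -/
def IsContinuousKernel (K : Plane → Plane → ℂ) : Prop :=
  ∃ K' : Plane × Plane → ℂ, ContinuousOn K' (B.bdry ×ˢ B.bdry) ∧
    ∀ x ∈ B.bdry, ∀ y ∈ B.bdry, x ≠ y → K' (x, y) = K x y

/-- The representation `u = 𝒦₁[ρ₁] + 𝒦₂[ρ₂]`. -/
def representation (k : ℝ) (ρ : (Plane → ℂ) × (Plane → ℂ)) (x : Plane) : ℂ :=
  B.layerPotential (B.K1 k) ρ.1 x + B.layerPotential (B.K2 k) ρ.2 x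

end PlateGeometry

/-- The two sides from which the boundary is approached. -/
inductive Side
  | exterior
  | interior

/-- `+1` for the exterior, `-1` for the interior. -/
def Side.sign : Side → ℂ
  | .exterior => 1
  | .interior => -1

/-- The signed distance `h` along the outward normal tends to `0⁺` for the exterior limit and to
`0⁻` for the interior limit. -/
def Side.approach : Side → Filter ℝ
  | .exterior => 𝓝[>] 0
  | .interior => 𝓝[<] 0

namespace PlateGeometry

variable {M : ℕ} (B : PlateGeometry M)

/-- The limit of `F` at `x₀ ∈ ∂Ω` from the given side, along the normal, is `v`. -/
def HasSideLimit (side : Side) (F : Plane → ℂ) (x₀ : Plane) (v : ℂ) : Prop :=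
  Tendsto (fun h : ℝ => F (x₀ + h • B.normal x₀)) side.approach (𝓝 v)

/-- The jump part `(∓½ ρ₁, ±κ ρ₁ ∓ ½ ρ₂)` of the boundary integral system
(upper sign: exterior, lower sign: interior). -/
def jumpPart (side : Side) (ρ : (Plane → ℂ) × (Plane → ℂ)) (x : Plane) : ℂ × ℂ :=
  (-side.sign / 2 * ρ.1 x,
    side.sign * (B.curvature x : ℂ) * ρ.1 x - side.sign / 2 * ρ.2 x)

/-- The integral part `(𝒦₁₁ ρ₁ + 𝒦₁₂ ρ₂, 𝒦₂₁ ρ₁ + 𝒦₂₂ ρ₂)` of the boundary integral system. -/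
def integralPart (k : ℝ) (ρ : (Plane → ℂ) × (Plane → ℂ)) (x : Plane) : ℂ × ℂ :=
  (B.bdryOp (B.bdryKernel k 0 0) ρ.1 x + B.bdryOp (B.bdryKernel k 0 1) ρ.2 x,
    B.bdryOp (B.bdryKernel k 1 0) ρ.1 x + B.bdryOp (B.bdryKernel k 1 1) ρ.2 x)

end PlateGeometry

/-- The system `J ρ + K ρ = f` is second kind on `L²(μ) × L²(μ)`: `J` acts as a bounded operator
with bounded inverse, and `K` acts as a compact operator. -/
def IsSecondKind (μ : Measure Plane)
    (J K : (Plane → ℂ) × (Plane → ℂ) → Plane → ℂ × ℂ) : Prop :=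
  ∃ (D : (Lp ℂ 2 μ × Lp ℂ 2 μ) ≃L[ℂ] (Lp ℂ 2 μ × Lp ℂ 2 μ))
    (C : (Lp ℂ 2 μ × Lp ℂ 2 μ) →L[ℂ] (Lp ℂ 2 μ × Lp ℂ 2 μ)),
    IsCompactOperator C ∧
    (∀ ρ : Lp ℂ 2 μ × Lp ℂ 2 μ, ∀ᵐ x ∂μ, ((D ρ).1 x, (D ρ).2 x) = J (⇑ρ.1, ⇑ρ.2) x) ∧
    (∀ ρ : Lp ℂ 2 μ × Lp ℂ 2 μ, ∀ᵐ x ∂μ, ((C ρ).1 x, (C ρ).2 x) = K (⇑ρ.1, ⇑ρ.2) x)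

end

noncomputable section
open scoped ContDiff

/-! ### The Green's function as a radial profile -/

/-! Write `ρ = ‖x - y‖²`, `z = x - y`, and let `n` be the normal at `y`. The logarithms of `Y₀` and
`K₀` enter `G` only through `log · (I₀ - J₀)`, and `I₀ - J₀` has no quadratic term in `w = k²ρ/4`.
Hence `G = ρ log ρ / (16π) + ρ³ log ρ · A(ρ) + E(ρ)` with `A`, `E` smooth: the biharmonic
fundamental solution plus a remainder regular enough to survive all the derivatives taken
(`green_eq_log_series`, `exists_flexuralProfile`). After substituting the closed forms, the kernels
become explicit biharmonic parts (`singKer`) plus remainders continuous everywhere, `z = 0` included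
(`ker_eq_sing_add_rem`, `continuous_remKer`). Jumps can come only from the biharmonic parts.

The biharmonic part of `K₁` is `-(1/π) (z·n)³/|z|⁴`, that of `K₂` is `-(1/2π) (z·n)²/|z|²`. For two
points of the same boundary curve with parameter difference `t`, the chord has normal component
`O(t²)` and squared length comparable to `t²` while `t` stays within one period. All four boundary
kernels therefore extend continuously to the diagonal, and the principal values are ordinary
integrals (`continuousOn_kerExt`, `hasPV_bdryKernel`).

For the one-sided limits put the target at `x₀ + sη n(x₀)` with `s = ±1`, and parametrize the curve
through `x₀` by `t`. Each biharmonic kernel splits into a bounded part, which converges by dominated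
convergence to the boundary integral, and a part of the form `η/(t²+η²)` times a bounded factor,
which under `t = ηu` converges to an integral over the line of powers of `1/(1+u²)` times `σ(x₀)`.
Those integrals are the jumps. The normal derivative of the `K₁` part also contains a term of size
`η⁻²`; to leading order it is an exact `t`-derivative, so one integration by parts against a `C¹`
density removes it, and the first order corrections of the curve to that term contribute to the jump
`sκ` (`locKer_one_zero_split`, `tendsto_integral_dipole`). The pieces are collected in
`tendsto_integral_locKer` and transported to the boundary by `exists_localFrame`.

For the second kind property, a continuous kernel maps `L²` compactly into the continuous functions
by Arzelà–Ascoli, and the jump matrix is triangular with diagonal entries `∓½` and a bounded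
multiplication below. -/

theorem summable_of_abs_le_div_factorial {c : ℕ → ℝ} (hc : ∀ m, |c m| ≤ 2 / (m.factorial : ℝ))
    (w : ℝ) : Summable fun m => c m * w ^ m := by
  refine Summable.of_norm_bounded ((Real.summable_pow_div_factorial |w|).mul_left 2) fun m => ?_
  rw [norm_mul, Real.norm_eq_abs, norm_pow, Real.norm_eq_abs]
  calc |c m| * |w| ^ m ≤ 2 / (m.factorial : ℝ) * |w| ^ m := by gcongr; exact hc m
    _ = 2 * (|w| ^ m / m.factorial) := by ring

/-- The factorial bound makes the radius of convergence infinite. The same bound `2 / m!` serves all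
five series that occur: `J₀`, `I₀`, the two harmonic series, and the tail of `I₀ - J₀`. -/
theorem contDiff_tsum_mul_pow {c : ℕ → ℝ} (hc : ∀ m, |c m| ≤ 2 / (m.factorial : ℝ)) :
    ContDiff ℝ ∞ fun w : ℝ => ∑' m, c m * w ^ m := by
  have hr : (FormalMultilinearSeries.ofScalars ℝ c).radius = ⊤ := by
    refine FormalMultilinearSeries.radius_eq_top_of_summable_norm _ fun r => ?_
    have h := (summable_of_abs_le_div_factorial (c := fun m => |c m|) (by simpa using hc) r)
    refine h.congr fun m => ?_
    rw [FormalMultilinearSeries.ofScalars_norm, Real.norm_eq_abs]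
  have h := (FormalMultilinearSeries.ofScalars ℝ c).hasFPowerSeriesOnBall (by simp [hr])
  rw [hr] at h
  have he : (FormalMultilinearSeries.ofScalars ℝ c).sum = fun w : ℝ => ∑' m, c m * w ^ m :=
    FormalMultilinearSeries.ofScalarsSum_eq_tsum c
  rw [he] at h
  have ha : AnalyticOnNhd ℝ (fun w : ℝ => ∑' m, c m * w ^ m) univ := by
    have := h.analyticOnNhd
    simpa using this
  exact ha.contDiff

theorem harmonic_le_factorial (m : ℕ) : |((harmonic m : ℚ) : ℝ)| ≤ m.factorial := by
  have h : ∀ m : ℕ, 0 ≤ harmonic m ∧ harmonic m ≤ m := by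
    intro m
    induction m with
    | zero => simp
    | succ k ih =>
      rw [harmonic_succ]
      have h1 : ((k + 1 : ℕ) : ℚ)⁻¹ ≤ 1 := inv_le_one_of_one_le₀ (by simp)
      have h2 : 0 ≤ ((k + 1 : ℕ) : ℚ)⁻¹ := by positivity
      push_cast at *
      constructor <;> linarith [ih.1, ih.2]
  have h1 : (0 : ℝ) ≤ (harmonic m : ℚ) := by exact_mod_cast (h m).1
  have h2 : ((harmonic m : ℚ) : ℝ) ≤ (m : ℝ) := by exact_mod_cast (h m).2
  rw [abs_of_nonneg h1]
  exact h2.trans (by exact_mod_cast Nat.self_le_factorial m)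

theorem abs_div_factorial_sq_le {a : ℝ} {m : ℕ} (ha : |a| ≤ 2 * m.factorial) :
    |a / (m.factorial : ℝ) ^ 2| ≤ 2 / (m.factorial : ℝ) := by
  have hp : (0 : ℝ) < m.factorial := by positivity
  rw [abs_div, abs_of_pos (pow_pos hp 2), div_le_div_iff₀ (by positivity) hp]
  nlinarith

/-- The coefficients of the power series of `I₀ - J₀` beyond the leading term. -/
def besselDiffCoeff (m : ℕ) : ℝ := (1 - (-1) ^ (m + 3)) / ((m + 3).factorial : ℝ) ^ 2

theorem abs_one_sub_neg_one_pow_le (m : ℕ) : |1 - (-1 : ℝ) ^ m| ≤ 2 := by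
  rcases neg_one_pow_eq_or ℝ m with h | h <;> rw [h] <;> norm_num

theorem one_le_factorial_cast (m : ℕ) : (1 : ℝ) ≤ m.factorial := by
  exact_mod_cast Nat.one_le_iff_ne_zero.2 (Nat.factorial_ne_zero m)

theorem abs_besselDiffCoeff_le (m : ℕ) : |besselDiffCoeff m| ≤ 2 / (m.factorial : ℝ) := by
  have h : |besselDiffCoeff m| ≤ 2 / ((m + 3).factorial : ℝ) :=
    abs_div_factorial_sq_le ((abs_one_sub_neg_one_pow_le _).trans
      (by linarith [one_le_factorial_cast (m + 3)]))
  refine h.trans ?_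
  gcongr
  omega

/-- The factor in front of the logarithm is `(I₀ - J₀) / (4πk²)`. Its linear term produces the
biharmonic `ρ log ρ / (16π)`; the missing quadratic term is what puts `ρ³`, not `ρ²`, in front of
`A`. A term `ρ² log ρ` would leave a logarithm in the second `ρ`-derivative. -/
theorem green_eq_log_series (k : ℝ) (hk : 0 < k) :
    ∃ A E : ℝ → ℂ, ContDiff ℝ ∞ A ∧ ContDiff ℝ ∞ E ∧ ∀ x y : Plane,
      flexuralGreen k x y = 1 / (16 * (Real.pi : ℂ)) * ((‖x - y‖ ^ 2 : ℝ) : ℂ) *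
          (Real.log (‖x - y‖ ^ 2) : ℂ)
        + ((‖x - y‖ ^ 2 : ℝ) : ℂ) ^ 3 * (Real.log (‖x - y‖ ^ 2) : ℂ) * A (‖x - y‖ ^ 2)
        + E (‖x - y‖ ^ 2) := by
  set cJ : ℕ → ℝ := fun m => (-1) ^ m / (m.factorial : ℝ) ^ 2 with hcJ
  set cI : ℕ → ℝ := fun m => 1 / (m.factorial : ℝ) ^ 2 with hcI
  set cY : ℕ → ℝ := fun m => (-1) ^ m * ((harmonic m : ℚ) : ℝ) / (m.factorial : ℝ) ^ 2 with hcY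
  set cK : ℕ → ℝ := fun m => ((harmonic m : ℚ) : ℝ) / (m.factorial : ℝ) ^ 2 with hcK
  have bJ : ∀ m, |cJ m| ≤ 2 / (m.factorial : ℝ) := fun m =>
    abs_div_factorial_sq_le (by
      rw [abs_pow, abs_neg, abs_one, one_pow]; linarith [one_le_factorial_cast m])
  have bI : ∀ m, |cI m| ≤ 2 / (m.factorial : ℝ) := fun m =>
    abs_div_factorial_sq_le (by rw [abs_one]; linarith [one_le_factorial_cast m])
  have bY : ∀ m, |cY m| ≤ 2 / (m.factorial : ℝ) := fun m =>
    abs_div_factorial_sq_le (by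
      rw [abs_mul, abs_pow, abs_neg, abs_one, one_pow, one_mul]
      linarith [one_le_factorial_cast m, harmonic_le_factorial m])
  have bK : ∀ m, |cK m| ≤ 2 / (m.factorial : ℝ) := fun m =>
    abs_div_factorial_sq_le (by linarith [one_le_factorial_cast m, harmonic_le_factorial m])
  set J : ℝ → ℝ := fun w => ∑' m, cJ m * w ^ m
  set I : ℝ → ℝ := fun w => ∑' m, cI m * w ^ m
  set SY : ℝ → ℝ := fun w => ∑' m, cY m * w ^ m
  set SK : ℝ → ℝ := fun w => ∑' m, cK m * w ^ m
  set D : ℝ → ℝ := fun w => ∑' m, besselDiffCoeff m * w ^ m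
  have hJ : ContDiff ℝ ∞ J := contDiff_tsum_mul_pow bJ
  have hI : ContDiff ℝ ∞ I := contDiff_tsum_mul_pow bI
  have hSY : ContDiff ℝ ∞ SY := contDiff_tsum_mul_pow bY
  have hSK : ContDiff ℝ ∞ SK := contDiff_tsum_mul_pow bK
  have hD : ContDiff ℝ ∞ D := contDiff_tsum_mul_pow abs_besselDiffCoeff_le
  -- The orders `m = 0` and `m = 2` cancel because `(-1)^m = 1`; the order `m = 1` contributes `2w`.
  have hIJ : ∀ w, I w - J w = 2 * w + w ^ 3 * D w := by
    intro w
    have s1 := summable_of_abs_le_div_factorial bI w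
    have s2 := summable_of_abs_le_div_factorial bJ w
    have h0 : I w - J w = ∑' m, (cI m - cJ m) * w ^ m := by
      simp only [I, J]
      rw [← s1.tsum_sub s2]
      exact tsum_congr fun m => by ring
    have s3 : Summable fun m => (cI m - cJ m) * w ^ m :=
      (s1.sub s2).congr fun m => by ring
    rw [h0, ← s3.sum_add_tsum_nat_add 3]
    have h3 : ∀ m, (cI (m + 3) - cJ (m + 3)) * w ^ (m + 3)
        = w ^ 3 * (besselDiffCoeff m * w ^ m) := fun m => by
      simp only [hcI, hcJ, besselDiffCoeff]; ring
    rw [tsum_congr h3, tsum_mul_left, show (∑' m, besselDiffCoeff m * w ^ m) = D w from rfl]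
    simp only [Finset.sum_range_succ, Finset.sum_range_zero, hcI, hcJ]
    norm_num [Nat.factorial]
  set b : ℝ := k ^ 2 / 4 with hb
  have hbpos : 0 < b := by positivity
  set γ₀ := Real.eulerMascheroniConstant
  have lift : ∀ {f : ℝ → ℝ}, ContDiff ℝ ∞ f → ContDiff ℝ ∞ fun ρ : ℝ => ((f (b * ρ) : ℝ) : ℂ) :=
    fun hf => Complex.ofRealCLM.contDiff.comp (hf.comp (contDiff_const.mul contDiff_id))
  refine ⟨fun ρ => (b : ℂ) ^ 3 / (8 * Real.pi * (k : ℂ) ^ 2) * ((D (b * ρ) : ℝ) : ℂ),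
    fun ρ => 1 / (2 * (k : ℂ) ^ 2) * (Complex.I / 4 * ((J (b * ρ) : ℝ) : ℂ)
      + (1 / (2 * Real.pi)) * ((((SY (b * ρ) : ℝ) : ℂ) - ((SK (b * ρ) : ℝ) : ℂ))
      + (Real.log b / 2 + γ₀) * (((I (b * ρ) : ℝ) : ℂ) - ((J (b * ρ) : ℝ) : ℂ)))),
    contDiff_const.mul (lift hD), ?_, ?_⟩
  · refine contDiff_const.mul ((contDiff_const.mul (lift hJ)).add (contDiff_const.mul
      (((lift hSY).sub (lift hSK)).add (contDiff_const.mul ((lift hI).sub (lift hJ))))))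
  · intro x y
    set r := ‖x - y‖
    have hw : (k * r) ^ 2 / 4 = b * r ^ 2 := by rw [hb]; ring
    have e1 : besselJ0 (k * r) = J (b * r ^ 2) := by
      simp only [besselJ0, J, hw, hcJ]; exact tsum_congr fun m => by ring
    have e2 : besselI0 (k * r) = I (b * r ^ 2) := by
      simp only [besselI0, I, hw, hcI]; exact tsum_congr fun m => by ring
    have e3 : (∑' m : ℕ, (-1) ^ m * ((harmonic m : ℚ) : ℝ) * ((k * r) ^ 2 / 4) ^ m
        / (m.factorial : ℝ) ^ 2) = SY (b * r ^ 2) := by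
      simp only [SY, hw, hcY]; exact tsum_congr fun m => by ring
    have e4 : (∑' m : ℕ, ((harmonic m : ℚ) : ℝ) * ((k * r) ^ 2 / 4) ^ m
        / (m.factorial : ℝ) ^ 2) = SK (b * r ^ 2) := by
      simp only [SK, hw, hcK]; exact tsum_congr fun m => by ring
    have hIc : (I (b * r ^ 2) : ℂ) = J (b * r ^ 2) + 2 * (b * (r : ℂ) ^ 2)
        + (b * (r : ℂ) ^ 2) ^ 3 * D (b * r ^ 2) := by
      have := hIJ (b * r ^ 2)
      have h2 : I (b * r ^ 2) = J (b * r ^ 2) + 2 * (b * r ^ 2)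
          + (b * r ^ 2) ^ 3 * D (b * r ^ 2) := by linarith
      rw [h2]; push_cast; ring
    beta_reduce
    rw [flexuralGreen, hankelH0, besselY0, besselK0, e1, e2, e3, e4]
    have hpi : (Real.pi : ℂ) ≠ 0 := by exact_mod_cast Real.pi_ne_zero
    have hkc : (k : ℂ) ≠ 0 := by exact_mod_cast hk.ne'
    -- On the diagonal `Real.log 0 = 0`, so splitting `log (k r / 2)` into `log b` and `log r²`
    -- fails. The identity survives because the logarithmic factors multiply `I - J`, which vanishes
    -- there.
    rcases (norm_nonneg (x - y)).eq_or_lt with h0 | hpos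
    · have hr : r = 0 := h0.symm
      have hJ0 : I (b * 0) = J (b * 0) := by have := hIJ (b * 0); norm_num at this ⊢; linarith
      have hr2 : b * r ^ 2 = b * 0 := by rw [hr]; ring
      rw [hr2, hJ0, hr]
      simp only [mul_zero]
      push_cast
      field_simp
      ring_nf
      simp only [Complex.I_sq]
      ring
    · have hr : 0 < r := hpos
      have hlog : Real.log (k * r / 2) = Real.log b / 2 + Real.log (r ^ 2) / 2 := by
        have : b * r ^ 2 = (k * r / 2) ^ 2 := by rw [hb]; ring
        have h := congrArg Real.log this
        rw [Real.log_mul hbpos.ne' (by positivity), Real.log_pow (n := 2) (k * r / 2)] at h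
        push_cast at h
        linarith
      rw [hlog]
      push_cast
      rw [hIc]
      have hbc : (b : ℂ) = (k : ℂ) ^ 2 / 4 := by rw [hb]; push_cast; ring
      rw [hbc]
      field_simp
      ring_nf
      simp only [Complex.I_sq]
      ring

/-- The class "`ρ^p log ρ` times smooth, plus smooth" is stable under differentiation at the cost of
one power of `ρ`. -/
theorem hasDerivAt_pow_mul_log_mul {A E : ℝ → ℂ} (hA : ContDiff ℝ ∞ A) (hE : ContDiff ℝ ∞ E)
    (p : ℕ) {ρ : ℝ} (hρ : 0 < ρ) :
    HasDerivAt (fun ρ : ℝ => (ρ : ℂ) ^ (p + 1) * (Real.log ρ : ℂ) * A ρ + E ρ)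
      ((ρ : ℂ) ^ p * (Real.log ρ : ℂ) * (((p + 1 : ℕ) : ℂ) * A ρ + (ρ : ℂ) * deriv A ρ)
        + ((ρ : ℂ) ^ p * A ρ + deriv E ρ)) ρ := by
  have h1 : HasDerivAt (fun ρ : ℝ => (ρ : ℂ)) 1 ρ := Complex.ofRealCLM.hasDerivAt
  have h2 : HasDerivAt (fun ρ : ℝ => (Real.log ρ : ℂ)) ((ρ⁻¹ : ℝ) : ℂ) ρ :=
    (Real.hasDerivAt_log hρ.ne').ofReal_comp
  have hA' : HasDerivAt A (deriv A ρ) ρ := (hA.differentiable (by simp) ρ).hasDerivAt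
  have hE' : HasDerivAt E (deriv E ρ) ρ := (hE.differentiable (by simp) ρ).hasDerivAt
  have hne : (ρ : ℂ) ≠ 0 := by exact_mod_cast hρ.ne'
  refine ((((h1.pow (p + 1)).mul h2).mul hA').add hE').congr_deriv ?_
  simp only [Pi.mul_apply, Pi.pow_apply, Nat.add_sub_cancel]
  push_cast
  field_simp
  ring

/-- The Green's function of `Δ² - k⁴` as a function of the squared distance, with its derivatives
split into those of the biharmonic fundamental solution `ρ log ρ / (16 π)` and a more regular
remainder. -/
structure FlexuralProfile where
  φ₀ : ℝ → ℂ
  φ₁ : ℝ → ℂ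
  φ₂ : ℝ → ℂ
  φ₃ : ℝ → ℂ
  φ₄ : ℝ → ℂ
  a : ℝ → ℂ
  b : ℝ → ℂ
  d : ℝ → ℂ
  deriv₀ : ∀ ρ, 0 < ρ → HasDerivAt φ₀ (φ₁ ρ) ρ
  deriv₁ : ∀ ρ, 0 < ρ → HasDerivAt φ₁ (φ₂ ρ) ρ
  deriv₂ : ∀ ρ, 0 < ρ → HasDerivAt φ₂ (φ₃ ρ) ρ
  deriv₃ : ∀ ρ, 0 < ρ → HasDerivAt φ₃ (φ₄ ρ) ρ
  cont_a : Continuous a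
  cont_b : Continuous b
  cont_d : Continuous d
  b_zero : b 0 = 0
  d_zero : d 0 = 0
  φ₂_eq : ∀ ρ : ℝ, 0 < ρ → φ₂ ρ = 1 / (16 * (Real.pi : ℂ)) / ρ + a ρ
  φ₃_eq : ∀ ρ : ℝ, 0 < ρ → φ₃ ρ = -(1 / (16 * (Real.pi : ℂ))) / (ρ : ℂ) ^ 2 + b ρ / ρ
  φ₄_eq : ∀ ρ : ℝ, 0 < ρ →
    φ₄ ρ = 2 * (1 / (16 * (Real.pi : ℂ))) / (ρ : ℂ) ^ 3 + d ρ / (ρ : ℂ) ^ 2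

theorem exists_flexuralProfile (k : ℝ) (hk : 0 < k) :
    ∃ Q : FlexuralProfile, ∀ x y : Plane, flexuralGreen k x y = Q.φ₀ (‖x - y‖ ^ 2) := by
  obtain ⟨A, E, hA, hE, hG⟩ := green_eq_log_series k hk
  have cid : ContDiff ℝ ∞ fun ρ : ℝ => (ρ : ℂ) := Complex.ofRealCLM.contDiff
  have step : ∀ (p : ℕ) (A E : ℝ → ℂ), ContDiff ℝ ∞ A → ContDiff ℝ ∞ E → ∃ A' E' : ℝ → ℂ,
      ContDiff ℝ ∞ A' ∧ ContDiff ℝ ∞ E' ∧ ∀ ρ : ℝ, 0 < ρ →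
      HasDerivAt (fun ρ : ℝ => (ρ : ℂ) ^ (p + 1) * (Real.log ρ : ℂ) * A ρ + E ρ)
        ((ρ : ℂ) ^ p * (Real.log ρ : ℂ) * A' ρ + E' ρ) ρ := by
    intro p A E hA hE
    have hdA : ContDiff ℝ ∞ (deriv A) := (contDiff_infty_iff_deriv.1 hA).2
    have hdE : ContDiff ℝ ∞ (deriv E) := (contDiff_infty_iff_deriv.1 hE).2
    exact ⟨_, _, (contDiff_const.mul hA).add (cid.mul hdA), ((cid.pow p).mul hA).add hdE,
      fun ρ hρ => hasDerivAt_pow_mul_log_mul hA hE p hρ⟩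
  -- The power `ρ³` allows exactly three such steps; the fourth derivative contains `1/ρ` and is
  -- written out by hand.
  obtain ⟨A1, E1, hA1, hE1, d0⟩ := step 2 A E hA hE
  obtain ⟨A2, E2, hA2, hE2, d1⟩ := step 1 A1 E1 hA1 hE1
  obtain ⟨A3, E3, hA3, hE3, d2⟩ := step 0 A2 E2 hA2 hE2
  have hdA : Continuous (deriv A3) := hA3.continuous_deriv (by simp)
  have hdE : Continuous (deriv E3) := hE3.continuous_deriv (by simp)
  set c : ℂ := 1 / (16 * (Real.pi : ℂ))
  have hid : ∀ ρ : ℝ, HasDerivAt (fun ρ : ℝ => (ρ : ℂ)) 1 ρ := fun ρ =>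
    Complex.ofRealCLM.hasDerivAt
  have hlog : ∀ ρ : ℝ, 0 < ρ → HasDerivAt (fun ρ : ℝ => (Real.log ρ : ℂ)) ((ρ : ℂ)⁻¹) ρ :=
    fun ρ hρ => by
      have := (Real.hasDerivAt_log hρ.ne').ofReal_comp
      push_cast at this
      exact this
  have hmlog : Continuous fun ρ : ℝ => (ρ : ℂ) * (Real.log ρ : ℂ) := by
    have := Complex.continuous_ofReal.comp Real.continuous_mul_log
    simpa [Function.comp_def] using this
  have hne : ∀ ρ : ℝ, 0 < ρ → (ρ : ℂ) ≠ 0 := fun ρ hρ => by exact_mod_cast hρ.ne'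
  have ccid : Continuous fun ρ : ℝ => (ρ : ℂ) := Complex.continuous_ofReal
  refine ⟨{
    φ₀ := fun ρ => c * (ρ : ℂ) * (Real.log ρ : ℂ)
      + ((ρ : ℂ) ^ 3 * (Real.log ρ : ℂ) * A ρ + E ρ)
    φ₁ := fun ρ => c * (Real.log ρ : ℂ) + c + ((ρ : ℂ) ^ 2 * (Real.log ρ : ℂ) * A1 ρ + E1 ρ)
    φ₂ := fun ρ => c * (ρ : ℂ)⁻¹ + ((ρ : ℂ) ^ 1 * (Real.log ρ : ℂ) * A2 ρ + E2 ρ)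
    φ₃ := fun ρ => -c * ((ρ : ℂ) ^ 2)⁻¹ + ((ρ : ℂ) ^ 0 * (Real.log ρ : ℂ) * A3 ρ + E3 ρ)
    φ₄ := fun ρ => 2 * c * ((ρ : ℂ) ^ 3)⁻¹
      + ((ρ : ℂ)⁻¹ * A3 ρ + (Real.log ρ : ℂ) * deriv A3 ρ + deriv E3 ρ)
    -- `a`, `b`, `d` are the remainders of `φ₂`, `φ₃`, `φ₄` multiplied by `1`, `ρ`, `ρ²`. Continuity
    -- at `0` rests on that of `ρ log ρ`, and the extra powers make `b` and `d` vanish there.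
    a := fun ρ => (ρ : ℂ) * (Real.log ρ : ℂ) * A2 ρ + E2 ρ
    b := fun ρ => (ρ : ℂ) * (Real.log ρ : ℂ) * A3 ρ + ρ * E3 ρ
    d := fun ρ => ρ * A3 ρ + ρ * ((ρ : ℂ) * (Real.log ρ : ℂ)) * deriv A3 ρ
      + (ρ : ℂ) ^ 2 * deriv E3 ρ
    deriv₀ := fun ρ hρ => ?_
    deriv₁ := fun ρ hρ => ?_
    deriv₂ := fun ρ hρ => ?_
    deriv₃ := fun ρ hρ => ?_
    cont_a := (hmlog.mul hA2.continuous).add hE2.continuous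
    cont_b := (hmlog.mul hA3.continuous).add (ccid.mul hE3.continuous)
    cont_d := ((ccid.mul hA3.continuous).add ((ccid.mul hmlog).mul hdA)).add
      ((ccid.pow 2).mul hdE)
    b_zero := by simp
    d_zero := by simp
    φ₂_eq := fun ρ hρ => by simp only [pow_one]; ring
    φ₃_eq := fun ρ hρ => by
      have := hne ρ hρ
      change _ = -c / (ρ : ℂ) ^ 2 + _
      field_simp
    φ₄_eq := fun ρ hρ => by
      have := hne ρ hρ
      change _ = 2 * c / (ρ : ℂ) ^ 3 + _
      field_simp }, fun x y => ?_⟩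
  · refine ((((hid ρ).const_mul c).mul (hlog ρ hρ)).add (d0 ρ hρ)).congr_deriv ?_
    have := hne ρ hρ
    field_simp
  · refine ((((hlog ρ hρ).const_mul c).add_const c).add (d1 ρ hρ)).congr_deriv ?_
    have := hne ρ hρ
    field_simp
  · refine ((((hid ρ).inv (hne ρ hρ)).const_mul c).add (d2 ρ hρ)).congr_deriv ?_
    have := hne ρ hρ
    field_simp
  · have hA' : HasDerivAt A3 (deriv A3 ρ) ρ := (hA3.differentiable (by simp) ρ).hasDerivAt
    have hE' : HasDerivAt E3 (deriv E3 ρ) ρ := (hE3.differentiable (by simp) ρ).hasDerivAt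
    have h := (((((hid ρ).pow 2).inv (pow_ne_zero 2 (hne ρ hρ))).const_mul (-c)).add
      (((hlog ρ hρ).mul hA').add hE'))
    refine (h.congr_of_eventuallyEq (Eventually.of_forall fun ρ => ?_)).congr_deriv ?_
    · simp
    · have := hne ρ hρ
      simp only [Pi.pow_apply]
      field_simp
      simp
      ring
  · rw [hG]
    push_cast
    ring

end

noncomputable section
open scoped ContDiff

/-! ### Closed forms of the kernels -/

/-- `f` is differentiable at `p`, with derivative `d` in the direction `v`. -/
def HasDirDeriv (f : Plane → ℂ) (v p : Plane) (d : ℂ) : Prop :=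
  ∃ f' : Plane →L[ℝ] ℂ, HasFDerivAt f f' p ∧ f' v = d

namespace HasDirDeriv

variable {f g : Plane → ℂ} {v p : Plane} {d e : ℂ}

theorem dirDeriv (h : HasDirDeriv f v p d) : dirDeriv v f p = d := by
  obtain ⟨f', h, rfl⟩ := h
  rw [_root_.dirDeriv, h.fderiv]

theorem congr (h : HasDirDeriv f v p d) (hd : d = e) (hfg : g =ᶠ[𝓝 p] f) :
    HasDirDeriv g v p e := by
  obtain ⟨f', h, rfl⟩ := h
  exact ⟨f', h.congr_of_eventuallyEq hfg, hd⟩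

theorem add (hf : HasDirDeriv f v p d) (hg : HasDirDeriv g v p e) :
    HasDirDeriv (fun q => f q + g q) v p (d + e) := by
  obtain ⟨f', hf, rfl⟩ := hf
  obtain ⟨g', hg, rfl⟩ := hg
  exact ⟨f' + g', hf.add hg, rfl⟩

theorem mul (hf : HasDirDeriv f v p d) (hg : HasDirDeriv g v p e) :
    HasDirDeriv (fun q => f q * g q) v p (f p * e + g p * d) := by
  obtain ⟨f', hf, rfl⟩ := hf
  obtain ⟨g', hg, rfl⟩ := hg
  exact ⟨f p • g' + g p • f', hf.mul hg, by simp⟩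

theorem const (c : ℂ) : HasDirDeriv (fun _ => c) v p 0 :=
  ⟨0, hasFDerivAt_const c p, rfl⟩

theorem const_mul (c : ℂ) (hf : HasDirDeriv f v p d) :
    HasDirDeriv (fun q => c * f q) v p (c * d) :=
  ((const c).mul hf).congr (by ring) (Eventually.of_forall fun _ => rfl)

theorem pow (hf : HasDirDeriv f v p d) (m : ℕ) :
    HasDirDeriv (fun q => f q ^ (m + 1)) v p ((m + 1 : ℕ) * f p ^ m * d) := by
  induction m with
  | zero => exact hf.congr (by simp) (Eventually.of_forall fun _ => by simp)
  | succ k ih =>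
    refine (ih.mul hf).congr ?_ (Eventually.of_forall fun q => pow_succ (f q) (k + 1))
    push_cast
    ring

/-- The sign `ε` lets one rule serve derivatives in the source (`Z q = x - q`, `ε = -1`) and in the
target (`Z q = q - y`, `ε = 1`). -/
theorem inner_left {Z : Plane → Plane} {ε : ℝ}
    (hZ : HasFDerivAt Z (ε • ContinuousLinearMap.id ℝ Plane) p) (a : Plane) :
    HasDirDeriv (fun q => ((inner ℝ (Z q) a : ℝ) : ℂ)) v p ((ε * inner ℝ v a : ℝ) : ℂ) := by
  have h := Complex.ofRealCLM.hasFDerivAt.comp p (hZ.inner ℝ (hasFDerivAt_const a p))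
  exact ⟨_, h, by simp [inner_smul_left]⟩

theorem radial {Z : Plane → Plane} {ε : ℝ}
    (hZ : HasFDerivAt Z (ε • ContinuousLinearMap.id ℝ Plane) p) {φ : ℝ → ℂ} {φ' : ℂ}
    (hφ : HasDerivAt φ φ' (‖Z p‖ ^ 2)) :
    HasDirDeriv (fun q => φ (‖Z q‖ ^ 2)) v p (((2 * ε * inner ℝ (Z p) v : ℝ) : ℂ) * φ') := by
  have h := hφ.hasFDerivAt.comp p hZ.norm_sq
  exact ⟨_, h, by simp [mul_assoc]⟩

end HasDirDeriv

theorem hasFDerivAt_const_sub_plane (x y : Plane) :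
    HasFDerivAt (fun q => x - q) ((-1 : ℝ) • ContinuousLinearMap.id ℝ Plane) y := by
  refine ((hasFDerivAt_id (𝕜 := ℝ) y).const_sub x).congr_fderiv ?_
  ext v
  simp

theorem hasFDerivAt_sub_const_plane (x y : Plane) :
    HasFDerivAt (fun q => q - y) ((1 : ℝ) • ContinuousLinearMap.id ℝ Plane) x := by
  simpa using (hasFDerivAt_id (𝕜 := ℝ) x).sub_const y

theorem norm_sub_sq_pos {x y : Plane} (h : x ≠ y) : 0 < ‖x - y‖ ^ 2 :=
  pow_pos (norm_pos_iff.2 (sub_ne_zero.2 h)) 2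

namespace FlexuralProfile

variable (Q : FlexuralProfile)

/-- The closed form of `K₁` at `x - y = z`, `n(y) = n`. -/
def kerOne (z n : Plane) : ℂ :=
  -24 * (inner ℝ z n : ℝ) * (Q.φ₂ (‖z‖ ^ 2) + ((‖z‖ ^ 2 : ℝ) : ℂ) * Q.φ₃ (‖z‖ ^ 2))
    + 16 * Q.φ₃ (‖z‖ ^ 2) * ((inner ℝ z n : ℝ) : ℂ) ^ 3

/-- The closed form of `K₂`. -/
def kerTwo (z n : Plane) : ℂ :=
  4 * Q.φ₂ (‖z‖ ^ 2) * (((‖z‖ ^ 2 : ℝ) : ℂ) - 2 * ((inner ℝ z n : ℝ) : ℂ) ^ 2)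

/-- The closed form of the derivative of `K₁` in the target, in the direction `v`. -/
def derivKerOne (z n v : Plane) : ℂ :=
  -24 * (inner ℝ v n : ℝ) * (Q.φ₂ (‖z‖ ^ 2) + ((‖z‖ ^ 2 : ℝ) : ℂ) * Q.φ₃ (‖z‖ ^ 2))
    - 48 * (inner ℝ z n : ℝ) * (inner ℝ z v : ℝ)
        * (2 * Q.φ₃ (‖z‖ ^ 2) + ((‖z‖ ^ 2 : ℝ) : ℂ) * Q.φ₄ (‖z‖ ^ 2))
    + 32 * Q.φ₄ (‖z‖ ^ 2) * (inner ℝ z v : ℝ) * ((inner ℝ z n : ℝ) : ℂ) ^ 3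
    + 48 * Q.φ₃ (‖z‖ ^ 2) * ((inner ℝ z n : ℝ) : ℂ) ^ 2 * (inner ℝ v n : ℝ)

/-- The closed form of the derivative of `K₂` in the target, in the direction `v`. -/
def derivKerTwo (z n v : Plane) : ℂ :=
  8 * Q.φ₃ (‖z‖ ^ 2) * (inner ℝ z v : ℝ)
      * (((‖z‖ ^ 2 : ℝ) : ℂ) - 2 * ((inner ℝ z n : ℝ) : ℂ) ^ 2)
    + 4 * Q.φ₂ (‖z‖ ^ 2) * (2 * (inner ℝ z v : ℝ) - 4 * (inner ℝ z n : ℝ) * (inner ℝ v n : ℝ))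

theorem ofReal_sq_hasDerivAt (r : ℝ) : HasDerivAt (fun ρ : ℝ => (ρ : ℂ)) 1 r :=
  Complex.ofRealCLM.hasDerivAt

theorem hasDirDeriv_kerOne {x y : Plane} (h : x ≠ y) (n v : Plane) :
    HasDirDeriv (fun w => Q.kerOne (w - y) n) v x (Q.derivKerOne (x - y) n v) := by
  have hρ := norm_sub_sq_pos h
  have hZ := hasFDerivAt_sub_const_plane x y
  have h1 := HasDirDeriv.inner_left (v := v) hZ n
  have h2 := HasDirDeriv.radial (v := v) hZ (Q.deriv₂ _ hρ)
  have h3 := HasDirDeriv.radial (v := v) hZ (Q.deriv₃ _ hρ)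
  have h4 := HasDirDeriv.radial (v := v) hZ (ofReal_sq_hasDerivAt (‖x - y‖ ^ 2))
  refine (((h1.const_mul (-24)).mul (h2.add (h4.mul h3))).add
    ((h3.const_mul 16).mul (h1.pow 2))).congr ?_ (Eventually.of_forall fun w => rfl)
  simp only [derivKerOne]
  push_cast
  ring

theorem hasDirDeriv_kerTwo {x y : Plane} (h : x ≠ y) (n v : Plane) :
    HasDirDeriv (fun w => Q.kerTwo (w - y) n) v x (Q.derivKerTwo (x - y) n v) := by
  have hρ := norm_sub_sq_pos h
  have hZ := hasFDerivAt_sub_const_plane x y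
  have h1 := HasDirDeriv.inner_left (v := v) hZ n
  have h2 := HasDirDeriv.radial (v := v) hZ (Q.deriv₂ _ hρ)
  have h4 := HasDirDeriv.radial (v := v) hZ (ofReal_sq_hasDerivAt (‖x - y‖ ^ 2))
  refine ((h2.const_mul 4).mul (h4.add ((h1.pow 1).const_mul (-2)))).congr ?_
    (Eventually.of_forall fun w => ?_)
  · simp only [derivKerTwo]
    push_cast
    ring
  · simp only [kerTwo]
    push_cast
    ring

theorem dirDeriv_radial_source {G : Plane → Plane → ℂ} (hG : ∀ x y, G x y = Q.φ₀ (‖x - y‖ ^ 2))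
    {x y : Plane} (h : x ≠ y) (a : Plane) :
    dirDeriv a (fun z => G x z) y = -2 * (inner ℝ (x - y) a : ℝ) * Q.φ₁ (‖x - y‖ ^ 2) := by
  have hZ := hasFDerivAt_const_sub_plane x y
  refine ((HasDirDeriv.radial (v := a) hZ (Q.deriv₀ _ (norm_sub_sq_pos h))).congr ?_
    (Eventually.of_forall fun w => hG x w)).dirDeriv
  push_cast
  ring

theorem eventually_ne_source {x y : Plane} (h : x ≠ y) : ∀ᶠ z in 𝓝 y, x ≠ z :=
  (eventually_ne_nhds (Ne.symm h)).mono fun _ hz => Ne.symm hz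

theorem dirDeriv_dirDeriv_radial_source {G : Plane → Plane → ℂ}
    (hG : ∀ x y, G x y = Q.φ₀ (‖x - y‖ ^ 2)) {x y : Plane} (h : x ≠ y) (a : Plane)
    (ha : inner ℝ a a = (1 : ℝ)) :
    dirDeriv a (dirDeriv a (fun z => G x z)) y =
      4 * Q.φ₂ (‖x - y‖ ^ 2) * ((inner ℝ (x - y) a : ℝ) : ℂ) ^ 2 + 2 * Q.φ₁ (‖x - y‖ ^ 2) := by
  have hZ := hasFDerivAt_const_sub_plane x y
  refine ((((HasDirDeriv.inner_left (v := a) hZ a).const_mul (-2)).mul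
    (HasDirDeriv.radial (v := a) hZ (Q.deriv₁ _ (norm_sub_sq_pos h)))).congr ?_
    ((eventually_ne_source h).mono fun w hw => Q.dirDeriv_radial_source hG hw a)).dirDeriv
  rw [ha]
  push_cast
  ring

theorem dirDeriv_dirDeriv_dirDeriv_radial_source {G : Plane → Plane → ℂ}
    (hG : ∀ x y, G x y = Q.φ₀ (‖x - y‖ ^ 2)) {x y : Plane} (h : x ≠ y) (a n : Plane)
    (ha : inner ℝ a a = (1 : ℝ)) :
    dirDeriv n (dirDeriv a (dirDeriv a (fun z => G x z))) y =
      -8 * Q.φ₃ (‖x - y‖ ^ 2) * (inner ℝ (x - y) n : ℝ) * ((inner ℝ (x - y) a : ℝ) : ℂ) ^ 2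
      - 8 * Q.φ₂ (‖x - y‖ ^ 2) * (inner ℝ (x - y) a : ℝ) * (inner ℝ n a : ℝ)
      - 4 * Q.φ₂ (‖x - y‖ ^ 2) * (inner ℝ (x - y) n : ℝ) := by
  have hZ := hasFDerivAt_const_sub_plane x y
  have h1 := HasDirDeriv.inner_left (v := n) hZ a
  have h2 := HasDirDeriv.radial (v := n) hZ (Q.deriv₂ _ (norm_sub_sq_pos h))
  have h3 := HasDirDeriv.radial (v := n) hZ (Q.deriv₁ _ (norm_sub_sq_pos h))
  refine ((((h2.const_mul 4).mul (h1.pow 1)).add (h3.const_mul 2)).congr ?_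
    ((eventually_ne_source h).mono fun w hw =>
      Q.dirDeriv_dirDeriv_radial_source hG hw a ha)).dirDeriv
  push_cast
  ring

end FlexuralProfile

namespace PlateGeometry

variable {M : ℕ} (B : PlateGeometry M)

theorem exists_param {y : Plane} (hy : y ∈ B.bdry) : ∃ i s, B.γ i s = y := by
  simpa [bdry] using hy

theorem γ_mem_bdry (i : Fin M) (s : ℝ) : B.γ i s ∈ B.bdry :=
  mem_iUnion.2 ⟨i, mem_range_self s⟩

/-- Rotation by `-π/2`, taking the unit tangent to the outward normal. -/
def rotate (t : Plane) : Plane := !₂[t 1, -t 0]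

theorem inner_plane (a b : Plane) : inner ℝ a b = a 0 * b 0 + a 1 * b 1 := by
  rw [PiLp.inner_apply, Fin.sum_univ_two]
  simp [mul_comm]

theorem norm_sq_plane (a : Plane) : ‖a‖ ^ 2 = a 0 ^ 2 + a 1 ^ 2 := by
  rw [EuclideanSpace.real_norm_sq_eq, Fin.sum_univ_two]

theorem tangent_sq {t : Plane} (h : ‖t‖ = 1) : t 0 ^ 2 + t 1 ^ 2 = 1 := by
  rw [← norm_sq_plane, h, one_pow]

theorem frame_of_mem {y : Plane} (hy : y ∈ B.bdry) :
    inner ℝ (B.normal y) (B.normal y) = (1 : ℝ) ∧ inner ℝ (B.tangent y) (B.tangent y) = (1 : ℝ) ∧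
    inner ℝ (B.normal y) (B.tangent y) = (0 : ℝ) ∧
    ∀ z : Plane, inner ℝ z (B.tangent y) ^ 2 = ‖z‖ ^ 2 - inner ℝ z (B.normal y) ^ 2 := by
  obtain ⟨i, s, rfl⟩ := B.exists_param hy
  rw [B.normal_γ, B.tangent_γ]
  have h := tangent_sq (B.unit_speed i s)
  refine ⟨?_, ?_, ?_, fun z => ?_⟩
  · rw [inner_plane]; simp; linarith
  · rw [inner_plane]; linarith
  · simp [inner_plane]; ring
  · simp only [inner_plane, norm_sq_plane]
    simp
    linear_combination (z 0 ^ 2 + z 1 ^ 2) * h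

/-- The tangent is eliminated through `(z·τ)² = |z|² - (z·n)²`, so that only `|z|²` and `z·n`
remain. -/
theorem K1_eq {k : ℝ} {Q : FlexuralProfile} (hG : ∀ x y, flexuralGreen k x y = Q.φ₀ (‖x - y‖ ^ 2))
    {x y : Plane} (hy : y ∈ B.bdry) (h : x ≠ y) :
    B.K1 k x y = Q.kerOne (x - y) (B.normal y) := by
  obtain ⟨h1, h2, h3, h4⟩ := B.frame_of_mem hy
  have h5 : ((inner ℝ (x - y) (B.tangent y) : ℝ) : ℂ) ^ 2
      = ((‖x - y‖ ^ 2 : ℝ) : ℂ) - ((inner ℝ (x - y) (B.normal y) : ℝ) : ℂ) ^ 2 := by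
    exact_mod_cast congrArg (fun r : ℝ => (r : ℂ)) (h4 (x - y))
  rw [K1, Q.dirDeriv_dirDeriv_dirDeriv_radial_source hG h _ _ h1,
    Q.dirDeriv_dirDeriv_dirDeriv_radial_source hG h _ _ h2, h1, h3, h5, FlexuralProfile.kerOne]
  push_cast
  ring

/-- The logarithmic `φ₁` terms of `G_{nn}` and `G_{ττ}` cancel in the difference. -/
theorem K2_eq {k : ℝ} {Q : FlexuralProfile} (hG : ∀ x y, flexuralGreen k x y = Q.φ₀ (‖x - y‖ ^ 2))
    {x y : Plane} (hy : y ∈ B.bdry) (h : x ≠ y) :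
    B.K2 k x y = Q.kerTwo (x - y) (B.normal y) := by
  obtain ⟨h1, h2, h3, h4⟩ := B.frame_of_mem hy
  have h5 : ((inner ℝ (x - y) (B.tangent y) : ℝ) : ℂ) ^ 2
      = ((‖x - y‖ ^ 2 : ℝ) : ℂ) - ((inner ℝ (x - y) (B.normal y) : ℝ) : ℂ) ^ 2 := by
    exact_mod_cast congrArg (fun r : ℝ => (r : ℂ)) (h4 (x - y))
  rw [K2, Q.dirDeriv_dirDeriv_radial_source hG h _ h1,
    Q.dirDeriv_dirDeriv_radial_source hG h _ h2, h5, FlexuralProfile.kerTwo]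
  ring

theorem hasDirDeriv_K1 {k : ℝ} {Q : FlexuralProfile}
    (hG : ∀ x y, flexuralGreen k x y = Q.φ₀ (‖x - y‖ ^ 2)) {x y : Plane} (hy : y ∈ B.bdry)
    (h : x ≠ y) (v : Plane) :
    HasDirDeriv (fun w => B.K1 k w y) v x (Q.derivKerOne (x - y) (B.normal y) v) :=
  (Q.hasDirDeriv_kerOne h (B.normal y) v).congr rfl
    ((eventually_ne_nhds h).mono fun _ hw => B.K1_eq hG hy hw)

theorem hasDirDeriv_K2 {k : ℝ} {Q : FlexuralProfile}
    (hG : ∀ x y, flexuralGreen k x y = Q.φ₀ (‖x - y‖ ^ 2)) {x y : Plane} (hy : y ∈ B.bdry)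
    (h : x ≠ y) (v : Plane) :
    HasDirDeriv (fun w => B.K2 k w y) v x (Q.derivKerTwo (x - y) (B.normal y) v) :=
  (Q.hasDirDeriv_kerTwo h (B.normal y) v).congr rfl
    ((eventually_ne_nhds h).mono fun _ hw => B.K2_eq hG hy hw)

end PlateGeometry

end

noncomputable section
open scoped ContDiff

/-! ### Splitting the kernels into biharmonic singular parts and continuous remainders -/

/-- The biharmonic parts of `K₁`, `K₂` and of their derivatives in the direction `v`. -/
def singKer : Fin 2 → Fin 2 → Plane → Plane → Plane → ℝ :=
  ![![fun z n _ => -(1 / Real.pi) * (inner ℝ z n ^ 3 / (‖z‖ ^ 2) ^ 2),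
      fun z n _ => -(1 / (2 * Real.pi)) * (inner ℝ z n ^ 2 / ‖z‖ ^ 2)],
    ![fun z n v => -(1 / Real.pi) * (3 * inner ℝ z n ^ 2 * inner ℝ v n / (‖z‖ ^ 2) ^ 2
        - 4 * inner ℝ z n ^ 3 * inner ℝ z v / (‖z‖ ^ 2) ^ 3),
      fun z n v => -(1 / Real.pi) * (inner ℝ z n * inner ℝ v n / ‖z‖ ^ 2
        - inner ℝ z n ^ 2 * inner ℝ z v / (‖z‖ ^ 2) ^ 2)]]

/-- Where `r = 0` the angular factor `h` may be discontinuous, but it stays bounded while `g ∘ r`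
tends to `0`. -/
theorem continuous_mul_of_bounded {X : Type*} [TopologicalSpace X] {g : ℝ → ℂ}
    (hg : Continuous g) (hg0 : g 0 = 0) {r h b : X → ℝ} (hr : Continuous r) (hb : Continuous b)
    (hh : ∀ x, r x ≠ 0 → ContinuousAt h x) (hle : ∀ x, |h x| ≤ b x) :
    Continuous fun x => g (r x) * (h x : ℂ) := by
  rw [continuous_iff_continuousAt]
  intro x
  by_cases hx : r x = 0
  · have h0 : Tendsto (fun y => ‖g (r y)‖ * b y) (𝓝 x) (𝓝 0) := by
      have := ((hg.comp hr).norm.mul hb).tendsto x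
      simpa [hx, hg0, Pi.mul_def] using this
    rw [ContinuousAt, hx, hg0, zero_mul]
    refine squeeze_zero_norm (fun y => ?_) h0
    rw [norm_mul, Complex.norm_real, Real.norm_eq_abs]
    exact mul_le_mul_of_nonneg_left (hle y) (norm_nonneg _)
  · exact (hg.comp hr).continuousAt.mul (Complex.continuous_ofReal.continuousAt.comp (hh x hx))

theorem abs_inner_mul_inner_div_le (z a b : Plane) :
    |inner ℝ z a * inner ℝ z b / ‖z‖ ^ 2| ≤ ‖a‖ * ‖b‖ := by
  rcases eq_or_ne z 0 with rfl | hz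
  · simp; positivity
  · have hp : 0 < ‖z‖ := norm_pos_iff.2 hz
    rw [abs_div, abs_mul, abs_of_pos (pow_pos hp 2), div_le_iff₀ (pow_pos hp 2)]
    calc |inner ℝ z a| * |inner ℝ z b| ≤ (‖z‖ * ‖a‖) * (‖z‖ * ‖b‖) :=
          mul_le_mul (abs_real_inner_le_norm z a) (abs_real_inner_le_norm z b) (abs_nonneg _)
            (by positivity)
      _ = ‖a‖ * ‖b‖ * ‖z‖ ^ 2 := by ring

namespace FlexuralProfile

variable (Q : FlexuralProfile)

/-- The closed forms of `K₁`, `K₂` and of their derivatives in the direction `v`. -/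
def ker : Fin 2 → Fin 2 → Plane → Plane → Plane → ℂ :=
  ![![fun z n _ => Q.kerOne z n, fun z n _ => Q.kerTwo z n], ![Q.derivKerOne, Q.derivKerTwo]]

/-- The remainders after removing the biharmonic parts. -/
def remKer : Fin 2 → Fin 2 → Plane → Plane → Plane → ℂ :=
  ![![fun z n _ => -24 * (inner ℝ z n : ℝ) * (Q.a (‖z‖ ^ 2) + Q.b (‖z‖ ^ 2))
        + 16 * (inner ℝ z n : ℝ)
          * (Q.b (‖z‖ ^ 2) * ((inner ℝ z n * inner ℝ z n / ‖z‖ ^ 2 : ℝ) : ℂ)),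
      fun z n _ => 1 / (4 * (Real.pi : ℂ))
        + 4 * Q.a (‖z‖ ^ 2) * (((‖z‖ ^ 2 : ℝ) : ℂ) - 2 * ((inner ℝ z n : ℝ) : ℂ) ^ 2)],
    ![fun z n v => -24 * (inner ℝ v n : ℝ) * (Q.a (‖z‖ ^ 2) + Q.b (‖z‖ ^ 2))
        - 48 * (2 * (Q.b (‖z‖ ^ 2) * ((inner ℝ z n * inner ℝ z v / ‖z‖ ^ 2 : ℝ) : ℂ))
          + Q.d (‖z‖ ^ 2) * ((inner ℝ z n * inner ℝ z v / ‖z‖ ^ 2 : ℝ) : ℂ))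
        + 32 * (Q.d (‖z‖ ^ 2) * (((inner ℝ z n * inner ℝ z v / ‖z‖ ^ 2)
          * (inner ℝ z n * inner ℝ z n / ‖z‖ ^ 2) : ℝ) : ℂ))
        + 48 * (inner ℝ v n : ℝ)
          * (Q.b (‖z‖ ^ 2) * ((inner ℝ z n * inner ℝ z n / ‖z‖ ^ 2 : ℝ) : ℂ)),
      fun z n v => 8 * Q.b (‖z‖ ^ 2) * (inner ℝ z v : ℝ)
        - 16 * (inner ℝ z n : ℝ)
          * (Q.b (‖z‖ ^ 2) * ((inner ℝ z n * inner ℝ z v / ‖z‖ ^ 2 : ℝ) : ℂ))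
        + 4 * Q.a (‖z‖ ^ 2)
          * (2 * (inner ℝ z v : ℝ) - 4 * (inner ℝ z n : ℝ) * (inner ℝ v n : ℝ))]]

/-- The leading singularities cancel in `φ₂ + ρ φ₃ = a + b` and in `2 φ₃ + ρ φ₄ = (2b + d)/ρ`. This
is why the weight `3` in `K₁` matters: the biharmonic part of `K₁` keeps only the cubic term in
`z·n`. -/
theorem ker_eq_sing_add_rem (i j : Fin 2) {z : Plane} (hz : z ≠ 0) (n v : Plane) :
    Q.ker i j z n v = (singKer i j z n v : ℂ) + Q.remKer i j z n v := by
  have hρ : 0 < ‖z‖ ^ 2 := pow_pos (norm_pos_iff.2 hz) 2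
  have e2 := Q.φ₂_eq _ hρ
  have e3 := Q.φ₃_eq _ hρ
  have e4 := Q.φ₄_eq _ hρ
  have hne : (‖z‖ : ℂ) ≠ 0 := by exact_mod_cast (norm_pos_iff.2 hz).ne'
  have hpi : (Real.pi : ℂ) ≠ 0 := by exact_mod_cast Real.pi_ne_zero
  fin_cases i <;> fin_cases j <;>
    simp only [ker, remKer, singKer, kerOne, kerTwo, derivKerOne, derivKerTwo, Fin.zero_eta,
      Fin.mk_one, Matrix.cons_val_zero, Matrix.cons_val_one, e2, e3, e4] <;>
    push_cast <;> field_simp <;> ring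

theorem continuous_remKer (i j : Fin 2) :
    Continuous fun p : Plane × Plane × Plane => Q.remKer i j p.1 p.2.1 p.2.2 := by
  have ci : ∀ {f g : Plane × Plane × Plane → Plane}, Continuous f → Continuous g →
      Continuous fun p => ((inner ℝ (f p) (g p) : ℝ) : ℂ) := fun hf hg =>
    Complex.continuous_ofReal.comp (hf.inner hg)
  have hz : Continuous fun p : Plane × Plane × Plane => p.1 := continuous_fst
  have hn : Continuous fun p : Plane × Plane × Plane => p.2.1 := continuous_snd.fst
  have hv : Continuous fun p : Plane × Plane × Plane => p.2.2 := continuous_snd.snd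
  have hr : Continuous fun p : Plane × Plane × Plane => ‖p.1‖ ^ 2 := hz.norm.pow 2
  have ca : Continuous fun p : Plane × Plane × Plane => Q.a (‖p.1‖ ^ 2) := Q.cont_a.comp hr
  have cb : Continuous fun p : Plane × Plane × Plane => Q.b (‖p.1‖ ^ 2) := Q.cont_b.comp hr
  have quot : ∀ {f g : Plane × Plane × Plane → Plane}, Continuous f → Continuous g →
      ∀ p : Plane × Plane × Plane, ‖p.1‖ ^ 2 ≠ 0 →
      ContinuousAt (fun p => inner ℝ p.1 (f p) * inner ℝ p.1 (g p) / ‖p.1‖ ^ 2) p :=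
    fun hf hg p hp => ((hz.inner hf).mul (hz.inner hg)).continuousAt.div hr.continuousAt hp
  have cmul : ∀ {h : ℝ → ℂ} {f g : Plane × Plane × Plane → Plane}, Continuous h → h 0 = 0 →
      Continuous f → Continuous g → Continuous fun p : Plane × Plane × Plane =>
        h (‖p.1‖ ^ 2) * ((inner ℝ p.1 (f p) * inner ℝ p.1 (g p) / ‖p.1‖ ^ 2 : ℝ) : ℂ) :=
    fun hh h0 hf hg => continuous_mul_of_bounded hh h0 hr (hf.norm.mul hg.norm) (quot hf hg)
      fun p => abs_inner_mul_inner_div_le _ _ _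
  have cmul2 : Continuous fun p : Plane × Plane × Plane => Q.d (‖p.1‖ ^ 2)
      * (((inner ℝ p.1 p.2.1 * inner ℝ p.1 p.2.2 / ‖p.1‖ ^ 2)
        * (inner ℝ p.1 p.2.1 * inner ℝ p.1 p.2.1 / ‖p.1‖ ^ 2) : ℝ) : ℂ) :=
    continuous_mul_of_bounded Q.cont_d Q.d_zero hr
      ((hn.norm.mul hv.norm).mul (hn.norm.mul hn.norm))
      (fun p hp => (quot hn hv p hp).mul (quot hn hn p hp)) fun p => by
        rw [abs_mul]
        exact mul_le_mul (abs_inner_mul_inner_div_le _ _ _) (abs_inner_mul_inner_div_le _ _ _)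
          (abs_nonneg _) (mul_nonneg (norm_nonneg _) (norm_nonneg _))
  have bnn := cmul Q.cont_b Q.b_zero hn hn
  have bnv := cmul Q.cont_b Q.b_zero hn hv
  have dnv := cmul Q.cont_d Q.d_zero hn hv
  have czn := ci hz hn
  have czv := ci hz hv
  have cvn := ci hv hn
  have crc : Continuous fun p : Plane × Plane × Plane => ((‖p.1‖ ^ 2 : ℝ) : ℂ) :=
    Complex.continuous_ofReal.comp hr
  fin_cases i <;> fin_cases j
  · exact ((continuous_const.mul czn).mul (ca.add cb)).add ((continuous_const.mul czn).mul bnn)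
  · exact continuous_const.add ((continuous_const.mul ca).mul
      (crc.sub (continuous_const.mul (czn.pow 2))))
  · exact ((((continuous_const.mul cvn).mul (ca.add cb)).sub
      (continuous_const.mul ((continuous_const.mul bnv).add dnv))).add
      (continuous_const.mul cmul2)).add ((continuous_const.mul cvn).mul bnn)
  · exact (((continuous_const.mul cb).mul czv).sub ((continuous_const.mul czn).mul bnv)).add
      ((continuous_const.mul ca).mul ((continuous_const.mul czv).sub
        ((continuous_const.mul czn).mul cvn)))

theorem continuousAt_singKer (i j : Fin 2) {p : Plane × Plane × Plane} (hp : p.1 ≠ 0) :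
    ContinuousAt (fun p : Plane × Plane × Plane => singKer i j p.1 p.2.1 p.2.2) p := by
  have h0 : ‖p.1‖ ^ 2 ≠ 0 := by simpa using hp
  have h2 : (‖p.1‖ ^ 2) ^ 2 ≠ 0 := pow_ne_zero _ h0
  have h3 : (‖p.1‖ ^ 2) ^ 3 ≠ 0 := pow_ne_zero _ h0
  fin_cases i <;> fin_cases j <;>
    simp only [singKer, Fin.zero_eta, Fin.mk_one, Matrix.cons_val_zero, Matrix.cons_val_one] <;>
    fun_prop (disch := assumption)

theorem continuousAt_ker (i j : Fin 2) {p : Plane × Plane × Plane} (hp : p.1 ≠ 0) :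
    ContinuousAt (fun p : Plane × Plane × Plane => Q.ker i j p.1 p.2.1 p.2.2) p := by
  have h : ContinuousAt (fun p : Plane × Plane × Plane =>
      (singKer i j p.1 p.2.1 p.2.2 : ℂ) + Q.remKer i j p.1 p.2.1 p.2.2) p :=
    (Complex.continuous_ofReal.continuousAt.comp (continuousAt_singKer i j hp)).add
      (Q.continuous_remKer i j).continuousAt
  refine h.congr ?_
  filter_upwards [continuous_fst.continuousAt.eventually_ne hp] with q hq
  exact (Q.ker_eq_sing_add_rem i j hq _ _).symm

end FlexuralProfile

end

noncomputable section

/-! ### One-dimensional singular integrals -/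

/-- A function `θ η t`, bounded for small `η > 0`, with limit `θ₀ t` as `η → 0` for fixed `t ≠ 0`
and with limit `1` along `t = η u`. -/
structure IsBlockRatio (T η₀ C : ℝ) (θ : ℝ → ℝ → ℝ) (θ₀ : ℝ → ℝ) : Prop where
  pos : 0 < η₀
  cont : ∀ η ∈ Ioc 0 η₀, ContinuousOn (θ η) (Icc (-T) T)
  bound : ∀ η ∈ Ioc 0 η₀, ∀ t ∈ Icc (-T) T, |θ η t| ≤ C
  lim : ∀ t ∈ Icc (-T) T, t ≠ 0 → Tendsto (fun η => θ η t) (𝓝[>] 0) (𝓝 (θ₀ t))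
  scaled : ∀ u : ℝ, Tendsto (fun η => θ η (η * u)) (𝓝[>] 0) (𝓝 1)

/-- Continuity in all five arguments. -/
def ContFive (P : ℝ → ℝ → ℝ → ℝ → ℝ → ℝ) : Prop :=
  Continuous fun p : ℝ × ℝ × ℝ × ℝ × ℝ => P p.1 p.2.1 p.2.2.1 p.2.2.2.1 p.2.2.2.2

/-- Evaluation of `P` at `η, t, η² / (t² + η²), η t / (t² + η²), θ η t`. -/
def blockEval (P : ℝ → ℝ → ℝ → ℝ → ℝ → ℝ) (θ : ℝ → ℝ → ℝ) (η t : ℝ) : ℝ :=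
  P η t (η ^ 2 / (t ^ 2 + η ^ 2)) (η * t / (t ^ 2 + η ^ 2)) (θ η t)

theorem ContFive.tendsto {P : ℝ → ℝ → ℝ → ℝ → ℝ → ℝ} (hP : ContFive P) {l : Filter ℝ}
    {f₁ f₂ f₃ f₄ f₅ : ℝ → ℝ} {a₁ a₂ a₃ a₄ a₅ : ℝ} (h₁ : Tendsto f₁ l (𝓝 a₁))
    (h₂ : Tendsto f₂ l (𝓝 a₂)) (h₃ : Tendsto f₃ l (𝓝 a₃)) (h₄ : Tendsto f₄ l (𝓝 a₄))
    (h₅ : Tendsto f₅ l (𝓝 a₅)) :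
    Tendsto (fun x => P (f₁ x) (f₂ x) (f₃ x) (f₄ x) (f₅ x)) l (𝓝 (P a₁ a₂ a₃ a₄ a₅)) :=
  (Continuous.tendsto hP (a₁, a₂, a₃, a₄, a₅)).comp
    (h₁.prodMk_nhds (h₂.prodMk_nhds (h₃.prodMk_nhds (h₄.prodMk_nhds h₅))))

theorem sq_add_sq_pos_of_pos {η : ℝ} (hη : 0 < η) (t : ℝ) : 0 < t ^ 2 + η ^ 2 := by positivity

theorem sq_div_sq_add_sq_mem {η : ℝ} (hη : 0 < η) (t : ℝ) :
    η ^ 2 / (t ^ 2 + η ^ 2) ∈ Icc (-1 : ℝ) 1 := by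
  have h := sq_add_sq_pos_of_pos hη t
  constructor
  · have : 0 ≤ η ^ 2 / (t ^ 2 + η ^ 2) := by positivity
    linarith
  · rw [div_le_one h]; nlinarith [sq_nonneg t]

theorem mul_div_sq_add_sq_mem {η : ℝ} (hη : 0 < η) (t : ℝ) :
    η * t / (t ^ 2 + η ^ 2) ∈ Icc (-1 : ℝ) 1 := by
  have h := sq_add_sq_pos_of_pos hη t
  constructor
  · rw [le_div_iff₀ h]; nlinarith [sq_nonneg (t + η), sq_nonneg t, sq_nonneg η]
  · rw [div_le_one h]; nlinarith [sq_nonneg (t - η), sq_nonneg t, sq_nonneg η]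

namespace IsBlockRatio

variable {T η₀ C : ℝ} {θ : ℝ → ℝ → ℝ} {θ₀ : ℝ → ℝ} (h : IsBlockRatio T η₀ C θ θ₀)
  {P : ℝ → ℝ → ℝ → ℝ → ℝ → ℝ} (hP : ContFive P)
include h

theorem eventually_mem : ∀ᶠ η in 𝓝[>] (0 : ℝ), η ∈ Ioc 0 η₀ :=
  Ioc_mem_nhdsGT h.pos

include hP

/-- All five arguments stay in a fixed compact box, so continuity of `P` suffices. -/
theorem exists_bound : ∃ K, ∀ η ∈ Ioc 0 η₀, ∀ t ∈ Icc (-T) T, |blockEval P θ η t| ≤ K := by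
  have hc : IsCompact (Icc (0 : ℝ) η₀ ×ˢ Icc (-T) T ×ˢ Icc (-1 : ℝ) 1 ×ˢ Icc (-1 : ℝ) 1 ×ˢ
      Icc (-C) C) :=
    isCompact_Icc.prod (isCompact_Icc.prod (isCompact_Icc.prod (isCompact_Icc.prod isCompact_Icc)))
  obtain ⟨K, hK⟩ := hc.exists_bound_of_continuousOn (Continuous.continuousOn hP)
  exact ⟨K, fun η hη t ht => hK (_, _, _, _, _) ⟨⟨hη.1.le, hη.2⟩, ht, sq_div_sq_add_sq_mem hη.1 t,
    mul_div_sq_add_sq_mem hη.1 t, abs_le.1 (h.bound η hη t ht)⟩⟩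

theorem continuousOn_blockEval {η : ℝ} (hη : η ∈ Ioc 0 η₀) :
    ContinuousOn (blockEval P θ η) (Icc (-T) T) := by
  have hne : ∀ t : ℝ, t ^ 2 + η ^ 2 ≠ 0 := fun t => (sq_add_sq_pos_of_pos hη.1 t).ne'
  have h1 : Continuous fun t : ℝ => η ^ 2 / (t ^ 2 + η ^ 2) :=
    continuous_const.div (by fun_prop) hne
  have h2 : Continuous fun t : ℝ => η * t / (t ^ 2 + η ^ 2) :=
    Continuous.div (by fun_prop) (by fun_prop) hne
  exact Continuous.comp_continuousOn hP (continuousOn_const.prodMk (continuousOn_id.prodMk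
    (h1.continuousOn.prodMk (h2.continuousOn.prodMk (h.cont η hη)))))

/-- Bounded contributions converge by dominated convergence. -/
theorem tendsto_integral_bounded (hT : 0 < T) {σ : ℝ → ℂ} (hσ : Continuous σ) :
    Tendsto (fun η => ∫ t in (-T)..T, (blockEval P θ η t : ℂ) * σ t) (𝓝[>] 0)
      (𝓝 (∫ t in (-T)..T, (P 0 t 0 0 (θ₀ t) : ℂ) * σ t)) := by
  obtain ⟨K, hK⟩ := h.exists_bound hP
  have hsub : Set.uIoc (-T) T ⊆ Icc (-T) T := by
    rw [Set.uIoc_of_le (by linarith)]; exact Ioc_subset_Icc_self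
  refine intervalIntegral.tendsto_integral_filter_of_dominated_convergence
    (fun t => K * ‖σ t‖) ?_ ?_ ?_ ?_
  · filter_upwards [h.eventually_mem] with η hη
    have := (Complex.continuous_ofReal.comp_continuousOn (h.continuousOn_blockEval hP hη)).mul
      hσ.continuousOn
    exact (this.mono hsub).aestronglyMeasurable measurableSet_uIoc
  · filter_upwards [h.eventually_mem] with η hη
    refine Eventually.of_forall fun t ht => ?_
    rw [norm_mul, Complex.norm_real, Real.norm_eq_abs]
    exact mul_le_mul_of_nonneg_right (hK η hη t (hsub ht)) (norm_nonneg _)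
  · exact (continuous_const.mul hσ.norm).intervalIntegrable _ _
  -- Away from `t = 0` both blocks `η²/(t²+η²)` and `ηt/(t²+η²)` tend to `0`; the exceptional point
  -- is null.
  · have h0 : ∀ᵐ t : ℝ, t ≠ 0 := by simp [ae_iff]
    filter_upwards [h0] with t ht htm
    have hid : Tendsto (fun η : ℝ => η) (𝓝[>] 0) (𝓝 0) := nhdsWithin_le_nhds
    have hne : t ^ 2 + (0 : ℝ) ^ 2 ≠ 0 := by positivity
    have h1 : Tendsto (fun η : ℝ => η ^ 2 / (t ^ 2 + η ^ 2)) (𝓝[>] 0) (𝓝 0) := by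
      have := (hid.pow 2).div (tendsto_const_nhds.add (hid.pow 2)) hne
      simpa [Pi.div_def] using this
    have h2 : Tendsto (fun η : ℝ => η * t / (t ^ 2 + η ^ 2)) (𝓝[>] 0) (𝓝 0) := by
      have := (hid.mul_const t).div (tendsto_const_nhds.add (hid.pow 2)) hne
      simpa [Pi.div_def] using this
    exact (Complex.continuous_ofReal.continuousAt.tendsto.comp
      (hP.tendsto hid tendsto_const_nhds h1 h2 (h.lim t (hsub htm) ht))).mul_const _

/-- Contributions that concentrate at `t = 0` on the scale `η`. -/
theorem tendsto_integral_concentrating (hT : 0 < T) {σ : ℝ → ℂ} (hσ : Continuous σ) :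
    Tendsto (fun η => ∫ t in (-T)..T, ((η / (t ^ 2 + η ^ 2) * blockEval P θ η t : ℝ) : ℂ) * σ t)
      (𝓝[>] 0)
      (𝓝 (((∫ u : ℝ, (1 + u ^ 2)⁻¹ * P 0 0 (1 + u ^ 2)⁻¹ (u * (1 + u ^ 2)⁻¹) 1 : ℝ) : ℂ)
        * σ 0)) := by
  obtain ⟨K, hK⟩ := h.exists_bound hP
  obtain ⟨S, hS⟩ := isCompact_Icc.exists_bound_of_continuousOn (s := Icc (-T) T) hσ.continuousOn
  set F : ℝ → ℝ → ℂ := fun η t => ((η / (t ^ 2 + η ^ 2) * blockEval P θ η t : ℝ) : ℂ) * σ t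
  have hFc : ∀ η ∈ Ioc 0 η₀, ContinuousOn (F η) (Icc (-T) T) := fun η hη => by
    have hne : ∀ t : ℝ, t ^ 2 + η ^ 2 ≠ 0 := fun t => (sq_add_sq_pos_of_pos hη.1 t).ne'
    have h1 : Continuous fun t : ℝ => η / (t ^ 2 + η ^ 2) :=
      continuous_const.div (by fun_prop) hne
    exact (Complex.continuous_ofReal.comp_continuousOn
      (h1.continuousOn.mul (h.continuousOn_blockEval hP hη))).mul hσ.continuousOn
  have hmem : ∀ η : ℝ, 0 < η → ∀ u : ℝ, u ∈ Ioc (-(T / η)) (T / η) → η * u ∈ Icc (-T) T := by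
    intro η hη u hu
    have h1 : η * (T / η) = T := by field_simp
    constructor <;> nlinarith [hu.1, hu.2]
  -- Under `t = ηu` the window becomes `(-T/η, T/η]`. Extension by zero gives a fixed domain, on
  -- which `K S / (1 + u²)` dominates.
  have hscale : ∀ η ∈ Ioc 0 η₀, ∫ t in (-T)..T, F η t
      = ∫ u, (Ioc (-(T / η)) (T / η)).indicator (fun u => (η : ℂ) * F η (η * u)) u := by
    intro η hη
    have hη0 := hη.1
    rw [integral_indicator measurableSet_Ioc, ← intervalIntegral.integral_of_le
      (by have : 0 < T / η := by positivity
          linarith), intervalIntegral.integral_const_mul,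
      intervalIntegral.integral_comp_mul_left (fun t => F η t) hη0.ne']
    have h1 : η * -(T / η) = -T := by field_simp
    have h2 : η * (T / η) = T := by field_simp
    rw [h1, h2, Complex.real_smul, ← mul_assoc]
    have : (η : ℂ) * ((η⁻¹ : ℝ) : ℂ) = 1 := by
      have : (η : ℂ) ≠ 0 := by exact_mod_cast hη0.ne'
      push_cast; field_simp
    rw [this, one_mul]
  have hval : ∀ η : ℝ, 0 < η → ∀ u : ℝ, (η : ℂ) * F η (η * u) =
      (((1 + u ^ 2)⁻¹ * P η (η * u) (1 + u ^ 2)⁻¹ (u * (1 + u ^ 2)⁻¹) (θ η (η * u)) : ℝ) : ℂ)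
        * σ (η * u) := by
    intro η hη u
    have h1 : (0 : ℝ) < 1 + u ^ 2 := by positivity
    have e1 : η ^ 2 / ((η * u) ^ 2 + η ^ 2) = (1 + u ^ 2)⁻¹ := by field_simp; ring
    have e2 : η * (η * u) / ((η * u) ^ 2 + η ^ 2) = u * (1 + u ^ 2)⁻¹ := by field_simp; ring
    have e3 : η * (η / ((η * u) ^ 2 + η ^ 2)) = (1 + u ^ 2)⁻¹ := by field_simp; ring
    simp only [F, blockEval, e1, e2]
    rw [← e3]
    push_cast
    ring
  have hlim : Tendsto (fun η => ∫ u, (Ioc (-(T / η)) (T / η)).indicator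
      (fun u => (η : ℂ) * F η (η * u)) u) (𝓝[>] 0)
      (𝓝 (∫ u : ℝ, (((1 + u ^ 2)⁻¹ * P 0 0 (1 + u ^ 2)⁻¹ (u * (1 + u ^ 2)⁻¹) 1 : ℝ) : ℂ)
        * σ 0)) := by
    refine tendsto_integral_filter_of_dominated_convergence
      (fun u => K * S * (1 + u ^ 2)⁻¹) ?_ ?_ ?_ ?_
    · filter_upwards [h.eventually_mem] with η hη
      rw [aestronglyMeasurable_indicator_iff measurableSet_Ioc]
      refine ContinuousOn.aestronglyMeasurable (continuousOn_const.mul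
        ((hFc η hη).comp (continuous_const.mul continuous_id).continuousOn ?_)) measurableSet_Ioc
      exact fun u hu => hmem η hη.1 u hu
    · filter_upwards [h.eventually_mem] with η hη
      refine Eventually.of_forall fun u => ?_
      by_cases hu : u ∈ Ioc (-(T / η)) (T / η)
      · have hm := hmem η hη.1 u hu
        rw [indicator_of_mem hu]
        have hb := hK η hη _ hm
        have hp : (0 : ℝ) < 1 + u ^ 2 := by positivity
        have e3 : η * (η / ((η * u) ^ 2 + η ^ 2)) = (1 + u ^ 2)⁻¹ := by
          have := hη.1
          field_simp
          ring
        have e4 : (η : ℂ) * F η (η * u)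
            = (((1 + u ^ 2)⁻¹ * blockEval P θ η (η * u) : ℝ) : ℂ) * σ (η * u) := by
          rw [← e3]; simp only [F]; push_cast; ring
        rw [e4, norm_mul, Complex.norm_real, Real.norm_eq_abs, abs_mul,
          abs_of_pos (inv_pos.2 hp)]
        calc (1 + u ^ 2)⁻¹ * |blockEval P θ η (η * u)| * ‖σ (η * u)‖
            ≤ (1 + u ^ 2)⁻¹ * K * S := by
              gcongr
              · exact mul_nonneg (inv_pos.2 hp).le ((abs_nonneg _).trans hb)
              · exact hS _ hm
          _ = K * S * (1 + u ^ 2)⁻¹ := by ring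
      · rw [indicator_of_notMem hu, norm_zero]
        have hz : (0 : ℝ) ∈ Icc (-T) T := ⟨by linarith, hT.le⟩
        have hK0 : 0 ≤ K := (abs_nonneg _).trans (hK η hη 0 hz)
        have hS0 : 0 ≤ S := (norm_nonneg _).trans (hS 0 hz)
        positivity
    · exact integrable_inv_one_add_sq.const_mul _
    · refine Eventually.of_forall fun u => ?_
      have hid : Tendsto (fun η : ℝ => η) (𝓝[>] 0) (𝓝 0) := nhdsWithin_le_nhds
      have hmulu : Tendsto (fun η : ℝ => η * u) (𝓝[>] 0) (𝓝 0) := by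
        simpa using hid.mul_const u
      have hl := ((Complex.continuous_ofReal.continuousAt.tendsto.comp
        ((hP.tendsto hid hmulu (tendsto_const_nhds (x := (1 + u ^ 2)⁻¹))
          (tendsto_const_nhds (x := u * (1 + u ^ 2)⁻¹)) (h.scaled u)).const_mul
            ((1 + u ^ 2)⁻¹)))).mul ((hσ.tendsto 0).comp hmulu)
      refine hl.congr' ?_
      have hev : ∀ᶠ η in 𝓝[>] (0 : ℝ), η * |u| < T := by
        have : Tendsto (fun η : ℝ => η * |u|) (𝓝[>] 0) (𝓝 0) := by
          simpa using hid.mul_const |u|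
        exact this.eventually_lt_const hT
      filter_upwards [hev, self_mem_nhdsWithin] with η h1 h2
      have h2 : 0 < η := h2
      have hu : u ∈ Ioc (-(T / η)) (T / η) := by
        have : |u| < T / η := by rw [lt_div_iff₀ h2]; linarith
        exact ⟨(abs_lt.1 this).1, (abs_lt.1 this).2.le⟩
      rw [indicator_of_mem hu, hval η h2 u]
      rfl
  rw [integral_mul_const, integral_complex_ofReal] at hlim
  refine hlim.congr' ?_
  filter_upwards [h.eventually_mem] with η hη
  exact (hscale η hη).symm

end IsBlockRatio

end

noncomputable section

/-! ### The biharmonic kernels near a boundary point, in local coordinates -/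

/-- The function `u (1 + u²)⁻ᵐ` vanishes at both ends of the line, so its derivative has integral
zero; rewriting `u²/(1+u²)` as `1 - 1/(1+u²)` gives the recursion. -/
theorem integral_inv_one_add_sq_pow_succ (m : ℕ) (hm : 0 < m) :
    Integrable (fun u : ℝ => ((1 + u ^ 2)⁻¹) ^ m) ∧
    (∫ u : ℝ, ((1 + u ^ 2)⁻¹) ^ (m + 1)) = (2 * (m : ℝ) - 1) / (2 * m) * ∫ u : ℝ, ((1 + u ^ 2)⁻¹) ^ m := by
  have hint : ∀ m : ℕ, 0 < m → Integrable (fun u : ℝ => ((1 + u ^ 2)⁻¹) ^ m) := by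
    intro m hm
    refine integrable_inv_one_add_sq.mono' (by fun_prop) (Eventually.of_forall fun u => ?_)
    have h1 : (0 : ℝ) < (1 + u ^ 2)⁻¹ := by positivity
    have h2 : (1 + u ^ 2)⁻¹ ≤ 1 := inv_le_one_of_one_le₀ (by nlinarith [sq_nonneg u])
    rw [Real.norm_eq_abs, abs_of_pos (pow_pos h1 m)]
    calc ((1 + u ^ 2)⁻¹) ^ m ≤ ((1 + u ^ 2)⁻¹) ^ 1 := pow_le_pow_of_le_one h1.le h2 hm
      _ = _ := pow_one _
  refine ⟨hint m hm, ?_⟩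
  have hd : ∀ u : ℝ, HasDerivAt (fun u : ℝ => u * ((1 + u ^ 2)⁻¹) ^ m)
      ((1 - 2 * m) * ((1 + u ^ 2)⁻¹) ^ m + 2 * m * ((1 + u ^ 2)⁻¹) ^ (m + 1)) u := by
    intro u
    have hne : (1 : ℝ) + u ^ 2 ≠ 0 := by positivity
    have h1 : HasDerivAt (fun u : ℝ => 1 + u ^ 2) (2 * u) u := by
      simpa using (hasDerivAt_pow 2 u).const_add 1
    have h2 : HasDerivAt (fun u : ℝ => (1 + u ^ 2)⁻¹) (-2 * u * ((1 + u ^ 2)⁻¹) ^ 2) u :=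
      (h1.inv hne).congr_deriv (by field_simp)
    refine ((hasDerivAt_id u).mul (h2.pow m)).congr_deriv ?_
    obtain ⟨j, rfl⟩ := Nat.exists_eq_succ_of_ne_zero hm.ne'
    have hw : (1 + u ^ 2)⁻¹ * (1 + u ^ 2) = 1 := inv_mul_cancel₀ hne
    simp only [Pi.pow_apply, id, Nat.succ_sub_one, Nat.succ_eq_add_one]
    push_cast
    linear_combination -2 * ((j : ℝ) + 1) * ((1 + u ^ 2)⁻¹) ^ (j + 1) * hw
  have hlim : ∀ l : Filter ℝ, Tendsto (fun u : ℝ => |u|) l atTop →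
      Tendsto (fun u : ℝ => u * ((1 + u ^ 2)⁻¹) ^ m) l (𝓝 0) := by
    intro l hl
    refine squeeze_zero_norm' (a := fun u => |u|⁻¹) ?_ (tendsto_inv_atTop_zero.comp hl)
    filter_upwards [hl.eventually_gt_atTop 0] with u hu
    have h1 : (0 : ℝ) < (1 + u ^ 2)⁻¹ := by positivity
    have h2 : (1 + u ^ 2)⁻¹ ≤ 1 := inv_le_one_of_one_le₀ (by nlinarith [sq_nonneg u])
    have h3 : ((1 + u ^ 2)⁻¹) ^ m ≤ (1 + u ^ 2)⁻¹ := by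
      calc ((1 + u ^ 2)⁻¹) ^ m ≤ ((1 + u ^ 2)⁻¹) ^ 1 := pow_le_pow_of_le_one h1.le h2 hm
        _ = _ := pow_one _
    rw [norm_mul, Real.norm_eq_abs, Real.norm_eq_abs, abs_of_pos (pow_pos h1 m)]
    calc |u| * ((1 + u ^ 2)⁻¹) ^ m ≤ |u| * (1 + u ^ 2)⁻¹ := by gcongr
      _ ≤ |u|⁻¹ := by
        rw [← sq_abs u]
        rw [inv_eq_one_div, inv_eq_one_div, mul_one_div, div_le_div_iff₀ (by positivity) hu]
        nlinarith
  have h := integral_of_hasDerivAt_of_tendsto hd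
    (((hint m hm).const_mul _).add ((hint (m + 1) m.succ_pos).const_mul _))
    (hlim atBot tendsto_abs_atBot_atTop) (hlim atTop tendsto_abs_atTop_atTop)
  rw [integral_add ((hint m hm).const_mul _) ((hint (m + 1) m.succ_pos).const_mul _),
    integral_const_mul, integral_const_mul] at h
  have hm' : (0 : ℝ) < m := by exact_mod_cast hm
  rw [div_mul_eq_mul_div, eq_div_iff (by positivity)]
  linarith

theorem integral_inv_one_add_sq_pow_one : ∫ u : ℝ, ((1 + u ^ 2)⁻¹) ^ 1 = Real.pi := by
  simp [integral_univ_inv_one_add_sq]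

theorem integral_inv_one_add_sq_pow_two : ∫ u : ℝ, ((1 + u ^ 2)⁻¹) ^ 2 = Real.pi / 2 := by
  rw [(integral_inv_one_add_sq_pow_succ 1 one_pos).2, integral_inv_one_add_sq_pow_one]
  norm_num; ring

theorem integral_inv_one_add_sq_pow_three : ∫ u : ℝ, ((1 + u ^ 2)⁻¹) ^ 3 = 3 * Real.pi / 8 := by
  rw [(integral_inv_one_add_sq_pow_succ 2 two_pos).2, integral_inv_one_add_sq_pow_two]
  norm_num; ring

theorem integral_inv_one_add_sq_pow_four : ∫ u : ℝ, ((1 + u ^ 2)⁻¹) ^ 4 = 5 * Real.pi / 16 := by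
  rw [(integral_inv_one_add_sq_pow_succ 3 three_pos).2, integral_inv_one_add_sq_pow_three]
  norm_num; ring

/-- Local description of a curve through the boundary point with parameter `0`, with respect to
the normal there: `t² e` and `t² f` are the components of the displacement along the normals at the
moving point and at the fixed point, `c` is the cosine of the angle between the normals and `t² q`
is the squared chord length. The fixed point is displaced by `s η` along its normal. -/
structure LocalFrame where
  T : ℝ
  s : ℝ
  c : ℝ → ℝ
  e : ℝ → ℝ
  f : ℝ → ℝ
  g : ℝ → ℝ
  q : ℝ → ℝ
  Q : ℝ → ℝ
  q₀ : ℝ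
  T_pos : 0 < T
  s_sq : s ^ 2 = 1
  cont_c : Continuous c
  cont_e : Continuous e
  cont_f : Continuous f
  cont_g : Continuous g
  cont_q : Continuous q
  cont_Q : Continuous Q
  q₀_pos : 0 < q₀
  q₀_le : ∀ t ∈ Icc (-T) T, q₀ ≤ q t
  c_eq : ∀ t, c t = 1 - t ^ 2 * g t
  q_eq : ∀ t, q t = 1 - t * Q t
  Q_zero : Q 0 = 0
  e_zero : e 0 = -f 0

namespace LocalFrame

variable (F : LocalFrame)

/-- The squared distance. -/
def dist2 (η t : ℝ) : ℝ := t ^ 2 * F.q t + 2 * F.s * η * t ^ 2 * F.f t + η ^ 2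

/-- The component of the displacement along the normal at the moving point. -/
def nComp (η t : ℝ) : ℝ := F.s * η * F.c t + t ^ 2 * F.e t

/-- The component of the displacement along the normal at the fixed point. -/
def vComp (η t : ℝ) : ℝ := F.s * η + t ^ 2 * F.f t

/-- Ratio between the flat and the actual squared distance. -/
def ratio (η t : ℝ) : ℝ := (t ^ 2 + η ^ 2) / F.dist2 η t

theorem abs_s : |F.s| = 1 := by
  rw [← sq_eq_sq₀ (abs_nonneg _) zero_le_one, sq_abs, F.s_sq, one_pow]

/-- The displaced point is as far from the curve as in the flat case, up to a constant: the cross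
term `2sηt²f` is absorbed by half of `t² q`. -/
theorem exists_dist2_ge : ∃ η₀ > 0, ∃ c₀ > 0, ∀ η ∈ Icc 0 η₀, ∀ t ∈ Icc (-F.T) F.T,
    c₀ * (t ^ 2 + η ^ 2) ≤ F.dist2 η t := by
  obtain ⟨K, hK⟩ := isCompact_Icc.exists_bound_of_continuousOn (s := Icc (-F.T) F.T)
    F.cont_f.continuousOn
  have h0 : (0 : ℝ) ∈ Icc (-F.T) F.T := ⟨by linarith [F.T_pos], F.T_pos.le⟩
  have hK0 : 0 ≤ K := (norm_nonneg _).trans (hK 0 h0)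
  have hq := F.q₀_pos
  -- With `|f| ≤ K` this `η₀` gives `|2sηf| ≤ q₀/2`; the `+ 1` covers `K = 0`.
  refine ⟨F.q₀ / (4 * (K + 1)), by positivity, min (F.q₀ / 2) 1, by positivity,
    fun η hη t ht => ?_⟩
  have hf : |F.f t| ≤ K := hK t ht
  have h1 : |2 * F.s * η * F.f t| ≤ F.q₀ / 2 := by
    rw [abs_mul, abs_mul, abs_mul, F.abs_s, abs_two, abs_of_nonneg hη.1]
    have : η * (4 * (K + 1)) ≤ F.q₀ := (le_div_iff₀ (by positivity)).1 hη.2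
    nlinarith [hη.1, abs_nonneg (F.f t)]
  have h2 := (abs_le.1 h1).1
  have h3 := F.q₀_le t ht
  have h4 : F.q₀ / 2 ≤ F.q t + 2 * F.s * η * F.f t := by linarith
  have h5 : F.dist2 η t = t ^ 2 * (F.q t + 2 * F.s * η * F.f t) + η ^ 2 := by
    rw [dist2]; ring
  rw [h5]
  nlinarith [mul_le_mul_of_nonneg_left h4 (sq_nonneg t), sq_nonneg t, sq_nonneg η,
    mul_le_mul_of_nonneg_right (min_le_left (F.q₀ / 2) 1) (sq_nonneg t),
    mul_le_mul_of_nonneg_right (min_le_right (F.q₀ / 2) 1) (sq_nonneg η)]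

theorem continuous_dist2 : Continuous fun p : ℝ × ℝ => F.dist2 p.1 p.2 := by
  have := F.cont_q
  have := F.cont_f
  unfold dist2
  fun_prop

/-- On the scale `t = ηu` the curve looks straight: `q(0) = 1` and the cross term is of higher
order, so the ratio tends to `1`. For fixed `t` only `t² q` survives in the denominator. -/
theorem exists_isBlockRatio : ∃ η₀ C, IsBlockRatio F.T η₀ C F.ratio (fun t => (F.q t)⁻¹) ∧
    ∀ η ∈ Ioc 0 η₀, ∀ t ∈ Icc (-F.T) F.T, 0 < F.dist2 η t := by
  obtain ⟨η₀, hη₀, c₀, hc₀, hge⟩ := F.exists_dist2_ge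
  have hpos : ∀ η ∈ Ioc 0 η₀, ∀ t ∈ Icc (-F.T) F.T, 0 < F.dist2 η t := fun η hη t ht =>
    lt_of_lt_of_le (mul_pos hc₀ (sq_add_sq_pos_of_pos hη.1 t)) (hge η ⟨hη.1.le, hη.2⟩ t ht)
  have hid : Tendsto (fun η : ℝ => η) (𝓝[>] 0) (𝓝 0) := nhdsWithin_le_nhds
  refine ⟨η₀, c₀⁻¹, ⟨hη₀, fun η hη => ?_, fun η hη t ht => ?_, fun t ht h0 => ?_, fun u => ?_⟩,
    hpos⟩
  · refine ContinuousOn.div (by fun_prop) ?_ fun t ht => (hpos η hη t ht).ne'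
    exact (F.continuous_dist2.comp (continuous_const.prodMk continuous_id)).continuousOn
  · have h1 := hpos η hη t ht
    have h2 := hge η ⟨hη.1.le, hη.2⟩ t ht
    have h3 := sq_add_sq_pos_of_pos hη.1 t
    rw [ratio, abs_of_pos (div_pos h3 h1), div_le_iff₀ h1, inv_mul_eq_div, le_div_iff₀ hc₀]
    linarith
  · have hq : 0 < F.q t := F.q₀_pos.trans_le (F.q₀_le t ht)
    have hd : Tendsto (fun η : ℝ => F.dist2 η t) (𝓝[>] 0) (𝓝 (F.dist2 0 t)) :=
      ((F.continuous_dist2.comp (continuous_id.prodMk continuous_const)).tendsto 0).comp hid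
    have hd0 : F.dist2 0 t = t ^ 2 * F.q t := by simp [dist2]
    rw [hd0] at hd
    have h := (tendsto_const_nhds (x := t ^ 2)).add (hid.pow 2)
    have hl := h.div hd (by positivity)
    have e : (t ^ 2 + 0 ^ 2) / (t ^ 2 * F.q t) = (F.q t)⁻¹ := by field_simp; ring
    rw [e] at hl
    exact hl
  · have hmulu : Tendsto (fun η : ℝ => η * u) (𝓝[>] 0) (𝓝 0) := by
      simpa using hid.mul_const u
    have h1 : Tendsto (fun η => u ^ 2 * F.q (η * u) + 2 * F.s * η * u ^ 2 * F.f (η * u) + 1)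
        (𝓝[>] 0) (𝓝 (u ^ 2 * F.q 0 + 2 * F.s * 0 * u ^ 2 * F.f 0 + 1)) :=
      (((((F.cont_q.tendsto 0).comp hmulu).const_mul _).add
        (((hid.const_mul (2 * F.s)).mul_const _).mul ((F.cont_f.tendsto 0).comp hmulu)))).add_const 1
    have hq0 : F.q 0 = 1 := by simp [F.q_eq]
    have h2 : u ^ 2 * F.q 0 + 2 * F.s * 0 * u ^ 2 * F.f 0 + 1 = u ^ 2 + 1 := by
      rw [hq0]; ring
    rw [h2] at h1
    have h3 := (tendsto_const_nhds (x := u ^ 2 + 1)).div h1 (by positivity)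
    rw [div_self (by positivity)] at h3
    refine h3.congr' ?_
    filter_upwards [self_mem_nhdsWithin] with η (hη : 0 < η)
    simp only [Pi.div_apply, ratio, dist2]
    have e1 : (η * u) ^ 2 + η ^ 2 = η ^ 2 * (u ^ 2 + 1) := by ring
    have e2 : (η * u) ^ 2 * F.q (η * u) + 2 * F.s * η * (η * u) ^ 2 * F.f (η * u) + η ^ 2
        = η ^ 2 * (u ^ 2 * F.q (η * u) + 2 * F.s * η * u ^ 2 * F.f (η * u) + 1) := by ring
    rw [e1, e2, mul_div_mul_left _ _ (by positivity)]

/-- A kernel that splits into a concentrating and a bounded part. -/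
theorem tendsto_integral_split {K : ℝ → ℝ → ℝ} {K₀ : ℝ → ℝ} {P R : ℝ → ℝ → ℝ → ℝ → ℝ → ℝ}
    (hP : ContFive P) (hR : ContFive R)
    (hK : ∀ η t, 0 < η → 0 < F.dist2 η t →
      K η t = η / (t ^ 2 + η ^ 2) * blockEval P F.ratio η t + blockEval R F.ratio η t)
    (hK₀ : ∀ t, t ≠ 0 → 0 < F.q t → K₀ t = R 0 t 0 0 (F.q t)⁻¹) {σ : ℝ → ℂ} (hσ : Continuous σ) :
    Tendsto (fun η => ∫ t in (-F.T)..F.T, (K η t : ℂ) * σ t) (𝓝[>] 0)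
      (𝓝 (((∫ u : ℝ, (1 + u ^ 2)⁻¹ * P 0 0 (1 + u ^ 2)⁻¹ (u * (1 + u ^ 2)⁻¹) 1 : ℝ) : ℂ) * σ 0
        + ∫ t in (-F.T)..F.T, (K₀ t : ℂ) * σ t)) := by
  obtain ⟨η₀, C, h, hpos⟩ := F.exists_isBlockRatio
  have hsub : Set.uIoc (-F.T) F.T ⊆ Icc (-F.T) F.T := by
    rw [Set.uIoc_of_le (by linarith [F.T_pos])]; exact Ioc_subset_Icc_self
  have hsub' : Set.uIcc (-F.T) F.T = Icc (-F.T) F.T := Set.uIcc_of_le (by linarith [F.T_pos])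
  have e0 : ∫ t in (-F.T)..F.T, (K₀ t : ℂ) * σ t
      = ∫ t in (-F.T)..F.T, (R 0 t 0 0 (F.q t)⁻¹ : ℂ) * σ t := by
    refine intervalIntegral.integral_congr_ae ?_
    have h0 : ∀ᵐ t : ℝ, t ≠ 0 := by simp [ae_iff]
    filter_upwards [h0] with t ht htm
    rw [hK₀ t ht (F.q₀_pos.trans_le (F.q₀_le t (hsub htm)))]
  rw [e0]
  refine ((h.tendsto_integral_concentrating hP F.T_pos hσ).add
    (h.tendsto_integral_bounded hR F.T_pos hσ)).congr' ?_
  filter_upwards [h.eventually_mem] with η hη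
  have hne : ∀ t : ℝ, t ^ 2 + η ^ 2 ≠ 0 := fun t => (sq_add_sq_pos_of_pos hη.1 t).ne'
  have h1 : Continuous fun t : ℝ => η / (t ^ 2 + η ^ 2) := continuous_const.div (by fun_prop) hne
  rw [← intervalIntegral.integral_add]
  · refine intervalIntegral.integral_congr fun t ht => ?_
    rw [hsub'] at ht
    simp only [hK η t hη.1 (hpos η hη t ht)]
    push_cast
    ring
  · refine ContinuousOn.intervalIntegrable ?_
    rw [hsub']
    exact (Complex.continuous_ofReal.comp_continuousOn
      (h1.continuousOn.mul (h.continuousOn_blockEval hP hη))).mul hσ.continuousOn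
  · refine ContinuousOn.intervalIntegrable ?_
    rw [hsub']
    exact (Complex.continuous_ofReal.comp_continuousOn
      (h.continuousOn_blockEval hR hη)).mul hσ.continuousOn

end LocalFrame

end

/-! ### Jump relations of the biharmonic kernels in local coordinates: the integrable entries. -/

noncomputable section

namespace LocalFrame

variable (F : LocalFrame)

/-- The biharmonic kernels in local coordinates. -/
def locKer : Fin 2 → Fin 2 → ℝ → ℝ → ℝ :=
  ![![fun η t => -(1 / Real.pi) * (F.nComp η t ^ 3 / F.dist2 η t ^ 2),
      fun η t => -(1 / (2 * Real.pi)) * (F.nComp η t ^ 2 / F.dist2 η t)],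
    ![fun η t => -(1 / Real.pi) * (3 * F.nComp η t ^ 2 * F.c t / F.dist2 η t ^ 2
        - 4 * F.nComp η t ^ 3 * F.vComp η t / F.dist2 η t ^ 3),
      fun η t => -(1 / Real.pi) * (F.nComp η t * F.c t / F.dist2 η t
        - F.nComp η t ^ 2 * F.vComp η t / F.dist2 η t ^ 2)]]

/-- The jump coefficients `(-½, 0; κ, -½)` with `κ = 2 f(0)`. -/
def locJump : Fin 2 → Fin 2 → ℝ :=
  ![![-F.s / 2, 0], ![2 * F.s * F.f 0, -F.s / 2]]

theorem inv_dist2 {η t : ℝ} (hη : 0 < η) :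
    (F.dist2 η t)⁻¹ = F.ratio η t * (t ^ 2 + η ^ 2)⁻¹ := by
  have h := (sq_add_sq_pos_of_pos hη t).ne'
  rw [ratio]
  field_simp

/-- With `α = η²/(t²+η²)`, every factor `t²` coming from curvature pairs with a `1/(t²+η²)` to give
the bounded factor `1 - α`. -/
theorem one_sub_block {η t : ℝ} (hη : 0 < η) :
    1 - η ^ 2 * (t ^ 2 + η ^ 2)⁻¹ = t ^ 2 * (t ^ 2 + η ^ 2)⁻¹ := by
  have h := (sq_add_sq_pos_of_pos hη t).ne'
  field_simp
  ring

/-- Expansion of the ratio around its flat value `1`, from `t² + η² - dist2 = t² (t Q - 2 s η f)`.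
The correction is of first order in `t` and `η`, which brings an `η⁻²` singularity down to `η⁻¹`. -/
theorem ratio_eq {η t : ℝ} (hη : 0 < η) (hD : 0 < F.dist2 η t) :
    F.ratio η t = 1 + F.ratio η t * (t ^ 2 + η ^ 2)⁻¹ * t ^ 2
      * (t * F.Q t - 2 * F.s * η * F.f t) := by
  rw [← F.inv_dist2 hη, ratio]
  field_simp
  rw [dist2, F.q_eq]
  ring

theorem c_zero : F.c 0 = 1 := by simp [F.c_eq]

/-- Up to the factor `-s²/π`, the right side is the kernel of the normal derivative of `K₁` for a
straight boundary. It has size `η⁻²` near `t = 0`, but is an exact derivative. -/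
theorem hasDerivAt_dipole {η : ℝ} (hη : 0 < η) (t : ℝ) :
    HasDerivAt (fun t : ℝ => -(η ^ 2 * t / (t ^ 2 + η ^ 2) ^ 2))
      (3 * η ^ 2 / (t ^ 2 + η ^ 2) ^ 2 - 4 * η ^ 4 / (t ^ 2 + η ^ 2) ^ 3) t := by
  have hne := (sq_add_sq_pos_of_pos hη t).ne'
  have h1 : HasDerivAt (fun t : ℝ => t ^ 2 + η ^ 2) (2 * t) t := by
    simpa using (hasDerivAt_pow 2 t).add_const (η ^ 2)
  have h2 : HasDerivAt (fun t : ℝ => η ^ 2 * t) (η ^ 2) t := by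
    simpa using (hasDerivAt_id t).const_mul (η ^ 2)
  refine (h2.div (h1.pow 2) (pow_ne_zero 2 hne)).neg.congr_deriv ?_
  simp only [Pi.pow_apply]
  field_simp
  norm_num
  ring

/-- Integration by parts moves the derivative to `σ`. The boundary terms are `O(η²)`, and what
remains concentrates with the odd profile `u/(1+u²)²`, whose integral is zero. Among the local
limits, this is where the derivative of the density is needed. -/
theorem tendsto_integral_dipole {σ : ℝ → ℂ} (hσ : ContDiff ℝ 1 σ) :
    Tendsto (fun η : ℝ => ∫ t in (-F.T)..F.T,
      ((3 * η ^ 2 / (t ^ 2 + η ^ 2) ^ 2 - 4 * η ^ 4 / (t ^ 2 + η ^ 2) ^ 3 : ℝ) : ℂ) * σ t)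
      (𝓝[>] 0) (𝓝 0) := by
  obtain ⟨η₀, C, h, -⟩ := F.exists_isBlockRatio
  have hT := F.T_pos
  have hid : Tendsto (fun η : ℝ => η) (𝓝[>] 0) (𝓝 0) := nhdsWithin_le_nhds
  have hχ : ContFive fun _ _ _ χ _ => χ := by unfold ContFive; fun_prop
  have hmain := h.tendsto_integral_concentrating hχ hT (hσ.continuous_deriv le_rfl)
  -- Vanishing by the reflection `u ↦ -u`.
  have hodd : ∫ u : ℝ, (1 + u ^ 2)⁻¹ * (u * (1 + u ^ 2)⁻¹) = 0 := by
    have := integral_neg_eq_self (fun u : ℝ => (1 + u ^ 2)⁻¹ * (u * (1 + u ^ 2)⁻¹)) volume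
    have h2 : (fun u : ℝ => (1 + (-u) ^ 2)⁻¹ * (-u * (1 + (-u) ^ 2)⁻¹))
        = fun u : ℝ => -((1 + u ^ 2)⁻¹ * (u * (1 + u ^ 2)⁻¹)) := by
      funext u; rw [neg_sq]; ring
    rw [h2, integral_neg] at this
    linarith
  rw [hodd, Complex.ofReal_zero, zero_mul] at hmain
  have hb : ∀ a : ℝ, a ≠ 0 → Tendsto (fun η : ℝ => -(η ^ 2 * a / (a ^ 2 + η ^ 2) ^ 2))
      (𝓝[>] 0) (𝓝 0) := fun a ha => by
    have := (((hid.pow 2).mul_const a).div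
      (((tendsto_const_nhds (x := a ^ 2)).add (hid.pow 2)).pow 2) (by positivity)).neg
    simpa [Pi.div_def] using this
  have hb' : ∀ a : ℝ, a ≠ 0 → Tendsto
      (fun η : ℝ => ((-(η ^ 2 * a / (a ^ 2 + η ^ 2) ^ 2) : ℝ) : ℂ) * σ a) (𝓝[>] 0) (𝓝 0) :=
    fun a ha => by
      have := ((Complex.continuous_ofReal.tendsto 0).comp (hb a ha)).mul_const (σ a)
      simpa [Function.comp_def] using this
  have htot := ((hb' F.T hT.ne').sub (hb' (-F.T) (by linarith))).add hmain
  simp only [sub_zero, add_zero] at htot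
  refine htot.congr' ?_
  filter_upwards [self_mem_nhdsWithin] with η (hη : 0 < η)
  have hne : ∀ t : ℝ, t ^ 2 + η ^ 2 ≠ 0 := fun t => (sq_add_sq_pos_of_pos hη t).ne'
  have hcont : Continuous fun t : ℝ =>
      3 * η ^ 2 / (t ^ 2 + η ^ 2) ^ 2 - 4 * η ^ 4 / (t ^ 2 + η ^ 2) ^ 3 :=
    (continuous_const.div (by fun_prop) fun t => pow_ne_zero _ (hne t)).sub
      (continuous_const.div (by fun_prop) fun t => pow_ne_zero _ (hne t))
  have ibp := intervalIntegral.integral_mul_deriv_eq_deriv_mul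
    (u := σ) (u' := deriv σ) (a := -F.T) (b := F.T)
    (fun t _ => (hσ.differentiable (by simp) t).hasDerivAt)
    (fun t _ => (hasDerivAt_dipole hη t).ofReal_comp)
    ((hσ.continuous_deriv le_rfl).intervalIntegrable _ _)
    ((Complex.continuous_ofReal.comp hcont).intervalIntegrable _ _)
  have e1 : ∀ t : ℝ, ((3 * η ^ 2 / (t ^ 2 + η ^ 2) ^ 2 - 4 * η ^ 4 / (t ^ 2 + η ^ 2) ^ 3 : ℝ) : ℂ)
      * σ t = σ t * ((3 * η ^ 2 / (t ^ 2 + η ^ 2) ^ 2 - 4 * η ^ 4 / (t ^ 2 + η ^ 2) ^ 3 : ℝ) : ℂ) :=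
    fun t => mul_comm _ _
  simp only [e1]
  rw [ibp]
  have e2 : ∫ t in (-F.T)..F.T, deriv σ t * ((-(η ^ 2 * t / (t ^ 2 + η ^ 2) ^ 2) : ℝ) : ℂ)
      = -∫ t in (-F.T)..F.T,
        ((η / (t ^ 2 + η ^ 2) * blockEval (fun _ _ _ χ _ => χ) F.ratio η t : ℝ) : ℂ)
          * deriv σ t := by
    rw [← intervalIntegral.integral_neg]
    refine intervalIntegral.integral_congr fun t _ => ?_
    have := hne t
    simp only [blockEval]
    have e : η ^ 2 * t / (t ^ 2 + η ^ 2) ^ 2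
        = η / (t ^ 2 + η ^ 2) * (η * t / (t ^ 2 + η ^ 2)) := by field_simp
    rw [e]
    push_cast
    ring
  rw [e2]
  ring

/-- In the expansion of `(sηc + t²e)³ / dist2²` only `η³` concentrates. Its profile is
`-(s³/π)(1+u²)⁻²`, with integral `-s/2`. -/
theorem tendsto_integral_locKer_zero_zero {σ : ℝ → ℂ} (hσ : Continuous σ) :
    Tendsto (fun η => ∫ t in (-F.T)..F.T, (F.locKer 0 0 η t : ℂ) * σ t) (𝓝[>] 0)
      (𝓝 ((F.locJump 0 0 : ℂ) * σ 0 + ∫ t in (-F.T)..F.T, (F.locKer 0 0 0 t : ℂ) * σ t)) := by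
  have cc := F.cont_c
  have ce := F.cont_e
  have h := F.tendsto_integral_split
    (K := F.locKer 0 0) (K₀ := F.locKer 0 0 0)
    (P := fun _ t α _ θ => -(1 / Real.pi) * (F.s ^ 3 * F.c t ^ 3 * α * θ ^ 2))
    (R := fun η t α _ θ => -(1 / Real.pi) * (3 * F.s ^ 2 * F.c t ^ 2 * F.e t * α * (1 - α) * θ ^ 2
      + 3 * F.s * η * F.c t * F.e t ^ 2 * (1 - α) ^ 2 * θ ^ 2
      + F.e t ^ 3 * t ^ 2 * (1 - α) ^ 2 * θ ^ 2))
    (by unfold ContFive; fun_prop) (by unfold ContFive; fun_prop)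
    (fun η t hη hD => by
      simp only [locKer, blockEval, Matrix.cons_val_zero, nComp, div_eq_mul_inv, ← inv_pow,
        F.inv_dist2 hη, one_sub_block hη]
      ring)
    (fun t ht hq => by
      simp only [locKer, Matrix.cons_val_zero, nComp, dist2]
      field_simp
      ring) hσ
  convert h using 5
  simp only [locJump, Matrix.cons_val_zero, F.c_zero]
  have e : ∀ u : ℝ, (1 + u ^ 2)⁻¹ * (-(1 / Real.pi) * (F.s ^ 3 * 1 ^ 3 * (1 + u ^ 2)⁻¹ * 1 ^ 2))
      = -(1 / Real.pi) * F.s ^ 3 * ((1 + u ^ 2)⁻¹) ^ 2 := fun u => by ring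
  simp only [e]
  rw [integral_const_mul, integral_inv_one_add_sq_pow_two]
  have := Real.pi_ne_zero
  field_simp
  linear_combination F.s * F.s_sq

/-- The kernel `nComp²/dist2` is bounded uniformly in `η`, so nothing concentrates and there is no
jump. -/
theorem tendsto_integral_locKer_zero_one {σ : ℝ → ℂ} (hσ : Continuous σ) :
    Tendsto (fun η => ∫ t in (-F.T)..F.T, (F.locKer 0 1 η t : ℂ) * σ t) (𝓝[>] 0)
      (𝓝 ((F.locJump 0 1 : ℂ) * σ 0 + ∫ t in (-F.T)..F.T, (F.locKer 0 1 0 t : ℂ) * σ t)) := by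
  have cc := F.cont_c
  have ce := F.cont_e
  have h := F.tendsto_integral_split
    (K := F.locKer 0 1) (K₀ := F.locKer 0 1 0)
    (P := fun _ _ _ _ _ => 0)
    (R := fun η t α _ θ => -(1 / (2 * Real.pi)) * (θ * (F.s ^ 2 * F.c t ^ 2 * α
      + 2 * F.s * F.c t * F.e t * η * (1 - α) + F.e t ^ 2 * t ^ 2 * (1 - α))))
    (by unfold ContFive; fun_prop) (by unfold ContFive; fun_prop)
    (fun η t hη hD => by
      simp only [locKer, blockEval, Matrix.cons_val_zero, Matrix.cons_val_one, nComp,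
        div_eq_mul_inv, F.inv_dist2 hη, one_sub_block hη]
      ring)
    (fun t ht hq => by
      simp only [locKer, Matrix.cons_val_zero, Matrix.cons_val_one, nComp, dist2]
      field_simp
      ring) hσ
  convert h using 5
  simp [locJump]

/-- The terms odd in the displacement, `η/dist2` and `η³/dist2²`, concentrate. Their profiles
contribute `-(s/π)(π - π/2) = -s/2`. -/
theorem tendsto_integral_locKer_one_one {σ : ℝ → ℂ} (hσ : Continuous σ) :
    Tendsto (fun η => ∫ t in (-F.T)..F.T, (F.locKer 1 1 η t : ℂ) * σ t) (𝓝[>] 0)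
      (𝓝 ((F.locJump 1 1 : ℂ) * σ 0 + ∫ t in (-F.T)..F.T, (F.locKer 1 1 0 t : ℂ) * σ t)) := by
  have cc := F.cont_c
  have ce := F.cont_e
  have cf := F.cont_f
  have h := F.tendsto_integral_split
    (K := F.locKer 1 1) (K₀ := F.locKer 1 1 0)
    (P := fun _ t α _ θ => -(1 / Real.pi) * (F.s * F.c t ^ 2 * θ - F.s ^ 3 * F.c t ^ 2 * α * θ ^ 2))
    (R := fun η t α _ θ => -(1 / Real.pi) * (F.e t * F.c t * (1 - α) * θ
      - θ ^ 2 * (α * (1 - α) * (F.s ^ 2 * F.c t ^ 2 * F.f t + 2 * F.s ^ 2 * F.c t * F.e t)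
        + F.s * η * (1 - α) ^ 2 * (2 * F.c t * F.e t * F.f t + F.e t ^ 2)
        + t ^ 2 * (1 - α) ^ 2 * F.e t ^ 2 * F.f t)))
    (by unfold ContFive; fun_prop) (by unfold ContFive; fun_prop)
    (fun η t hη hD => by
      simp only [locKer, blockEval, Matrix.cons_val_zero, Matrix.cons_val_one, nComp, vComp,
        div_eq_mul_inv, ← inv_pow, F.inv_dist2 hη, one_sub_block hη]
      ring)
    (fun t ht hq => by
      simp only [locKer, Matrix.cons_val_zero, Matrix.cons_val_one, nComp, vComp, dist2]
      field_simp
      ring) hσ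
  convert h using 5
  simp only [locJump, Matrix.cons_val_zero, Matrix.cons_val_one, F.c_zero]
  have e : ∀ u : ℝ, (1 + u ^ 2)⁻¹ * (-(1 / Real.pi) * (F.s * 1 ^ 2 * 1
      - F.s ^ 3 * 1 ^ 2 * (1 + u ^ 2)⁻¹ * 1 ^ 2))
      = -(1 / Real.pi) * F.s * ((1 + u ^ 2)⁻¹) ^ 1
        + (1 / Real.pi) * F.s ^ 3 * ((1 + u ^ 2)⁻¹) ^ 2 := fun u => by ring
  simp only [e]
  rw [integral_add ((integral_inv_one_add_sq_pow_succ 1 (by norm_num)).1.const_mul _)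
    ((integral_inv_one_add_sq_pow_succ 2 (by norm_num)).1.const_mul _),
    integral_const_mul, integral_const_mul, integral_inv_one_add_sq_pow_one,
    integral_inv_one_add_sq_pow_two]
  have := Real.pi_ne_zero
  field_simp
  linear_combination -F.s * F.s_sq

end LocalFrame

end

/-! ### The normal derivative of the `K₁` part, the most singular entry, and its curvature jump. -/

noncomputable section

theorem integral_four_inv_one_add_sq_pow (a b c d : ℝ) :
    (∫ u : ℝ, (a * ((1 + u ^ 2)⁻¹) ^ 1 + b * ((1 + u ^ 2)⁻¹) ^ 2 + c * ((1 + u ^ 2)⁻¹) ^ 3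
      + d * ((1 + u ^ 2)⁻¹) ^ 4)) =
      a * Real.pi + b * (Real.pi / 2) + c * (3 * Real.pi / 8) + d * (5 * Real.pi / 16) := by
  have i1 := ((integral_inv_one_add_sq_pow_succ 1 (by norm_num)).1).const_mul a
  have i2 := ((integral_inv_one_add_sq_pow_succ 2 (by norm_num)).1).const_mul b
  have i3 := ((integral_inv_one_add_sq_pow_succ 3 (by norm_num)).1).const_mul c
  have i4 := ((integral_inv_one_add_sq_pow_succ 4 (by norm_num)).1).const_mul d
  have i12 : Integrable fun u : ℝ => a * ((1 + u ^ 2)⁻¹) ^ 1 + b * ((1 + u ^ 2)⁻¹) ^ 2 := i1.add i2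
  have i123 : Integrable fun u : ℝ => a * ((1 + u ^ 2)⁻¹) ^ 1 + b * ((1 + u ^ 2)⁻¹) ^ 2
      + c * ((1 + u ^ 2)⁻¹) ^ 3 := i12.add i3
  rw [integral_add i123 i4, integral_add i12 i3, integral_add i1 i2, integral_const_mul,
    integral_const_mul, integral_const_mul, integral_const_mul, integral_inv_one_add_sq_pow_one,
    integral_inv_one_add_sq_pow_two, integral_inv_one_add_sq_pow_three,
    integral_inv_one_add_sq_pow_four]

namespace LocalFrame

variable (F : LocalFrame)

/-- Adding the flat dipole removes the `η⁻²` singularity. Its coefficients differ from the actual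
ones by `c³ - 1 = -t² g (1 + c + c²)`, which gives bounded terms, and by `θ² - 1`, `θ³ - 1`, which
by `ratio_eq` give concentrating terms. The mixed products of `η` and `t² e`, `t² f` supply the
rest. -/
theorem locKer_one_zero_split {η t : ℝ} (hη : 0 < η) (hD : 0 < F.dist2 η t) :
    F.locKer 1 0 η t
      + 1 / Real.pi * (3 * η ^ 2 / (t ^ 2 + η ^ 2) ^ 2 - 4 * η ^ 4 / (t ^ 2 + η ^ 2) ^ 3)
    = η / (t ^ 2 + η ^ 2) * blockEval (fun _ t α χ θ => -(1 / Real.pi) *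
        (6 * F.s * F.c t ^ 2 * F.e t * (1 - α) * θ ^ 2
        + 3 * (θ + 1) * θ * (1 - α) * (χ * F.Q t - 2 * F.s * α * F.f t)
        - 4 * α * (1 - α) * θ ^ 3 * F.s ^ 3 * (F.c t ^ 3 * F.f t + 3 * F.c t ^ 2 * F.e t)
        - 4 * α * (θ ^ 2 + θ + 1) * θ * (1 - α) * (χ * F.Q t - 2 * F.s * α * F.f t))) F.ratio η t
      + blockEval (fun η t α _ θ => -(1 / Real.pi) *
        (3 * F.e t ^ 2 * F.c t * (1 - α) ^ 2 * θ ^ 2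
        - 3 * α * (1 - α) * θ ^ 2 * F.g t * (1 + F.c t + F.c t ^ 2)
        + 4 * α ^ 2 * (1 - α) * θ ^ 3 * F.g t * (1 + F.c t + F.c t ^ 2)
        - 4 * (α * (1 - α) ^ 2 * θ ^ 3 * F.s ^ 2
            * (3 * F.c t ^ 2 * F.e t * F.f t + 3 * F.c t * F.e t ^ 2)
          + F.s * η * (1 - α) ^ 3 * θ ^ 3 * (3 * F.c t * F.e t ^ 2 * F.f t + F.e t ^ 3)
          + t ^ 2 * (1 - α) ^ 3 * θ ^ 3 * F.e t ^ 3 * F.f t))) F.ratio η t := by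
  have hθ := F.ratio_eq hη hD
  have hc := F.c_eq t
  simp only [locKer, blockEval, Matrix.cons_val_zero, Matrix.cons_val_one, nComp, vComp,
    div_eq_mul_inv, ← inv_pow, F.inv_dist2 hη, one_sub_block hη]
  generalize F.ratio η t = θ at *
  generalize (t ^ 2 + η ^ 2)⁻¹ = r at *
  generalize F.c t = c at *
  generalize F.e t = e at *
  generalize F.f t = f at *
  generalize F.g t = g at *
  generalize F.Q t = W at *
  have hs := F.s_sq
  generalize F.s = s at *
  generalize Real.pi⁻¹ = p at *
  -- The three lines replace `s²`, `c³` and the powers of the ratio by `1`; the cofactors `c² + c +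
  -- 1`, `θ + 1`, `θ² + θ + 1` come from factoring `c³ - 1`, `θ² - 1`, `θ³ - 1`.
  linear_combination
    (-p * (3 * η ^ 2 * c ^ 3 * (θ * r) ^ 2 - 4 * η ^ 4 * c ^ 3 * (θ * r) ^ 3 * (s ^ 2 + 1))) * hs
    + (-p * (3 * η ^ 2 * (θ * r) ^ 2 - 4 * η ^ 4 * (θ * r) ^ 3) * (c ^ 2 + c + 1)) * hc
    + (-p * (3 * η ^ 2 * r ^ 2 * (θ + 1) - 4 * η ^ 4 * r ^ 3 * (θ ^ 2 + θ + 1))) * hθ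

theorem tendsto_integral_locKer_one_zero {σ : ℝ → ℂ} (hσ : ContDiff ℝ 1 σ) :
    Tendsto (fun η => ∫ t in (-F.T)..F.T, (F.locKer 1 0 η t : ℂ) * σ t) (𝓝[>] 0)
      (𝓝 ((F.locJump 1 0 : ℂ) * σ 0 + ∫ t in (-F.T)..F.T, (F.locKer 1 0 0 t : ℂ) * σ t)) := by
  have cc := F.cont_c
  have ce := F.cont_e
  have cf := F.cont_f
  have cg := F.cont_g
  have cQ := F.cont_Q
  set dip : ℝ → ℝ → ℝ := fun η t =>
    3 * η ^ 2 / (t ^ 2 + η ^ 2) ^ 2 - 4 * η ^ 4 / (t ^ 2 + η ^ 2) ^ 3 with hdip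
  have h := F.tendsto_integral_split
    (K := fun η t => F.locKer 1 0 η t + 1 / Real.pi * dip η t) (K₀ := F.locKer 1 0 0)
    (by unfold ContFive; fun_prop) (by unfold ContFive; fun_prop)
    (fun η t hη hD => F.locKer_one_zero_split hη hD)
    (fun t ht hq => by
      simp only [locKer, Matrix.cons_val_zero, Matrix.cons_val_one, nComp, vComp, dist2]
      field_simp
      ring) hσ.continuous
  -- The dipole added for the splitting is subtracted again at no cost, its integral having limit
  -- zero.
  have hd := (F.tendsto_integral_dipole hσ).const_mul (((1 / Real.pi : ℝ) : ℂ))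
  rw [mul_zero] at hd
  have hsub := h.sub hd
  rw [sub_zero] at hsub
  have hval : (∫ u : ℝ, (1 + u ^ 2)⁻¹ * (-(1 / Real.pi) *
        (6 * F.s * F.c 0 ^ 2 * F.e 0 * (1 - (1 + u ^ 2)⁻¹) * 1 ^ 2
        + 3 * (1 + 1) * 1 * (1 - (1 + u ^ 2)⁻¹) * (u * (1 + u ^ 2)⁻¹ * F.Q 0
          - 2 * F.s * (1 + u ^ 2)⁻¹ * F.f 0)
        - 4 * (1 + u ^ 2)⁻¹ * (1 - (1 + u ^ 2)⁻¹) * 1 ^ 3 * F.s ^ 3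
          * (F.c 0 ^ 3 * F.f 0 + 3 * F.c 0 ^ 2 * F.e 0)
        - 4 * (1 + u ^ 2)⁻¹ * (1 ^ 2 + 1 + 1) * 1 * (1 - (1 + u ^ 2)⁻¹) * (u * (1 + u ^ 2)⁻¹ * F.Q 0
          - 2 * F.s * (1 + u ^ 2)⁻¹ * F.f 0)))) = F.locJump 1 0 := by
    simp only [F.c_zero, F.Q_zero, F.e_zero]
    have e : ∀ u : ℝ, (1 + u ^ 2)⁻¹ * (-(1 / Real.pi) *
        (6 * F.s * 1 ^ 2 * -F.f 0 * (1 - (1 + u ^ 2)⁻¹) * 1 ^ 2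
        + 3 * (1 + 1) * 1 * (1 - (1 + u ^ 2)⁻¹) * (u * (1 + u ^ 2)⁻¹ * 0
          - 2 * F.s * (1 + u ^ 2)⁻¹ * F.f 0)
        - 4 * (1 + u ^ 2)⁻¹ * (1 - (1 + u ^ 2)⁻¹) * 1 ^ 3 * F.s ^ 3
          * (1 ^ 3 * F.f 0 + 3 * 1 ^ 2 * -F.f 0)
        - 4 * (1 + u ^ 2)⁻¹ * (1 ^ 2 + 1 + 1) * 1 * (1 - (1 + u ^ 2)⁻¹) * (u * (1 + u ^ 2)⁻¹ * 0
          - 2 * F.s * (1 + u ^ 2)⁻¹ * F.f 0)))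
        = 6 / Real.pi * F.s * F.f 0 * ((1 + u ^ 2)⁻¹) ^ 1
          + (6 / Real.pi * F.s * F.f 0 - 8 / Real.pi * F.s ^ 3 * F.f 0) * ((1 + u ^ 2)⁻¹) ^ 2
          + (8 / Real.pi * F.s ^ 3 * F.f 0 - 36 / Real.pi * F.s * F.f 0) * ((1 + u ^ 2)⁻¹) ^ 3
          + 24 / Real.pi * F.s * F.f 0 * ((1 + u ^ 2)⁻¹) ^ 4 := fun u => by ring
    simp only [e]
    -- With `s² = 1` the four contributions, in units of `s f(0)`, are `6 - 1 - 21/2 + 15/2 = 2`.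
    rw [integral_four_inv_one_add_sq_pow]
    have := Real.pi_ne_zero
    simp only [locJump, Matrix.cons_val_zero, Matrix.cons_val_one]
    field_simp
    rw [F.s_sq]
    ring
  rw [hval] at hsub
  refine hsub.congr' ?_
  obtain ⟨η₀, C, hb, hpos⟩ := F.exists_isBlockRatio
  have hsub' : Set.uIcc (-F.T) F.T = Icc (-F.T) F.T := Set.uIcc_of_le (by linarith [F.T_pos])
  filter_upwards [hb.eventually_mem] with η hη
  have hne : ∀ t : ℝ, t ^ 2 + η ^ 2 ≠ 0 := fun t => (sq_add_sq_pos_of_pos hη.1 t).ne'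
  have hcont : Continuous (dip η) :=
    (continuous_const.div (by fun_prop) fun t => pow_ne_zero _ (hne t)).sub
      (continuous_const.div (by fun_prop) fun t => pow_ne_zero _ (hne t))
  have hD : ContinuousOn (F.dist2 η) (Icc (-F.T) F.T) :=
    (F.continuous_dist2.comp (continuous_const.prodMk continuous_id)).continuousOn
  have hn : Continuous (F.nComp η) := by unfold nComp; fun_prop
  have hv : Continuous (F.vComp η) := by unfold vComp; fun_prop
  have hK : ContinuousOn (F.locKer 1 0 η) (Icc (-F.T) F.T) := by
    refine continuousOn_const.mul (ContinuousOn.sub (ContinuousOn.div ?_ (hD.pow 2) fun t ht =>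
      pow_ne_zero _ (hpos η hη t ht).ne') (ContinuousOn.div ?_ (hD.pow 3) fun t ht =>
      pow_ne_zero _ (hpos η hη t ht).ne'))
    · fun_prop
    · fun_prop
  rw [← intervalIntegral.integral_const_mul, ← intervalIntegral.integral_sub]
  · refine intervalIntegral.integral_congr fun t _ => ?_
    simp only [hdip]
    push_cast
    ring
  · refine ContinuousOn.intervalIntegrable ?_
    rw [hsub']
    exact (Complex.continuous_ofReal.comp_continuousOn
      (hK.add (continuous_const.mul hcont).continuousOn)).mul hσ.continuous.continuousOn
  · exact (continuous_const.mul ((Complex.continuous_ofReal.comp hcont).mul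
      hσ.continuous)).intervalIntegrable _ _

/-- The jump relations of the biharmonic kernels, in local coordinates. -/
theorem tendsto_integral_locKer (i j : Fin 2) {σ : ℝ → ℂ} (hσ : ContDiff ℝ 1 σ) :
    Tendsto (fun η => ∫ t in (-F.T)..F.T, (F.locKer i j η t : ℂ) * σ t) (𝓝[>] 0)
      (𝓝 ((F.locJump i j : ℂ) * σ 0 + ∫ t in (-F.T)..F.T, (F.locKer i j 0 t : ℂ) * σ t)) := by
  fin_cases i <;> fin_cases j
  · exact F.tendsto_integral_locKer_zero_zero hσ.continuous
  · exact F.tendsto_integral_locKer_zero_one hσ.continuous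
  · exact F.tendsto_integral_locKer_one_zero hσ
  · exact F.tendsto_integral_locKer_one_one hσ.continuous

end LocalFrame

end

noncomputable section

/-! ### Taylor quotients of the boundary curves -/

/-- The continuous extension of the difference quotient of a `C¹` curve to the diagonal. -/
def chordSlope (g : ℝ → Plane) (s s' : ℝ) : Plane :=
  ∫ θ in (0 : ℝ)..1, deriv g (s' + θ * (s - s'))

/-- The continuous extension of the second order Taylor quotient of a `C²` curve. -/
def taylorQuot (g : ℝ → Plane) (s s' : ℝ) : Plane :=
  ∫ θ in (0 : ℝ)..1, (1 - θ) • deriv (deriv g) (s' + θ * (s - s'))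

section Curve

variable {g : ℝ → Plane}

theorem sub_eq_smul_chordSlope (hg : ContDiff ℝ 1 g) (s s' : ℝ) :
    g s - g s' = (s - s') • chordSlope g s s' := by
  have h : ∀ θ : ℝ, HasDerivAt (fun θ : ℝ => g (s' + θ * (s - s')))
      ((s - s') • deriv g (s' + θ * (s - s'))) θ := fun θ => by
    have h1 : HasDerivAt (fun θ : ℝ => s' + θ * (s - s')) (s - s') θ := by
      simpa using ((hasDerivAt_id θ).mul_const (s - s')).const_add s'
    exact ((hg.differentiable (by simp)) _).hasDerivAt.scomp θ h1
  have hc : Continuous fun θ : ℝ => deriv g (s' + θ * (s - s')) :=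
    (hg.continuous_deriv le_rfl).comp (by fun_prop)
  have := intervalIntegral.integral_eq_sub_of_hasDerivAt (fun θ _ => h θ)
    ((hc.const_smul (s - s')).intervalIntegrable 0 1)
  rw [intervalIntegral.integral_smul] at this
  rw [chordSlope, this]
  simp

theorem sub_sub_eq_smul_taylorQuot (hg : ContDiff ℝ 2 g) (s s' : ℝ) :
    g s - g s' - (s - s') • deriv g s' = (s - s') ^ 2 • taylorQuot g s s' := by
  have hg1 : ContDiff ℝ 1 (deriv g) := ((contDiff_succ_iff_deriv (n := 1)).1 hg).2.2
  -- The interpolating function runs from `g s' + (s - s') g'(s')` at `θ = 0` to `g s` at `θ = 1`,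
  -- and the first derivative terms cancel on differentiation.
  have h : ∀ θ : ℝ, HasDerivAt
      (fun θ : ℝ => g (s' + θ * (s - s')) + ((1 - θ) * (s - s')) • deriv g (s' + θ * (s - s')))
      ((s - s') ^ 2 • ((1 - θ) • deriv (deriv g) (s' + θ * (s - s')))) θ := fun θ => by
    have h1 : HasDerivAt (fun θ : ℝ => s' + θ * (s - s')) (s - s') θ := by
      simpa using ((hasDerivAt_id θ).mul_const (s - s')).const_add s'
    have h2 : HasDerivAt (fun θ : ℝ => (1 - θ) * (s - s')) (-(s - s')) θ := by
      simpa using ((hasDerivAt_id θ).const_sub 1).mul_const (s - s')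
    have h3 := ((hg.differentiable (by simp)) (s' + θ * (s - s'))).hasDerivAt.scomp θ h1
    have h4 := ((hg1.differentiable (by simp)) (s' + θ * (s - s'))).hasDerivAt.scomp θ h1
    refine (h3.add (h2.smul h4)).congr_deriv ?_
    simp only [Function.comp]
    module
  have hc : Continuous fun θ : ℝ => (1 - θ) • deriv (deriv g) (s' + θ * (s - s')) :=
    (continuous_const.sub continuous_id).smul ((hg1.continuous_deriv le_rfl).comp
      (continuous_const.add (continuous_id.mul continuous_const)))
  have := intervalIntegral.integral_eq_sub_of_hasDerivAt (fun θ _ => h θ)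
    ((hc.const_smul ((s - s') ^ 2)).intervalIntegrable 0 1)
  rw [intervalIntegral.integral_smul] at this
  rw [taylorQuot, this]
  simp only [one_mul, add_sub_cancel, sub_self, zero_mul, zero_smul, add_zero, sub_zero]
  abel

theorem continuous_chordSlope (hg : ContDiff ℝ 1 g) :
    Continuous fun p : ℝ × ℝ => chordSlope g p.1 p.2 :=
  intervalIntegral.continuous_parametric_intervalIntegral_of_continuous'
    (f := fun (p : ℝ × ℝ) θ => deriv g (p.2 + θ * (p.1 - p.2)))
    ((hg.continuous_deriv le_rfl).comp (by fun_prop)) 0 1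

theorem continuous_taylorQuot (hg : ContDiff ℝ 2 g) :
    Continuous fun p : ℝ × ℝ => taylorQuot g p.1 p.2 := by
  have hg1 : ContDiff ℝ 1 (deriv g) := ((contDiff_succ_iff_deriv (n := 1)).1 hg).2.2
  refine intervalIntegral.continuous_parametric_intervalIntegral_of_continuous'
    (f := fun (p : ℝ × ℝ) θ => (1 - θ) • deriv (deriv g) (p.2 + θ * (p.1 - p.2))) ?_ 0 1
  exact (continuous_const.sub continuous_snd).smul ((hg1.continuous_deriv le_rfl).comp
    (continuous_fst.snd.add (continuous_snd.mul (continuous_fst.fst.sub continuous_fst.snd))))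

theorem chordSlope_self (s : ℝ) : chordSlope g s s = deriv g s := by simp [chordSlope]

theorem taylorQuot_self (s : ℝ) : taylorQuot g s s = (1 / 2 : ℝ) • deriv (deriv g) s := by
  have : ∫ θ in (0 : ℝ)..1, (1 - θ) = 1 / 2 := by
    rw [intervalIntegral.integral_sub (by simp) (by simp)]
    simp
    norm_num
  simp only [taylorQuot, sub_self, mul_zero, add_zero]
  rw [intervalIntegral.integral_smul_const, this]

theorem chordSlope_eq_add_smul (hg : ContDiff ℝ 2 g) (s s' : ℝ) :
    chordSlope g s s' = deriv g s' + (s - s') • taylorQuot g s s' := by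
  rcases eq_or_ne s s' with rfl | h
  · simp [chordSlope_self]
  · have h1 := sub_sub_eq_smul_taylorQuot hg s s'
    rw [sub_eq_smul_chordSlope (hg.of_le (by norm_num)) s s', ← smul_sub, pow_two, mul_smul] at h1
    have h2 := smul_right_injective Plane (sub_ne_zero.2 h) h1
    rw [← h2]
    abel

end Curve

namespace PlateGeometry

variable {M : ℕ} (B : PlateGeometry M)

theorem inner_rotate_rotate (a b : Plane) :
    inner ℝ (rotate a) (rotate b) = inner ℝ a b := by
  simp [inner_plane, rotate]; ring

theorem inner_rotate_self (a : Plane) : inner ℝ a (rotate a) = (0 : ℝ) := by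
  simp [inner_plane, rotate]; ring

theorem continuous_rotate : Continuous rotate := by
  unfold rotate
  fun_prop

theorem normal_γ_eq (i : Fin M) (s : ℝ) : B.normal (B.γ i s) = rotate (deriv (B.γ i) s) :=
  B.normal_γ i s

theorem contDiff_two (i : Fin M) : ContDiff ℝ 2 (B.γ i) := (B.contDiff_γ i).of_le (by norm_num)

theorem contDiff_one (i : Fin M) : ContDiff ℝ 1 (B.γ i) := (B.contDiff_γ i).of_le (by norm_num)

theorem contDiff_deriv (i : Fin M) : ContDiff ℝ 1 (deriv (B.γ i)) :=
  ((contDiff_succ_iff_deriv (n := 1)).1 (B.contDiff_two i)).2.2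

theorem continuous_γ (i : Fin M) : Continuous (B.γ i) := (B.contDiff_γ i).continuous

theorem continuous_deriv_γ (i : Fin M) : Continuous (deriv (B.γ i)) :=
  (B.contDiff_deriv i).continuous

theorem γ_ne_of_abs_sub_lt (i : Fin M) {s s' : ℝ} (h : s ≠ s') (hlt : |s - s'| < B.len i) :
    B.γ i s ≠ B.γ i s' := by
  intro he
  obtain ⟨-, m, hm⟩ := B.param_unique (p := (i, s)) (q := (i, s')) he
  simp only at hm
  have hL := B.len_pos i
  have h1 : s - s' = m * B.len i := by rw [hm]; ring
  have hm0 : m ≠ 0 := by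
    rintro rfl
    exact h (by simpa using hm)
  rw [h1, abs_mul, abs_of_pos hL] at hlt
  have h2 : (1 : ℝ) ≤ |(m : ℝ)| := by exact_mod_cast Int.one_le_abs hm0
  nlinarith

/-- Unit speed excludes zero on the diagonal, simplicity of the curve off it. -/
theorem chordSlope_ne_zero (i : Fin M) {s s' : ℝ} (hlt : |s - s'| < B.len i) :
    chordSlope (B.γ i) s s' ≠ 0 := by
  rcases eq_or_ne s s' with rfl | h
  · rw [chordSlope_self, ← norm_ne_zero_iff, B.unit_speed]
    exact one_ne_zero
  · intro h0
    have h1 := sub_eq_smul_chordSlope (B.contDiff_one i) s s'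
    rw [h0, smul_zero, sub_eq_zero] at h1
    exact B.γ_ne_of_abs_sub_lt i h hlt h1

theorem inner_deriv_deriv_deriv (i : Fin M) (s : ℝ) :
    inner ℝ (deriv (B.γ i) s) (deriv (deriv (B.γ i)) s) = (0 : ℝ) := by
  have hd : HasDerivAt (deriv (B.γ i)) (deriv (deriv (B.γ i)) s) s :=
    ((B.contDiff_deriv i).differentiable (by simp) s).hasDerivAt
  have h := hd.norm_sq
  have hc : (fun t => ‖deriv (B.γ i) t‖ ^ 2) = fun _ => 1 := by
    funext t; rw [B.unit_speed, one_pow]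
  rw [hc] at h
  have := h.unique (hasDerivAt_const s (1 : ℝ))
  linarith

/-- The first order Taylor term is tangential, so the normal component of a chord is quadratic in
the parameter difference. The continuity of the boundary kernels rests on this. -/
theorem inner_sub_normal (i : Fin M) (s s' : ℝ) :
    inner ℝ (B.γ i s - B.γ i s') (rotate (deriv (B.γ i) s'))
      = (s - s') ^ 2 * inner ℝ (taylorQuot (B.γ i) s s') (rotate (deriv (B.γ i) s')) := by
  have h := sub_sub_eq_smul_taylorQuot (B.contDiff_two i) s s'
  have h2 : B.γ i s - B.γ i s' = (s - s') • deriv (B.γ i) s'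
      + (s - s') ^ 2 • taylorQuot (B.γ i) s s' := by rw [← h]; abel
  rw [h2, inner_add_left, inner_smul_left, inner_smul_left, inner_rotate_self]
  simp

/-- The local description of the boundary curve near the point with parameter `s₀`. -/
theorem exists_localFrame (i : Fin M) (s₀ : ℝ) (s : ℝ) (hs : s ^ 2 = 1) :
    ∃ F : LocalFrame, F.T = B.len i / 2 ∧ F.s = s ∧
      2 * F.f 0 = B.curvature (B.γ i s₀) ∧
      (∀ η t, 0 < F.dist2 η t →
        B.γ i s₀ + (s * η) • B.normal (B.γ i s₀) - B.γ i (s₀ + t) ≠ 0) ∧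
      ∀ a b η t, singKer a b (B.γ i s₀ + (s * η) • B.normal (B.γ i s₀) - B.γ i (s₀ + t))
        (B.normal (B.γ i (s₀ + t))) (B.normal (B.γ i s₀)) = F.locKer a b η t := by
  set γ := B.γ i with hγ
  have hL := B.len_pos i
  have cq := continuous_chordSlope (B.contDiff_one i)
  have ct := continuous_taylorQuot (B.contDiff_two i)
  have cg := continuous_chordSlope (B.contDiff_deriv i)
  have cd := B.continuous_deriv_γ i
  have c1 : Continuous fun t : ℝ => (s₀ + t, s₀) := by fun_prop
  have c2 : Continuous fun t : ℝ => (s₀, s₀ + t) := by fun_prop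
  have cq' : Continuous fun t => ‖chordSlope γ (s₀ + t) s₀‖ ^ 2 := (cq.comp c1).norm.pow 2
  have ct1 : Continuous fun t => taylorQuot γ (s₀ + t) s₀ := ct.comp c1
  have ct2 : Continuous fun t => taylorQuot γ s₀ (s₀ + t) := ct.comp c2
  have cdt : Continuous fun t => deriv γ (s₀ + t) := cd.comp (by fun_prop)
  have unit : ∀ t, inner ℝ (deriv γ t) (deriv γ t) = (1 : ℝ) := fun t => by
    rw [real_inner_self_eq_norm_sq, B.unit_speed, one_pow]
  obtain ⟨q₀, hq₀, hq⟩ : ∃ q₀ > 0, ∀ t ∈ Icc (-(B.len i / 2)) (B.len i / 2),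
      q₀ ≤ ‖chordSlope γ (s₀ + t) s₀‖ ^ 2 := by
    obtain ⟨t₀, ht₀, hmin⟩ := isCompact_Icc.exists_isMinOn
      (nonempty_Icc.2 (by linarith : -(B.len i / 2) ≤ B.len i / 2)) cq'.continuousOn
    refine ⟨_, ?_, fun t ht => hmin ht⟩
    refine pow_pos (norm_pos_iff.2 (B.chordSlope_ne_zero i ?_)) 2
    rw [add_sub_cancel_left, abs_lt]
    constructor <;> linarith [ht₀.1, ht₀.2]
  -- Half a period on each side covers the whole curve once, and all differences stay below the
  -- period, so the chord slope has a positive minimum. The sign of `f` reflects that displacements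
  -- point from the moving point to the fixed one.
  let F : LocalFrame :=
    { T := B.len i / 2
      s := s
      c := fun t => inner ℝ (deriv γ s₀) (deriv γ (s₀ + t))
      e := fun t => inner ℝ (taylorQuot γ s₀ (s₀ + t)) (rotate (deriv γ (s₀ + t)))
      f := fun t => -inner ℝ (taylorQuot γ (s₀ + t) s₀) (rotate (deriv γ s₀))
      g := fun t => ‖chordSlope (deriv γ) (s₀ + t) s₀‖ ^ 2 / 2
      q := fun t => ‖chordSlope γ (s₀ + t) s₀‖ ^ 2
      Q := fun t => -(2 * inner ℝ (deriv γ s₀) (taylorQuot γ (s₀ + t) s₀)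
        + t * ‖taylorQuot γ (s₀ + t) s₀‖ ^ 2)
      q₀ := q₀
      T_pos := by linarith
      s_sq := hs
      cont_c := continuous_const.inner cdt
      cont_e := ct2.inner (continuous_rotate.comp cdt)
      cont_f := (ct1.inner continuous_const).neg
      cont_g := ((cg.comp c1).norm.pow 2).div_const 2
      cont_q := cq'
      cont_Q := ((continuous_const.mul (continuous_const.inner ct1)).add
        (continuous_id.mul (ct1.norm.pow 2))).neg
      q₀_pos := hq₀
      q₀_le := hq
      -- For unit tangents `|γ'(s₀+t) - γ'(s₀)|² = 2 - 2c`, and the left side is `t²` times a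
      -- squared chord slope of `γ'`.
      c_eq := fun t => by
        have h := sub_eq_smul_chordSlope (B.contDiff_deriv i) (s₀ + t) s₀
        have h2 := congrArg (fun v : Plane => ‖v‖ ^ 2) h
        simp only [norm_smul, mul_pow, add_sub_cancel_left, Real.norm_eq_abs, sq_abs] at h2
        rw [norm_sub_sq_real, B.unit_speed, B.unit_speed, real_inner_comm] at h2
        linarith
      q_eq := fun t => by
        rw [chordSlope_eq_add_smul (B.contDiff_two i), norm_add_sq_real, B.unit_speed,
          add_sub_cancel_left, inner_smul_right, norm_smul, mul_pow, Real.norm_eq_abs, sq_abs]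
        ring
      -- The first order term of the squared chord slope vanishes because `γ''` is orthogonal to
      -- `γ'` for an arc length parametrization.
      Q_zero := by
        rw [add_zero, taylorQuot_self, inner_smul_right, B.inner_deriv_deriv_deriv]
        simp
      e_zero := by simp }
  have hn₀ : B.normal (γ s₀) = rotate (deriv γ s₀) := B.normal_γ_eq i s₀
  have hn : ∀ t, B.normal (γ (s₀ + t)) = rotate (deriv γ (s₀ + t)) := fun t =>
    B.normal_γ_eq i (s₀ + t)
  have hp : ∀ t, inner ℝ (γ s₀ - γ (s₀ + t)) (rotate (deriv γ s₀)) = t ^ 2 * F.f t := fun t => by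
    have := B.inner_sub_normal i (s₀ + t) s₀
    rw [← neg_sub, inner_neg_left, this, add_sub_cancel_left]
    simp only [F, hγ]
    ring
  have hp' : ∀ t, inner ℝ (γ s₀ - γ (s₀ + t)) (rotate (deriv γ (s₀ + t))) = t ^ 2 * F.e t :=
    fun t => by
      have := B.inner_sub_normal i s₀ (s₀ + t)
      rw [this]
      simp only [F, hγ]
      ring
  have hz : ∀ η t, γ s₀ + (s * η) • B.normal (γ s₀) - γ (s₀ + t)
      = (γ s₀ - γ (s₀ + t)) + (s * η) • rotate (deriv γ s₀) := fun η t => by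
    rw [hn₀]; abel
  have hv : ∀ η t, inner ℝ (γ s₀ + (s * η) • B.normal (γ s₀) - γ (s₀ + t)) (B.normal (γ s₀))
      = F.vComp η t := fun η t => by
    rw [hz, hn₀, inner_add_left, hp, inner_smul_left, inner_rotate_rotate, unit]
    simp [LocalFrame.vComp, F]
    ring
  have hnc : ∀ η t, inner ℝ (γ s₀ + (s * η) • B.normal (γ s₀) - γ (s₀ + t))
      (B.normal (γ (s₀ + t))) = F.nComp η t := fun η t => by
    rw [hz, hn, inner_add_left, hp', inner_smul_left, inner_rotate_rotate]
    simp [LocalFrame.nComp, F]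
    ring
  have hd : ∀ η t, ‖γ s₀ + (s * η) • B.normal (γ s₀) - γ (s₀ + t)‖ ^ 2 = F.dist2 η t :=
    fun η t => by
      have h1 : ‖γ s₀ - γ (s₀ + t)‖ ^ 2 = t ^ 2 * F.q t := by
        rw [norm_sub_rev, sub_eq_smul_chordSlope (B.contDiff_one i), norm_smul, mul_pow,
          add_sub_cancel_left, Real.norm_eq_abs, sq_abs]
      have h2 : ‖rotate (deriv γ s₀)‖ ^ 2 = 1 := by
        rw [← real_inner_self_eq_norm_sq, inner_rotate_rotate, unit]
      rw [hz, norm_add_sq_real, h1, inner_smul_right, hp, norm_smul, mul_pow, h2,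
        Real.norm_eq_abs, sq_abs, mul_pow, hs]
      simp only [LocalFrame.dist2, F]
      ring
  have hc : ∀ t, inner ℝ (B.normal (γ s₀)) (B.normal (γ (s₀ + t))) = F.c t := fun t => by
    rw [hn₀, hn, inner_rotate_rotate]
  refine ⟨F, rfl, rfl, ?_, fun η t hpos h0 => ?_, fun a b η t => ?_⟩
  · rw [B.curvature_γ]
    simp only [F, add_zero, taylorQuot_self, inner_smul_left]
    simp [rotate, hγ]
  · rw [← hd, h0] at hpos
    simp at hpos
  · fin_cases a <;> fin_cases b <;>
      simp only [singKer, LocalFrame.locKer, Fin.zero_eta, Fin.mk_one, Matrix.cons_val_zero,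
        Matrix.cons_val_one, hv, hnc, hd, hc]

end PlateGeometry

end

noncomputable section

/-! ### Topology of the boundary and continuity of the kernels -/

/-- A continuous map from a compact space onto its image in a Hausdorff space is a quotient map.
Continuity on `∂Ω` can thus be tested on parameters. -/
theorem continuousOn_of_continuous_comp {P X Z : Type*} [TopologicalSpace P] [CompactSpace P]
    [TopologicalSpace X] [T2Space X] [TopologicalSpace Z] {S : Set X} {π : P → X}
    (hπ : Continuous π) (hS : range π = S) {F : X → Z} (hF : Continuous fun p => F (π p)) :
    ContinuousOn F S := by
  subst hS
  rw [continuousOn_iff_continuous_domRestrict]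
  have hq : IsQuotientMap (rangeFactorization π) :=
    IsQuotientMap.of_surjective_continuous rangeFactorization_surjective
      (hπ.subtype_mk _)
  exact hq.continuous_iff.2 hF

namespace PlateGeometry

variable {M : ℕ} (B : PlateGeometry M)

/-- The compact parameter space of `∂Ω`. -/
abbrev ParamSpace : Type := Σ i : Fin M, Icc (0 : ℝ) (B.len i)

/-- The parametrization of `∂Ω`. -/
def param (p : B.ParamSpace) : Plane := B.γ p.1 p.2

theorem continuous_param : Continuous B.param :=
  continuous_sigma fun i => (B.continuous_γ i).comp continuous_subtype_val

theorem exists_mem_Ioc (i : Fin M) (s : ℝ) : ∃ t ∈ Ioc 0 (B.len i), B.γ i t = B.γ i s := by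
  obtain ⟨t, ht, h⟩ := (B.periodic_γ i).exists_mem_Ioc (B.len_pos i) s 0
  rw [zero_add] at ht
  exact ⟨t, ht, h.symm⟩

theorem range_param : range B.param = B.bdry := by
  ext y
  constructor
  · rintro ⟨⟨i, s⟩, rfl⟩
    exact B.γ_mem_bdry i s
  · intro hy
    obtain ⟨i, s, rfl⟩ := B.exists_param hy
    obtain ⟨t, ht, h⟩ := B.exists_mem_Ioc i s
    exact ⟨⟨i, t, Ioc_subset_Icc_self ht⟩, h⟩

theorem isCompact_bdry : IsCompact B.bdry :=
  B.range_param ▸ isCompact_range B.continuous_param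

theorem continuousOn_bdry {Z : Type*} [TopologicalSpace Z] {F : Plane → Z}
    (h : ∀ i, Continuous fun s => F (B.γ i s)) : ContinuousOn F B.bdry :=
  continuousOn_of_continuous_comp B.continuous_param B.range_param
    (continuous_sigma fun i => (h i).comp continuous_subtype_val)

theorem continuousOn_bdry_prod {Z : Type*} [TopologicalSpace Z] {F : Plane × Plane → Z}
    (h : ∀ i j, Continuous fun p : ℝ × ℝ => F (B.γ i p.1, B.γ j p.2)) :
    ContinuousOn F (B.bdry ×ˢ B.bdry) := by
  refine continuousOn_of_continuous_comp (B.continuous_param.prodMap B.continuous_param)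
    (by rw [range_prodMap, B.range_param]) ?_
  rw [continuous_iff_continuousAt]
  rintro ⟨⟨i, s⟩, ⟨j, t⟩⟩
  have he : IsOpenEmbedding (Prod.map (Sigma.mk (β := fun i => Icc (0 : ℝ) (B.len i)) i)
      (Sigma.mk (β := fun i => Icc (0 : ℝ) (B.len i)) j)) :=
    IsOpenEmbedding.sigmaMk.prodMap IsOpenEmbedding.sigmaMk
  exact (he.continuousAt_iff (g := fun p => F (Prod.map B.param B.param p)) (x := (s, t))).1
    ((h i j).comp (continuous_subtype_val.prodMap continuous_subtype_val)).continuousAt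

theorem continuousOn_normal : ContinuousOn B.normal B.bdry :=
  B.continuousOn_bdry fun i => by
    simp only [B.normal_γ_eq]
    exact continuous_rotate.comp (B.continuous_deriv_γ i)

theorem continuousOn_curvature : ContinuousOn B.curvature B.bdry :=
  B.continuousOn_bdry fun i => by
    simp only [B.curvature_γ]
    exact (((B.contDiff_deriv i).continuous_deriv le_rfl).inner
      (continuous_rotate.comp (B.continuous_deriv_γ i))).neg

/-- The values on the diagonal of the extended biharmonic kernels, in terms of the curvature. -/
def singDiag : Fin 2 → Fin 2 → ℝ → ℝ :=
  ![![fun _ => 0, fun _ => 0],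
    ![fun κ => -(1 / Real.pi) * (3 * (κ / 2) ^ 2), fun κ => 1 / Real.pi * (κ / 2)]]

open Classical in
/-- The biharmonic kernels on `∂Ω × ∂Ω`, extended to the diagonal. -/
def singExt (a b : Fin 2) (p : Plane × Plane) : ℝ :=
  if p.1 = p.2 then singDiag a b (B.curvature p.1)
  else singKer a b (p.1 - p.2) (B.normal p.2) (B.normal p.1)

theorem singExt_of_ne (a b : Fin 2) {x y : Plane} (h : x ≠ y) :
    B.singExt a b (x, y) = singKer a b (x - y) (B.normal y) (B.normal x) := if_neg h

/-- The kernels after division of numerator and denominator by powers of the parameter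
difference. -/
def regKer : Fin 2 → Fin 2 → (u e v q c : ℝ) → ℝ :=
  ![![fun u e _ q _ => -(1 / Real.pi) * (u ^ 2 * e ^ 3 / q ^ 2),
      fun u e _ q _ => -(1 / (2 * Real.pi)) * (u ^ 2 * e ^ 2 / q)],
    ![fun u e v q c => -(1 / Real.pi) * (3 * e ^ 2 * c / q ^ 2 - 4 * u ^ 2 * e ^ 3 * v / q ^ 3),
      fun u e v q c => -(1 / Real.pi) * (e * c / q - u ^ 2 * e ^ 2 * v / q ^ 2)]]

/-- With `u = s - s'`, the two normal components of the chord are `u² e` and `u² v`, and its squared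
length is `u² q`; all negative powers of `u` cancel. On the diagonal `e = -κ/2`, `v = κ/2`, `q = 1`,
which are the values recorded in `singDiag`. -/
theorem singExt_γ_eq (a b : Fin 2) (i : Fin M) {s s' : ℝ} (h : |s - s'| < B.len i) :
    B.singExt a b (B.γ i s, B.γ i s') = regKer a b (s - s')
      (inner ℝ (taylorQuot (B.γ i) s s') (rotate (deriv (B.γ i) s')))
      (-inner ℝ (taylorQuot (B.γ i) s' s) (rotate (deriv (B.γ i) s)))
      (‖chordSlope (B.γ i) s s'‖ ^ 2) (inner ℝ (deriv (B.γ i) s) (deriv (B.γ i) s')) := by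
  have hq : ‖chordSlope (B.γ i) s s'‖ ≠ 0 := norm_ne_zero_iff.2 (B.chordSlope_ne_zero i h)
  rcases eq_or_ne s s' with rfl | hne
  · have hκ : B.curvature (B.γ i s) / 2
        = -inner ℝ (taylorQuot (B.γ i) s s) (rotate (deriv (B.γ i) s)) := by
      rw [B.curvature_γ, taylorQuot_self, inner_smul_left]
      simp only [rotate, one_div, conj_trivial]
      ring
    have hu : inner ℝ (deriv (B.γ i) s) (deriv (B.γ i) s) = (1 : ℝ) := by
      rw [real_inner_self_eq_norm_sq, B.unit_speed, one_pow]
    rw [singExt, if_pos rfl, chordSlope_self, B.unit_speed, hu, sub_self]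
    fin_cases a <;> fin_cases b <;>
      simp only [singDiag, regKer, Fin.zero_eta, Fin.mk_one, Matrix.cons_val_zero,
        Matrix.cons_val_one, hκ] <;> ring
  · have hu : s - s' ≠ 0 := sub_ne_zero.2 hne
    have h1 := B.inner_sub_normal i s s'
    have h2 : inner ℝ (B.γ i s - B.γ i s') (rotate (deriv (B.γ i) s)) = (s - s') ^ 2 *
        -inner ℝ (taylorQuot (B.γ i) s' s) (rotate (deriv (B.γ i) s)) := by
      rw [← neg_sub, inner_neg_left, B.inner_sub_normal i s' s]
      ring
    have h3 : ‖B.γ i s - B.γ i s'‖ ^ 2 = (s - s') ^ 2 * ‖chordSlope (B.γ i) s s'‖ ^ 2 := by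
      rw [sub_eq_smul_chordSlope (B.contDiff_one i), norm_smul, mul_pow, Real.norm_eq_abs, sq_abs]
    rw [B.singExt_of_ne a b (B.γ_ne_of_abs_sub_lt i hne h), B.normal_γ_eq, B.normal_γ_eq]
    generalize -inner ℝ (taylorQuot (B.γ i) s' s) (rotate (deriv (B.γ i) s)) = v at *
    generalize inner ℝ (taylorQuot (B.γ i) s s') (rotate (deriv (B.γ i) s')) = e at *
    fin_cases a <;> fin_cases b <;>
      simp only [singKer, regKer, Fin.zero_eta, Fin.mk_one, Matrix.cons_val_zero,
        Matrix.cons_val_one, h1, h2, h3, inner_rotate_rotate] <;>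
      field_simp

theorem continuousAt_singExt_of_lt (a b : Fin 2) (i : Fin M) {p : ℝ × ℝ}
    (h : |p.1 - p.2| < B.len i) :
    ContinuousAt (fun p : ℝ × ℝ => B.singExt a b (B.γ i p.1, B.γ i p.2)) p := by
  have hev : ∀ᶠ r : ℝ × ℝ in 𝓝 p, |r.1 - r.2| < B.len i :=
    (continuous_fst.sub continuous_snd).abs.continuousAt.eventually_lt_const h
  have cd := B.continuous_deriv_γ i
  have ct := continuous_taylorQuot (B.contDiff_two i)
  have ce : Continuous fun r : ℝ × ℝ =>
      inner ℝ (taylorQuot (B.γ i) r.1 r.2) (rotate (deriv (B.γ i) r.2)) :=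
    ct.inner (continuous_rotate.comp (cd.comp continuous_snd))
  have cv : Continuous fun r : ℝ × ℝ =>
      -inner ℝ (taylorQuot (B.γ i) r.2 r.1) (rotate (deriv (B.γ i) r.1)) :=
    ((ct.comp continuous_swap).inner (continuous_rotate.comp (cd.comp continuous_fst))).neg
  have cq : Continuous fun r : ℝ × ℝ => ‖chordSlope (B.γ i) r.1 r.2‖ ^ 2 :=
    (continuous_chordSlope (B.contDiff_one i)).norm.pow 2
  have cc : Continuous fun r : ℝ × ℝ => inner ℝ (deriv (B.γ i) r.1) (deriv (B.γ i) r.2) :=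
    (cd.comp continuous_fst).inner (cd.comp continuous_snd)
  have cu : Continuous fun r : ℝ × ℝ => r.1 - r.2 := continuous_fst.sub continuous_snd
  have hq : ‖chordSlope (B.γ i) p.1 p.2‖ ^ 2 ≠ 0 :=
    pow_ne_zero 2 (norm_ne_zero_iff.2 (B.chordSlope_ne_zero i h))
  refine ContinuousAt.congr ?_ (hev.mono fun r hr => (B.singExt_γ_eq a b i hr).symm)
  have hq2 := pow_ne_zero 2 hq
  have hq3 := pow_ne_zero 3 hq
  fin_cases a <;> fin_cases b
  · exact continuousAt_const.mul (ContinuousAt.div ((cu.pow 2).mul (ce.pow 3)).continuousAt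
      (cq.pow 2).continuousAt hq2)
  · exact continuousAt_const.mul (ContinuousAt.div ((cu.pow 2).mul (ce.pow 2)).continuousAt
      cq.continuousAt hq)
  · exact continuousAt_const.mul ((ContinuousAt.div
      ((continuous_const.mul (ce.pow 2)).mul cc).continuousAt (cq.pow 2).continuousAt hq2).sub
      (ContinuousAt.div (((continuous_const.mul (cu.pow 2)).mul (ce.pow 3)).mul cv).continuousAt
      (cq.pow 3).continuousAt hq3))
  · exact continuousAt_const.mul ((ContinuousAt.div (ce.mul cc).continuousAt
      cq.continuousAt hq).sub (ContinuousAt.div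
      (((cu.pow 2).mul (ce.pow 2)).mul cv).continuousAt (cq.pow 2).continuousAt hq2))

theorem continuousOn_singExt (a b : Fin 2) : ContinuousOn (B.singExt a b) (B.bdry ×ˢ B.bdry) := by
  refine B.continuousOn_bdry_prod fun i j => continuous_iff_continuousAt.2 fun p => ?_
  have ci := B.continuous_γ i
  have cj := B.continuous_γ j
  by_cases h : B.γ i p.1 = B.γ j p.2
  · obtain ⟨hij, m, hm⟩ := B.param_unique (p := (i, p.1)) (q := (j, p.2)) h
    simp only at hij hm
    subst hij
    -- Parameters of the same point may differ by whole periods; shifting the first one back brings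
    -- the pair to the diagonal, where the regularized formula applies.
    have hper : (fun r : ℝ × ℝ => B.singExt a b (B.γ i r.1, B.γ i r.2))
        = (fun r : ℝ × ℝ => B.singExt a b (B.γ i r.1, B.γ i r.2)) ∘
          fun r : ℝ × ℝ => (r.1 - m * B.len i, r.2) := by
      funext r
      simp only [Function.comp]
      rw [(B.periodic_γ i).sub_int_mul_eq]
    rw [hper]
    refine ContinuousAt.comp (B.continuousAt_singExt_of_lt a b i ?_) (by fun_prop)
    simp only [hm, add_sub_cancel_right, sub_self, abs_zero]
    exact B.len_pos i
  · have c1 : Continuous fun r : ℝ × ℝ => B.γ i r.1 := ci.comp continuous_fst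
    have c2 : Continuous fun r : ℝ × ℝ => B.γ j r.2 := cj.comp continuous_snd
    have hev : ∀ᶠ r : ℝ × ℝ in 𝓝 p, B.γ i r.1 ≠ B.γ j r.2 :=
      (isOpen_ne_fun c1 c2).mem_nhds h
    refine ContinuousAt.congr ?_ (hev.mono fun r hr => (B.singExt_of_ne a b hr).symm)
    simp only [B.normal_γ_eq]
    exact ContinuousAt.comp (f := fun r : ℝ × ℝ => (B.γ i r.1 - B.γ j r.2,
      rotate (deriv (B.γ j) r.2), rotate (deriv (B.γ i) r.1)))
      (FlexuralProfile.continuousAt_singKer a b (p := (_, _, _)) (sub_ne_zero.2 h))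
      ((c1.sub c2).prodMk (((continuous_rotate.comp (B.continuous_deriv_γ j)).comp
        continuous_snd).prodMk ((continuous_rotate.comp (B.continuous_deriv_γ i)).comp
        continuous_fst))).continuousAt

/-- The kernels on `∂Ω × ∂Ω`, extended to the diagonal. -/
def kerExt (Q : FlexuralProfile) (a b : Fin 2) (p : Plane × Plane) : ℂ :=
  (B.singExt a b p : ℂ) + Q.remKer a b (p.1 - p.2) (B.normal p.2) (B.normal p.1)

theorem continuousOn_kerExt (Q : FlexuralProfile) (a b : Fin 2) :
    ContinuousOn (B.kerExt Q a b) (B.bdry ×ˢ B.bdry) := by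
  refine (Complex.continuous_ofReal.comp_continuousOn (B.continuousOn_singExt a b)).add ?_
  have h1 : ContinuousOn (fun p : Plane × Plane => B.normal p.1) (B.bdry ×ˢ B.bdry) :=
    B.continuousOn_normal.comp continuousOn_fst fun p hp => hp.1
  have h2 : ContinuousOn (fun p : Plane × Plane => B.normal p.2) (B.bdry ×ˢ B.bdry) :=
    B.continuousOn_normal.comp continuousOn_snd fun p hp => hp.2
  exact (Q.continuous_remKer a b).comp_continuousOn
    ((continuous_fst.sub continuous_snd).continuousOn.prodMk (h2.prodMk h1))

theorem bdryKernel_eq {k : ℝ} {Q : FlexuralProfile}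
    (hG : ∀ x y, flexuralGreen k x y = Q.φ₀ (‖x - y‖ ^ 2)) (a b : Fin 2) {x y : Plane}
    (hy : y ∈ B.bdry) (h : x ≠ y) :
    B.bdryKernel k a b x y = Q.ker a b (x - y) (B.normal y) (B.normal x) := by
  fin_cases a <;> fin_cases b
  · exact B.K1_eq hG hy h
  · exact B.K2_eq hG hy h
  · exact (B.hasDirDeriv_K1 hG hy h _).dirDeriv
  · exact (B.hasDirDeriv_K2 hG hy h _).dirDeriv

theorem bdryKernel_eq_kerExt {k : ℝ} {Q : FlexuralProfile}
    (hG : ∀ x y, flexuralGreen k x y = Q.φ₀ (‖x - y‖ ^ 2)) (a b : Fin 2) {x y : Plane}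
    (hy : y ∈ B.bdry) (h : x ≠ y) :
    B.bdryKernel k a b x y = B.kerExt Q a b (x, y) := by
  rw [B.bdryKernel_eq hG a b hy h, Q.ker_eq_sing_add_rem a b (sub_ne_zero.2 h), kerExt,
    B.singExt_of_ne a b h]

theorem isContinuousKernel_bdryKernel {k : ℝ} {Q : FlexuralProfile}
    (hG : ∀ x y, flexuralGreen k x y = Q.φ₀ (‖x - y‖ ^ 2)) (a b : Fin 2) :
    B.IsContinuousKernel (B.bdryKernel k a b) :=
  ⟨B.kerExt Q a b, B.continuousOn_kerExt Q a b, fun _ _ _ hy h =>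
    (B.bdryKernel_eq_kerExt hG a b hy h).symm⟩

end PlateGeometry

end

noncomputable section

/-! ### Arc length measure and principal values -/

namespace PlateGeometry

variable {M : ℕ} (B : PlateGeometry M)

theorem measurable_γ (i : Fin M) : Measurable (B.γ i) := (B.continuous_γ i).measurable

instance isFiniteMeasure_arcLength : IsFiniteMeasure B.arcLength := by
  unfold arcLength
  infer_instance

theorem measurableSet_bdry : MeasurableSet B.bdry := B.isCompact_bdry.measurableSet

theorem arcLength_apply {s : Set Plane} (hs : MeasurableSet s) :
    B.arcLength s = ∑ i, volume (B.γ i ⁻¹' s ∩ Ioc 0 (B.len i)) := by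
  rw [arcLength, Measure.finsetSum_apply]
  refine Finset.sum_congr rfl fun i _ => ?_
  rw [Measure.map_apply (B.measurable_γ i) hs, Measure.restrict_apply (B.measurable_γ i hs)]

theorem ae_mem_bdry : ∀ᵐ y ∂B.arcLength, y ∈ B.bdry := by
  rw [ae_iff]
  change B.arcLength B.bdryᶜ = 0
  rw [B.arcLength_apply B.measurableSet_bdry.compl]
  refine Finset.sum_eq_zero fun i _ => ?_
  have : B.γ i ⁻¹' B.bdryᶜ = ∅ := by
    ext s
    simp [B.γ_mem_bdry i s]
  simp [this]

theorem arcLength_restrict : B.arcLength.restrict B.bdry = B.arcLength :=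
  Measure.restrict_eq_self_of_ae_mem B.ae_mem_bdry

/-- Each curve passes through `x` at most once per period, so arc length has no atoms. -/
theorem ae_ne (x : Plane) : ∀ᵐ y ∂B.arcLength, y ≠ x := by
  rw [ae_iff]
  simp only [not_not, ofPred_eq_eq_singleton]
  rw [B.arcLength_apply (measurableSet_singleton x)]
  refine Finset.sum_eq_zero fun i _ => Set.Subsingleton.measure_zero ?_ _
  rintro s ⟨hs, hs'⟩ t ⟨ht, ht'⟩
  by_contra hne
  refine B.γ_ne_of_abs_sub_lt i hne ?_ (Eq.trans hs (Eq.symm ht))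
  rw [abs_lt]
  constructor <;> linarith [hs'.1, hs'.2, ht'.1, ht'.2]

theorem aestronglyMeasurable_of_continuousOn {f : Plane → ℂ} (hf : ContinuousOn f B.bdry) :
    AEStronglyMeasurable f B.arcLength := by
  have := hf.aestronglyMeasurable (μ := B.arcLength) B.measurableSet_bdry
  rwa [B.arcLength_restrict] at this

theorem integrable_mul_of_continuousOn {f σ : Plane → ℂ} (hf : ContinuousOn f B.bdry)
    (hσ : Integrable σ B.arcLength) : Integrable (fun y => f y * σ y) B.arcLength := by
  obtain ⟨C, hC⟩ := B.isCompact_bdry.exists_bound_of_continuousOn hf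
  exact hσ.bdd_mul (B.aestronglyMeasurable_of_continuousOn hf) (B.ae_mem_bdry.mono hC)

theorem integrable_of_continuousOn {f : Plane → ℂ} (hf : ContinuousOn f B.bdry) :
    Integrable f B.arcLength := by
  simpa using B.integrable_mul_of_continuousOn hf (integrable_const (1 : ℂ))

theorem integral_arcLength {f : Plane → ℂ} (hf : Integrable f B.arcLength) :
    ∫ y, f y ∂B.arcLength = ∑ i, ∫ s in (0)..(B.len i), f (B.γ i s) := by
  have hi : ∀ i ∈ Finset.univ,
      Integrable f (Measure.map (B.γ i) (volume.restrict (Ioc 0 (B.len i)))) :=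
    fun i _ => hf.mono_measure (Finset.single_le_sum
      (f := fun i => Measure.map (B.γ i) (volume.restrict (Ioc 0 (B.len i))))
      (fun _ _ => Measure.zero_le _) (Finset.mem_univ i))
  rw [arcLength, integral_finsetSum_measure hi]
  refine Finset.sum_congr rfl fun i _ => ?_
  rw [integral_map (B.measurable_γ i).aemeasurable (hi i (Finset.mem_univ i)).1,
    intervalIntegral.integral_of_le (B.len_pos i).le]

theorem integral_shift (i : Fin M) (s₀ : ℝ) (f : Plane → ℂ) :
    ∫ s in (0)..(B.len i), f (B.γ i s)
      = ∫ t in (-(B.len i / 2))..(B.len i / 2), f (B.γ i (s₀ + t)) := by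
  have hp : Function.Periodic (fun s => f (B.γ i s)) (B.len i) := fun s => by
    simp only [B.periodic_γ i s]
  have h := hp.intervalIntegral_add_eq 0 (s₀ - B.len i / 2)
  rw [zero_add] at h
  rw [h, intervalIntegral.integral_comp_add_left (fun s => f (B.γ i s))]
  congr 1
  ring

theorem IsC1Density.continuousOn {B : PlateGeometry M} {σ : Plane → ℂ} (hσ : B.IsC1Density σ) :
    ContinuousOn σ B.bdry :=
  B.continuousOn_bdry fun i => (hσ i).continuous

theorem IsC1Density.integrable {B : PlateGeometry M} {σ : Plane → ℂ} (hσ : B.IsC1Density σ) :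
    Integrable σ B.arcLength :=
  B.integrable_of_continuousOn hσ.continuousOn

theorem continuousOn_kerExt_right (Q : FlexuralProfile) (a b : Fin 2) {x : Plane}
    (hx : x ∈ B.bdry) : ContinuousOn (fun y => B.kerExt Q a b (x, y)) B.bdry :=
  (B.continuousOn_kerExt Q a b).comp (by fun_prop) fun _ hy => ⟨hx, hy⟩

/-- Off the diagonal the kernel agrees with a continuous, hence bounded, function on the compact
boundary. The truncations converge by dominated convergence to an ordinary integral, and
integrability of the density is enough. -/
theorem hasPV_bdryKernel {k : ℝ} {Q : FlexuralProfile}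
    (hG : ∀ x y, flexuralGreen k x y = Q.φ₀ (‖x - y‖ ^ 2)) (a b : Fin 2) {σ : Plane → ℂ}
    (hσ : Integrable σ B.arcLength) {x : Plane} (hx : x ∈ B.bdry) :
    B.HasPV (B.bdryKernel k a b) σ x (∫ y, B.kerExt Q a b (x, y) * σ y ∂B.arcLength) := by
  have hint := B.integrable_mul_of_continuousOn (B.continuousOn_kerExt_right Q a b hx) hσ
  have hms : ∀ ε : ℝ, MeasurableSet {y : Plane | ε < dist y x} := fun ε =>
    (isOpen_lt continuous_const (by fun_prop)).measurableSet
  have he : ∀ ε ∈ Ioi (0 : ℝ), ∫ y, {y | ε < dist y x}.indicator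
      (fun y => B.kerExt Q a b (x, y) * σ y) y ∂B.arcLength
      = B.truncatedIntegral (B.bdryKernel k a b) σ x ε := fun ε hε => by
    rw [truncatedIntegral, integral_indicator (hms ε)]
    refine setIntegral_congr_ae (hms ε) ?_
    filter_upwards [B.ae_mem_bdry] with y hy hyd
    have hne : x ≠ y := by
      rintro rfl
      have : ε < dist x x := hyd
      rw [dist_self] at this
      exact lt_asymm this hε
    rw [B.bdryKernel_eq_kerExt hG a b hy hne]
  refine Tendsto.congr' (eventually_nhdsWithin_of_forall he) ?_
  refine tendsto_integral_filter_of_dominated_convergence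
    (fun y => ‖B.kerExt Q a b (x, y) * σ y‖) ?_ ?_ hint.norm ?_
  · exact Eventually.of_forall fun ε => hint.1.indicator (hms ε)
  · exact Eventually.of_forall fun ε => Eventually.of_forall fun y => norm_indicator_le_norm_self _ _
  · filter_upwards [B.ae_ne x] with y hy
    refine tendsto_const_nhds.congr' ?_
    filter_upwards [Ioo_mem_nhdsGT (dist_pos.2 hy)] with ε hε
    rw [indicator_of_mem (show y ∈ {y | ε < dist y x} from hε.2)]

theorem bdryOp_eq {k : ℝ} {Q : FlexuralProfile}
    (hG : ∀ x y, flexuralGreen k x y = Q.φ₀ (‖x - y‖ ^ 2)) (a b : Fin 2) {σ : Plane → ℂ}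
    (hσ : Integrable σ B.arcLength) {x : Plane} (hx : x ∈ B.bdry) :
    B.bdryOp (B.bdryKernel k a b) σ x = ∫ y, B.kerExt Q a b (x, y) * σ y ∂B.arcLength :=
  (B.hasPV_bdryKernel hG a b hσ hx).limUnder_eq

end PlateGeometry

end

noncomputable section

/-! ### Differentiability of the layer potentials off the boundary -/

namespace PlateGeometry

variable {M : ℕ} (B : PlateGeometry M)

theorem isOpen_compl_bdry : IsOpen B.bdryᶜ := B.isCompact_bdry.isClosed.isOpen_compl

theorem ne_of_notMem {x y : Plane} (hx : x ∉ B.bdry) (hy : y ∈ B.bdry) : x ≠ y :=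
  fun h => hx (h ▸ hy)

/-- Differentiation under the integral: on a closed ball that misses `∂Ω` the kernel derivative is
bounded by compactness. -/
theorem hasFDerivAt_layerPotential {K : Plane → Plane → ℂ} {K' : Plane → Plane → Plane →L[ℝ] ℂ}
    (hK : ∀ x ∉ B.bdry, ContinuousOn (K x) B.bdry)
    (hK' : ContinuousOn (fun p : Plane × Plane => K' p.1 p.2) (B.bdryᶜ ×ˢ B.bdry))
    (hd : ∀ x ∉ B.bdry, ∀ y ∈ B.bdry, HasFDerivAt (fun w => K w y) (K' x y) x)
    {σ : Plane → ℂ} (hσ : Integrable σ B.arcLength) {x : Plane} (hx : x ∉ B.bdry) :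
    ∃ L : Plane →L[ℝ] ℂ, HasFDerivAt (B.layerPotential K σ) L x ∧
      ∀ v, L v = ∫ y, K' x y v * σ y ∂B.arcLength := by
  obtain ⟨r, hr, hball⟩ := Metric.nhds_basis_closedBall.mem_iff.1
    (B.isOpen_compl_bdry.mem_nhds hx)
  obtain ⟨C, hC⟩ := ((isCompact_closedBall x r).prod B.isCompact_bdry).exists_bound_of_continuousOn
    (hK'.mono (prod_mono hball subset_rfl))
  have hKx : ContinuousOn (K' x) B.bdry :=
    hK'.comp (by fun_prop : ContinuousOn (fun y => (x, y)) B.bdry) fun y hy => ⟨hx, hy⟩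
  have hmeasK' : AEStronglyMeasurable (K' x) B.arcLength := by
    have := hKx.aestronglyMeasurable (μ := B.arcLength) B.measurableSet_bdry
    rwa [B.arcLength_restrict] at this
  have hmeas : AEStronglyMeasurable (fun y => σ y • K' x y) B.arcLength := hσ.1.smul hmeasK'
  have hbound : ∀ᵐ y ∂B.arcLength, ∀ w ∈ Metric.closedBall x r, ‖σ y • K' w y‖ ≤ C * ‖σ y‖ := by
    filter_upwards [B.ae_mem_bdry] with y hy w hw
    rw [norm_smul, mul_comm]
    exact mul_le_mul_of_nonneg_right (hC (w, y) ⟨hw, hy⟩) (norm_nonneg _)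
  have h := hasFDerivAt_integral_of_dominated_of_fderiv_le (𝕜 := ℝ) (μ := B.arcLength)
    (F := fun w y => K w y * σ y) (F' := fun w y => σ y • K' w y) (x₀ := x)
    (bound := fun y => C * ‖σ y‖) (Metric.closedBall_mem_nhds x hr)
    ((B.isOpen_compl_bdry.eventually_mem hx).mono fun w hw =>
      (B.integrable_mul_of_continuousOn (hK w hw) hσ).1)
    (B.integrable_mul_of_continuousOn (hK x hx) hσ) hmeas hbound (hσ.norm.const_mul C)
    (B.ae_mem_bdry.mono fun y hy w hw => (hd w (hball hw) y hy).mul_const (σ y))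
  refine ⟨_, h, fun v => ?_⟩
  have hint : Integrable (fun y => σ y • K' x y) B.arcLength :=
    (hσ.norm.const_mul C).mono' hmeas
      (hbound.mono fun y hy => hy x (Metric.mem_closedBall_self hr.le))
  rw [ContinuousLinearMap.integral_apply hint]
  simp [mul_comm]

theorem continuousOn_ker_normal (Q : FlexuralProfile) (a b : Fin 2) (v : Plane) :
    ContinuousOn (fun p : Plane × Plane => Q.ker a b (p.1 - p.2) (B.normal p.2) v)
      (B.bdryᶜ ×ˢ B.bdry) := by
  intro p hp
  have hne : p.1 - p.2 ≠ 0 := sub_ne_zero.2 (B.ne_of_notMem hp.1 hp.2)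
  have h2 : ContinuousOn (fun p : Plane × Plane => B.normal p.2) (B.bdryᶜ ×ˢ B.bdry) :=
    B.continuousOn_normal.comp continuousOn_snd fun p hp => hp.2
  exact (Q.continuousAt_ker a b (p := (p.1 - p.2, B.normal p.2, v)) hne).comp_continuousWithinAt
    (f := fun p : Plane × Plane => (p.1 - p.2, B.normal p.2, v))
    ((continuous_fst.sub continuous_snd).continuousWithinAt.prodMk
      ((h2 p hp).prodMk continuousWithinAt_const))

theorem hasDirDeriv_bdryKernel {k : ℝ} {Q : FlexuralProfile}
    (hG : ∀ x y, flexuralGreen k x y = Q.φ₀ (‖x - y‖ ^ 2)) (b : Fin 2) {x y : Plane}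
    (hy : y ∈ B.bdry) (h : x ≠ y) (v : Plane) :
    HasDirDeriv (fun w => B.bdryKernel k 0 b w y) v x (Q.ker 1 b (x - y) (B.normal y) v) := by
  fin_cases b
  · exact B.hasDirDeriv_K1 hG hy h v
  · exact B.hasDirDeriv_K2 hG hy h v

theorem bdryKernel_zero_eq {k : ℝ} {Q : FlexuralProfile}
    (hG : ∀ x y, flexuralGreen k x y = Q.φ₀ (‖x - y‖ ^ 2)) (b : Fin 2) {x y : Plane}
    (hy : y ∈ B.bdry) (h : x ≠ y) (v : Plane) :
    B.bdryKernel k 0 b x y = Q.ker 0 b (x - y) (B.normal y) v := by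
  fin_cases b
  · exact B.K1_eq hG hy h
  · exact B.K2_eq hG hy h

theorem continuousOn_bdryKernel_zero {k : ℝ} {Q : FlexuralProfile}
    (hG : ∀ x y, flexuralGreen k x y = Q.φ₀ (‖x - y‖ ^ 2)) (b : Fin 2) {x : Plane}
    (hx : x ∉ B.bdry) : ContinuousOn (B.bdryKernel k 0 b x) B.bdry :=
  ((B.continuousOn_ker_normal Q 0 b 0).comp
    (by fun_prop : ContinuousOn (fun y => (x, y)) B.bdry) fun _ hy => ⟨hx, hy⟩).congr
    fun _ hy => B.bdryKernel_zero_eq hG b hy (B.ne_of_notMem hx hy) 0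

theorem differentiableAt_layerPotential_and_dirDeriv {k : ℝ} {Q : FlexuralProfile}
    (hG : ∀ x y, flexuralGreen k x y = Q.φ₀ (‖x - y‖ ^ 2)) (b : Fin 2) {σ : Plane → ℂ}
    (hσ : Integrable σ B.arcLength) {x : Plane} (hx : x ∉ B.bdry) :
    DifferentiableAt ℝ (B.layerPotential (B.bdryKernel k 0 b) σ) x ∧
    ∀ v, dirDeriv v (B.layerPotential (B.bdryKernel k 0 b) σ) x
      = ∫ y, Q.ker 1 b (x - y) (B.normal y) v * σ y ∂B.arcLength := by
  set e : Fin 2 → Plane := fun j => EuclideanSpace.single j (1 : ℝ) with he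
  -- The derivative is assembled from its values on the two basis vectors, so its joint continuity
  -- reduces to that of the scalar closed forms.
  set K' : Plane → Plane → Plane →L[ℝ] ℂ := fun x y =>
    ∑ j, (EuclideanSpace.proj (𝕜 := ℝ) j : Plane →L[ℝ] ℝ).smulRight
      (Q.ker 1 b (x - y) (B.normal y) (e j)) with hK'
  have hd : ∀ x ∉ B.bdry, ∀ y ∈ B.bdry,
      HasFDerivAt (fun w => B.bdryKernel k 0 b w y) (K' x y) x ∧
      ∀ v, K' x y v = Q.ker 1 b (x - y) (B.normal y) v := by
    intro x hx y hy
    have hv := fun v => B.hasDirDeriv_bdryKernel hG b hy (B.ne_of_notMem hx hy) v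
    obtain ⟨f', hf, -⟩ := hv 0
    have hfv : ∀ v, f' v = Q.ker 1 b (x - y) (B.normal y) v := fun v => by
      obtain ⟨g', hg, hgv⟩ := hv v
      rw [hf.unique hg, hgv]
    have hKf : K' x y = f' := by
      ext v
      have hvs : v = ∑ j, v j • e j := by
        ext l
        fin_cases l <;> simp [he, Fin.sum_univ_two]
      conv_rhs => rw [hvs, map_sum]
      simp only [map_smul]
      simp only [hfv]
      simp [hK']
    exact ⟨hKf ▸ hf, fun v => hKf ▸ hfv v⟩
  have hcont : ContinuousOn (fun p : Plane × Plane => K' p.1 p.2) (B.bdryᶜ ×ˢ B.bdry) :=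
    continuousOn_finsetSum _ fun j _ =>
      ((ContinuousLinearMap.smulRightL ℝ Plane ℂ
        (EuclideanSpace.proj (𝕜 := ℝ) j : Plane →L[ℝ] ℝ)).continuous.comp_continuousOn
        (B.continuousOn_ker_normal Q 1 b (e j)))
  obtain ⟨L, hL, hLv⟩ := B.hasFDerivAt_layerPotential
    (fun x hx => B.continuousOn_bdryKernel_zero hG b hx) hcont
    (fun x hx y hy => (hd x hx y hy).1) hσ hx
  refine ⟨hL.differentiableAt, fun v => ?_⟩
  rw [dirDeriv, hL.fderiv, hLv]
  refine integral_congr_ae (B.ae_mem_bdry.mono fun y hy => ?_)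
  simp only [(hd x hx y hy).2]

end PlateGeometry

end

noncomputable section

/-! ### One-sided limits of the layer potentials -/

namespace PlateGeometry

variable {M : ℕ} (B : PlateGeometry M)

theorem tendsto_curve_integral (j : Fin M) {F : Plane → Plane → ℂ} {x₀ : Plane} {r : ℝ}
    (hr : 0 < r)
    (hF : ContinuousOn (fun p : Plane × Plane => F p.1 p.2)
      (Metric.closedBall x₀ r ×ˢ range (B.γ j))) :
    Tendsto (fun x => ∫ s in (0)..(B.len j), F x (B.γ j s)) (𝓝 x₀)
      (𝓝 (∫ s in (0)..(B.len j), F x₀ (B.γ j s))) := by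
  have hc : IsCompact (range (B.γ j)) := by
    have : range (B.γ j) = B.γ j '' Icc 0 (B.len j) := by
      refine Subset.antisymm ?_ (image_subset_range _ _)
      rintro _ ⟨s, rfl⟩
      obtain ⟨t, ht, h⟩ := B.exists_mem_Ioc j s
      exact ⟨t, Ioc_subset_Icc_self ht, h⟩
    rw [this]
    exact isCompact_Icc.image (B.continuous_γ j)
  obtain ⟨C, hC⟩ := ((isCompact_closedBall x₀ r).prod hc).exists_bound_of_continuousOn hF
  have hball : ∀ᶠ x in 𝓝 x₀, x ∈ Metric.closedBall x₀ r := Metric.closedBall_mem_nhds x₀ hr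
  have hcs : ∀ x ∈ Metric.closedBall x₀ r, Continuous fun s => F x (B.γ j s) := fun x hx =>
    hF.comp_continuous (continuous_const.prodMk (B.continuous_γ j))
      fun s => ⟨hx, mem_range_self s⟩
  refine intervalIntegral.tendsto_integral_filter_of_dominated_convergence (fun _ => C)
    (hball.mono fun x hx => (hcs x hx).aestronglyMeasurable)
    (hball.mono fun x hx => Eventually.of_forall fun s _ => hC (x, B.γ j s) ⟨hx, mem_range_self s⟩)
    intervalIntegrable_const (Eventually.of_forall fun s _ => ?_)
  have hat : ContinuousOn (fun x => F x (B.γ j s)) (Metric.closedBall x₀ r) :=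
    hF.comp (by fun_prop : ContinuousOn (fun x => (x, B.γ j s)) _)
      fun x hx => ⟨hx, mem_range_self s⟩
  exact hat.continuousAt (Metric.closedBall_mem_nhds x₀ hr)

theorem exists_closedBall_disjoint (i j : Fin M) (hij : i ≠ j) (s₀ : ℝ) :
    ∃ r > 0, ∀ x ∈ Metric.closedBall (B.γ i s₀) r, ∀ y ∈ range (B.γ j), x ≠ y := by
  have hcl : IsClosed (range (B.γ j)) := by
    rw [← B.frontier_dom j]; exact isClosed_frontier
  have hmem : B.γ i s₀ ∈ (range (B.γ j))ᶜ := by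
    rintro ⟨t, ht⟩
    exact hij (B.param_unique (p := (i, s₀)) (q := (j, t)) ht.symm).1
  obtain ⟨r, hr, h⟩ := Metric.nhds_basis_closedBall.mem_iff.1 (hcl.isOpen_compl.mem_nhds hmem)
  exact ⟨r, hr, fun x hx y hy he => h hx (he ▸ hy)⟩

theorem tendsto_normal_line (x₀ v : Plane) (s : ℝ) :
    Tendsto (fun η : ℝ => x₀ + (s * η) • v) (𝓝[>] 0) (𝓝 x₀) := by
  have : Continuous fun η : ℝ => x₀ + (s * η) • v := by fun_prop
  have h := this.tendsto 0
  simp only [mul_zero, zero_smul, add_zero] at h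
  exact h.mono_left nhdsWithin_le_nhds

theorem exists_mem_Icc_half (i : Fin M) (s₀ s : ℝ) :
    ∃ t ∈ Icc (-(B.len i / 2)) (B.len i / 2), B.γ i s = B.γ i (s₀ + t) := by
  obtain ⟨t, ht, h⟩ := (B.periodic_γ i).exists_mem_Ioc (B.len_pos i) s (s₀ - B.len i / 2)
  refine ⟨t - s₀, ⟨by linarith [ht.1], by linarith [ht.2]⟩, ?_⟩
  rw [h]
  congr 1
  ring

/-- The own curve is avoided because `dist2` is positive for small `η`, the other curves because
they lie at positive distance. -/
theorem eventually_notMem_bdry (i : Fin M) (s₀ s : ℝ) (hs : s ^ 2 = 1) :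
    ∀ᶠ η in 𝓝[>] (0 : ℝ), B.γ i s₀ + (s * η) • B.normal (B.γ i s₀) ∉ B.bdry := by
  obtain ⟨F, hT, -, -, hne, -⟩ := B.exists_localFrame i s₀ s hs
  obtain ⟨η₀, C, hb, hpos⟩ := F.exists_isBlockRatio
  have hcurve : ∀ j, ∀ᶠ η in 𝓝[>] (0 : ℝ), ∀ y ∈ range (B.γ j),
      B.γ i s₀ + (s * η) • B.normal (B.γ i s₀) ≠ y := by
    intro j
    by_cases hij : i = j
    · subst hij
      filter_upwards [hb.eventually_mem] with η hη
      rintro _ ⟨t, rfl⟩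
      obtain ⟨t', ht', he⟩ := B.exists_mem_Icc_half i s₀ t
      rw [he]
      exact sub_ne_zero.1 (hne η t' (hpos η hη t' (hT ▸ ht')))
    · obtain ⟨r, hr, h⟩ := B.exists_closedBall_disjoint i j hij s₀
      filter_upwards [(tendsto_normal_line (B.γ i s₀) (B.normal (B.γ i s₀)) s).eventually
        (Metric.closedBall_mem_nhds _ hr)] with η hη
      exact h _ hη
  filter_upwards [eventually_all.2 hcurve] with η hη hmem
  obtain ⟨j, t, he⟩ := B.exists_param hmem
  exact hη j _ (mem_range_self t) he.symm

theorem continuousOn_ker_fixed (Q : FlexuralProfile) (a b : Fin 2) (v : Plane) {N S : Set Plane}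
    (hS : S ⊆ B.bdry) (hne : ∀ x ∈ N, ∀ y ∈ S, x ≠ y) :
    ContinuousOn (fun p : Plane × Plane => Q.ker a b (p.1 - p.2) (B.normal p.2) v) (N ×ˢ S) := by
  intro p hp
  have hz : p.1 - p.2 ≠ 0 := sub_ne_zero.2 (hne _ hp.1 _ hp.2)
  have h2 : ContinuousOn (fun p : Plane × Plane => B.normal p.2) (N ×ˢ S) :=
    B.continuousOn_normal.comp continuousOn_snd fun p hp => hS hp.2
  exact (Q.continuousAt_ker a b (p := (p.1 - p.2, B.normal p.2, v)) hz).comp_continuousWithinAt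
    (f := fun p : Plane × Plane => (p.1 - p.2, B.normal p.2, v))
    ((continuous_fst.sub continuous_snd).continuousWithinAt.prodMk
      ((h2 p hp).prodMk continuousWithinAt_const))

theorem continuousOn_ker_left (Q : FlexuralProfile) (a b : Fin 2) (v : Plane) {x : Plane}
    (hx : x ∉ B.bdry) : ContinuousOn (fun y => Q.ker a b (x - y) (B.normal y) v) B.bdry := by
  have h := B.continuousOn_ker_fixed Q a b v (N := {x}) (S := B.bdry) subset_rfl
    (by rintro _ rfl y hy; exact B.ne_of_notMem hx hy)
  have h2 : ContinuousOn (fun y : Plane => (x, y)) B.bdry := by fun_prop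
  exact h.comp h2 fun y hy => ⟨rfl, hy⟩

theorem range_subset_bdry (j : Fin M) : range (B.γ j) ⊆ B.bdry :=
  fun _ h => mem_iUnion.2 ⟨j, h⟩

theorem tendsto_curve_integral_of_ne (Q : FlexuralProfile) (a b : Fin 2) {i j : Fin M}
    (hij : i ≠ j) (s₀ s : ℝ) {σ : Plane → ℂ} (hσ : B.IsC1Density σ) :
    Tendsto (fun η => ∫ t in (0)..(B.len j),
      Q.ker a b (B.γ i s₀ + (s * η) • B.normal (B.γ i s₀) - B.γ j t) (B.normal (B.γ j t))
        (B.normal (B.γ i s₀)) * σ (B.γ j t)) (𝓝[>] 0)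
      (𝓝 (∫ t in (0)..(B.len j), B.kerExt Q a b (B.γ i s₀, B.γ j t) * σ (B.γ j t))) := by
  obtain ⟨r, hr, hne⟩ := B.exists_closedBall_disjoint i j hij s₀
  have hF : ContinuousOn (fun p : Plane × Plane =>
      Q.ker a b (p.1 - p.2) (B.normal p.2) (B.normal (B.γ i s₀)) * σ p.2)
      (Metric.closedBall (B.γ i s₀) r ×ˢ range (B.γ j)) :=
    (B.continuousOn_ker_fixed Q a b _ (B.range_subset_bdry j) hne).mul
      (hσ.continuousOn.comp continuousOn_snd fun p hp => B.range_subset_bdry j hp.2)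
  have h := (B.tendsto_curve_integral j hr (F := fun x y =>
    Q.ker a b (x - y) (B.normal y) (B.normal (B.γ i s₀)) * σ y) hF).comp
    (tendsto_normal_line (B.γ i s₀) (B.normal (B.γ i s₀)) s)
  have he : ∀ t, B.kerExt Q a b (B.γ i s₀, B.γ j t) = Q.ker a b (B.γ i s₀ - B.γ j t)
      (B.normal (B.γ j t)) (B.normal (B.γ i s₀)) := fun t => by
    have hn : B.γ i s₀ ≠ B.γ j t :=
      hne _ (Metric.mem_closedBall_self hr.le) _ (mem_range_self t)
    rw [Q.ker_eq_sing_add_rem a b (sub_ne_zero.2 hn), kerExt, B.singExt_of_ne a b hn]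
  simp only [he]
  exact h

/-- The jump coefficients on the side with sign `s`. -/
def jumpCoeff (s : ℝ) (a b : Fin 2) (x : Plane) : ℝ :=
  (![![-s / 2, 0], ![s * B.curvature x, -s / 2]] : Fin 2 → Fin 2 → ℝ) a b

/-- The biharmonic part carries the jump through the local frame; the remainder is continuous across
the boundary and passes to the limit unchanged. -/
theorem tendsto_curve_integral_self (Q : FlexuralProfile) (a b : Fin 2) (i : Fin M)
    (s₀ s : ℝ) (hs : s ^ 2 = 1) {σ : Plane → ℂ} (hσ : B.IsC1Density σ) :
    Tendsto (fun η => ∫ t in (0)..(B.len i),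
      Q.ker a b (B.γ i s₀ + (s * η) • B.normal (B.γ i s₀) - B.γ i t) (B.normal (B.γ i t))
        (B.normal (B.γ i s₀)) * σ (B.γ i t)) (𝓝[>] 0)
      (𝓝 ((B.jumpCoeff s a b (B.γ i s₀) : ℂ) * σ (B.γ i s₀)
        + ∫ t in (0)..(B.len i), B.kerExt Q a b (B.γ i s₀, B.γ i t) * σ (B.γ i t))) := by
  obtain ⟨F, hT, hFs, hκ, hne, hsing⟩ := B.exists_localFrame i s₀ s hs
  obtain ⟨η₀, C, hb, hpos⟩ := F.exists_isBlockRatio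
  set x₀ := B.γ i s₀ with hx₀
  set n₀ := B.normal x₀ with hn₀
  have cσ : Continuous fun t => σ (B.γ i t) := (hσ i).continuous
  have cn : Continuous fun t => B.normal (B.γ i t) := by
    simp only [B.normal_γ_eq]
    exact continuous_rotate.comp (B.continuous_deriv_γ i)
  have cγ := B.continuous_γ i
  have hjump : F.locJump a b = B.jumpCoeff s a b x₀ := by
    fin_cases a <;> fin_cases b <;> simp [LocalFrame.locJump, jumpCoeff, hFs, ← hκ]
    ring
  have hsm : ContDiff ℝ 1 fun t => σ (B.γ i (s₀ + t)) :=
    (hσ i).comp (contDiff_const.add contDiff_id)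
  have h1 := F.tendsto_integral_locKer a b hsm
  have hrem := (B.tendsto_curve_integral i one_pos (x₀ := x₀) (F := fun x y =>
      Q.remKer a b (x - y) (B.normal y) n₀ * σ y) (by
    have h2 : ContinuousOn (fun p : Plane × Plane => B.normal p.2)
        (Metric.closedBall x₀ 1 ×ˢ range (B.γ i)) :=
      B.continuousOn_normal.comp continuousOn_snd fun p hp => B.range_subset_bdry i hp.2
    exact ((Q.continuous_remKer a b).comp_continuousOn
      ((continuous_fst.sub continuous_snd).continuousOn.prodMk (h2.prodMk continuousOn_const))).mul
      (hσ.continuousOn.comp continuousOn_snd fun p hp => B.range_subset_bdry i hp.2))).comp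
    (tendsto_normal_line x₀ n₀ s)
  have htot := h1.add hrem
  have hlimit : ((F.locJump a b : ℂ) * σ (B.γ i (s₀ + 0))
      + ∫ t in (-F.T)..F.T, (F.locKer a b 0 t : ℂ) * σ (B.γ i (s₀ + t)))
      + ∫ t in (0)..(B.len i), Q.remKer a b (x₀ - B.γ i t) (B.normal (B.γ i t)) n₀ * σ (B.γ i t)
      = (B.jumpCoeff s a b x₀ : ℂ) * σ x₀
        + ∫ t in (0)..(B.len i), B.kerExt Q a b (x₀, B.γ i t) * σ (B.γ i t) := by
    have e1 : ∫ t in (-F.T)..F.T, (F.locKer a b 0 t : ℂ) * σ (B.γ i (s₀ + t))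
        = ∫ t in (0)..(B.len i), (B.singExt a b (x₀, B.γ i t) : ℂ) * σ (B.γ i t) := by
      rw [B.integral_shift i s₀ (fun y => (B.singExt a b (x₀, y) : ℂ) * σ y), hT]
      refine intervalIntegral.integral_congr_ae ?_
      have h0 : ∀ᵐ t : ℝ, t ≠ 0 := by simp [ae_iff]
      filter_upwards [h0] with t ht htm
      rw [Set.uIoc_of_le (by linarith [B.len_pos i])] at htm
      have hn : x₀ ≠ B.γ i (s₀ + t) := by
        refine B.γ_ne_of_abs_sub_lt i (by simpa using ht) ?_
        rw [abs_lt]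
        constructor <;> linarith [htm.1, htm.2, B.len_pos i]
      -- At `η = 0` the local kernel is the boundary kernel itself, so the limit integral is the
      -- boundary integral.
      have h := hsing a b 0 t
      rw [mul_zero, zero_smul, add_zero] at h
      rw [B.singExt_of_ne a b hn, ← h]
    have csing : Continuous fun t => (B.singExt a b (x₀, B.γ i t) : ℂ) := by
      refine Complex.continuous_ofReal.comp ?_
      exact (B.continuousOn_singExt a b).comp_continuous (continuous_const.prodMk cγ)
        fun t => ⟨B.γ_mem_bdry i s₀, B.γ_mem_bdry i t⟩
    have crem : Continuous fun t => Q.remKer a b (x₀ - B.γ i t) (B.normal (B.γ i t)) n₀ :=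
      (Q.continuous_remKer a b).comp ((continuous_const.sub cγ).prodMk
        (cn.prodMk continuous_const))
    have i1 : IntervalIntegrable (fun t => (B.singExt a b (x₀, B.γ i t) : ℂ) * σ (B.γ i t))
        volume 0 (B.len i) := (csing.mul cσ).intervalIntegrable _ _
    have i2 : IntervalIntegrable (fun t => Q.remKer a b (x₀ - B.γ i t) (B.normal (B.γ i t)) n₀
        * σ (B.γ i t)) volume 0 (B.len i) := (crem.mul cσ).intervalIntegrable _ _
    rw [e1, hjump, add_zero, add_assoc, ← intervalIntegral.integral_add i1 i2]
    congr 1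
    refine intervalIntegral.integral_congr fun t _ => ?_
    simp only [kerExt]
    ring
  rw [hlimit] at htot
  refine htot.congr' ?_
  filter_upwards [hb.eventually_mem, B.eventually_notMem_bdry i s₀ s hs] with η hη hη'
  set x := x₀ + (s * η) • n₀ with hx
  have hxne : ∀ t, x - B.γ i t ≠ 0 := fun t =>
    sub_ne_zero.2 (B.ne_of_notMem hη' (B.γ_mem_bdry i t))
  have e1 : ∫ t in (-F.T)..F.T, (F.locKer a b η t : ℂ) * σ (B.γ i (s₀ + t))
      = ∫ t in (0)..(B.len i),
        (singKer a b (x - B.γ i t) (B.normal (B.γ i t)) n₀ : ℂ) * σ (B.γ i t) := by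
    rw [B.integral_shift i s₀ (fun y => (singKer a b (x - y) (B.normal y) n₀ : ℂ) * σ y), hT]
    refine intervalIntegral.integral_congr fun t _ => ?_
    simp only [← hsing a b η t]
    rfl
  have csing : Continuous fun t =>
      (singKer a b (x - B.γ i t) (B.normal (B.γ i t)) n₀ : ℂ) := by
    refine Complex.continuous_ofReal.comp (continuous_iff_continuousAt.2 fun t => ?_)
    exact ContinuousAt.comp (f := fun t => (x - B.γ i t, B.normal (B.γ i t), n₀))
      (FlexuralProfile.continuousAt_singKer a b (p := (_, _, _)) (hxne t))
      ((continuous_const.sub cγ).prodMk (cn.prodMk continuous_const)).continuousAt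
  have crem : Continuous fun t => Q.remKer a b (x - B.γ i t) (B.normal (B.γ i t)) n₀ :=
    (Q.continuous_remKer a b).comp ((continuous_const.sub cγ).prodMk (cn.prodMk continuous_const))
  have i1 : IntervalIntegrable (fun t => (singKer a b (x - B.γ i t) (B.normal (B.γ i t)) n₀ : ℂ)
      * σ (B.γ i t)) volume 0 (B.len i) := (csing.mul cσ).intervalIntegrable _ _
  have i2 : IntervalIntegrable (fun t => Q.remKer a b (x - B.γ i t) (B.normal (B.γ i t)) n₀
      * σ (B.γ i t)) volume 0 (B.len i) := (crem.mul cσ).intervalIntegrable _ _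
  change _ + (∫ t in (0)..(B.len i), Q.remKer a b (x - B.γ i t) (B.normal (B.γ i t)) n₀
      * σ (B.γ i t)) = _
  rw [e1, ← intervalIntegral.integral_add i1 i2]
  refine intervalIntegral.integral_congr fun t _ => ?_
  simp only [Q.ker_eq_sing_add_rem a b (hxne t)]
  ring

/-- Only the curve through `x₀` contributes a jump, since the kernel is continuous near `x₀` against
the other curves. -/
theorem tendsto_integral_ker (Q : FlexuralProfile) (a b : Fin 2) {x₀ : Plane} (hx₀ : x₀ ∈ B.bdry)
    (s : ℝ) (hs : s ^ 2 = 1) {σ : Plane → ℂ} (hσ : B.IsC1Density σ) :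
    Tendsto (fun η => ∫ y, Q.ker a b (x₀ + (s * η) • B.normal x₀ - y) (B.normal y)
        (B.normal x₀) * σ y ∂B.arcLength) (𝓝[>] 0)
      (𝓝 ((B.jumpCoeff s a b x₀ : ℂ) * σ x₀
        + ∫ y, B.kerExt Q a b (x₀, y) * σ y ∂B.arcLength)) := by
  obtain ⟨i, s₀, rfl⟩ := B.exists_param hx₀
  have hj : ∀ j ∈ Finset.univ, Tendsto (fun η => ∫ t in (0)..(B.len j),
      Q.ker a b (B.γ i s₀ + (s * η) • B.normal (B.γ i s₀) - B.γ j t) (B.normal (B.γ j t))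
        (B.normal (B.γ i s₀)) * σ (B.γ j t)) (𝓝[>] 0)
      (𝓝 ((if i = j then (B.jumpCoeff s a b (B.γ i s₀) : ℂ) * σ (B.γ i s₀) else 0)
        + ∫ t in (0)..(B.len j), B.kerExt Q a b (B.γ i s₀, B.γ j t) * σ (B.γ j t))) := by
    intro j _
    by_cases hij : i = j
    · subst hij
      rw [if_pos rfl]
      exact B.tendsto_curve_integral_self Q a b i s₀ s hs hσ
    · rw [if_neg hij, zero_add]
      exact B.tendsto_curve_integral_of_ne Q a b hij s₀ s hσ
  have h := tendsto_finsetSum _ hj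
  rw [Finset.sum_add_distrib, Finset.sum_ite_eq, if_pos (Finset.mem_univ i),
    ← B.integral_arcLength (B.integrable_mul_of_continuousOn
      (B.continuousOn_kerExt_right Q a b hx₀) hσ.integrable)] at h
  refine h.congr' ?_
  filter_upwards [B.eventually_notMem_bdry i s₀ s hs] with η hη
  generalize B.γ i s₀ + (s * η) • B.normal (B.γ i s₀) = x at hη ⊢
  exact (B.integral_arcLength (B.integrable_mul_of_continuousOn
    (B.continuousOn_ker_left Q a b (B.normal (B.γ i s₀)) hη) hσ.integrable)).symm

end PlateGeometry

end

noncomputable section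

/-! ### Jump relations -/

theorem Side.sign_mul_sign (side : Side) : side.sign * side.sign = 1 := by
  cases side <;> simp [Side.sign]

/-- The sign of a side, as a real number. -/
def Side.realSign : Side → ℝ
  | .exterior => 1
  | .interior => -1

theorem Side.ofReal_realSign (side : Side) : (side.realSign : ℂ) = side.sign := by
  cases side <;> simp [Side.sign, Side.realSign]

theorem Side.realSign_sq (side : Side) : side.realSign ^ 2 = 1 := by
  cases side <;> simp [Side.realSign]

theorem Side.tendsto_realSign_mul (side : Side) :
    Tendsto (fun h => side.realSign * h) side.approach (𝓝[>] 0) := by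
  cases side
  · simp only [Side.realSign, Side.approach, one_mul]
    exact tendsto_id
  · simp only [Side.realSign, Side.approach, neg_mul, one_mul]
    simpa using tendsto_neg_nhdsLT (a := (0 : ℝ))

theorem Side.realSign_mul_realSign_mul (side : Side) (h : ℝ) :
    side.realSign * (side.realSign * h) = h := by
  rw [← mul_assoc, ← sq, side.realSign_sq, one_mul]

namespace PlateGeometry

variable {M : ℕ} (B : PlateGeometry M)

theorem eventually_approach_notMem_bdry (side : Side) {x₀ : Plane} (hx₀ : x₀ ∈ B.bdry) :
    ∀ᶠ h in side.approach, x₀ + h • B.normal x₀ ∉ B.bdry := by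
  obtain ⟨i, s₀, rfl⟩ := B.exists_param hx₀
  filter_upwards [side.tendsto_realSign_mul.eventually
    (B.eventually_notMem_bdry i s₀ side.realSign side.realSign_sq)] with h hh
  rwa [side.realSign_mul_realSign_mul] at hh

theorem tendsto_integral_ker_side (Q : FlexuralProfile) (a b : Fin 2) {x₀ : Plane}
    (hx₀ : x₀ ∈ B.bdry) (side : Side) {σ : Plane → ℂ} (hσ : B.IsC1Density σ) :
    Tendsto (fun h : ℝ => ∫ y, Q.ker a b (x₀ + h • B.normal x₀ - y) (B.normal y)
        (B.normal x₀) * σ y ∂B.arcLength) side.approach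
      (𝓝 ((B.jumpCoeff side.realSign a b x₀ : ℂ) * σ x₀
        + ∫ y, B.kerExt Q a b (x₀, y) * σ y ∂B.arcLength)) := by
  have h := (B.tendsto_integral_ker Q a b hx₀ side.realSign side.realSign_sq hσ).comp
    side.tendsto_realSign_mul
  simpa only [Function.comp_def, side.realSign_mul_realSign_mul] using h

theorem hasSideLimit_layerPotential {k : ℝ} {Q : FlexuralProfile}
    (hG : ∀ x y, flexuralGreen k x y = Q.φ₀ (‖x - y‖ ^ 2)) (b : Fin 2) {x₀ : Plane}
    (hx₀ : x₀ ∈ B.bdry) (side : Side) {σ : Plane → ℂ} (hσ : B.IsC1Density σ) :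
    B.HasSideLimit side (B.layerPotential (B.bdryKernel k 0 b) σ) x₀
      ((B.jumpCoeff side.realSign 0 b x₀ : ℂ) * σ x₀ + B.bdryOp (B.bdryKernel k 0 b) σ x₀) := by
  rw [B.bdryOp_eq hG 0 b hσ.integrable hx₀]
  refine (B.tendsto_integral_ker_side Q 0 b hx₀ side hσ).congr' ?_
  filter_upwards [B.eventually_approach_notMem_bdry side hx₀] with h hh
  refine integral_congr_ae ?_
  filter_upwards [B.ae_mem_bdry] with y hy
  rw [B.bdryKernel_zero_eq hG b hy (B.ne_of_notMem hh hy)]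

theorem hasSideLimit_dirDeriv_layerPotential {k : ℝ} {Q : FlexuralProfile}
    (hG : ∀ x y, flexuralGreen k x y = Q.φ₀ (‖x - y‖ ^ 2)) (b : Fin 2) {x₀ : Plane}
    (hx₀ : x₀ ∈ B.bdry) (side : Side) {σ : Plane → ℂ} (hσ : B.IsC1Density σ) :
    B.HasSideLimit side
      (dirDeriv (B.normal x₀) (B.layerPotential (B.bdryKernel k 0 b) σ)) x₀
      ((B.jumpCoeff side.realSign 1 b x₀ : ℂ) * σ x₀ + B.bdryOp (B.bdryKernel k 1 b) σ x₀) := by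
  rw [B.bdryOp_eq hG 1 b hσ.integrable hx₀]
  refine (B.tendsto_integral_ker_side Q 1 b hx₀ side hσ).congr' ?_
  filter_upwards [B.eventually_approach_notMem_bdry side hx₀] with h hh
  exact ((B.differentiableAt_layerPotential_and_dirDeriv hG b hσ.integrable hh).2 _).symm

theorem jump_relations {k : ℝ} {Q : FlexuralProfile}
    (hG : ∀ x y, flexuralGreen k x y = Q.φ₀ (‖x - y‖ ^ 2)) {σ : Plane → ℂ}
    (hσ : B.IsC1Density σ) {x₀ : Plane} (hx₀ : x₀ ∈ B.bdry) (side : Side) :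
    B.HasSideLimit side (B.layerPotential (B.K1 k) σ) x₀
        (-side.sign / 2 * σ x₀ + B.bdryOp (B.bdryKernel k 0 0) σ x₀) ∧
      B.HasSideLimit side (B.layerPotential (B.K2 k) σ) x₀
        (B.bdryOp (B.bdryKernel k 0 1) σ x₀) ∧
      B.HasSideLimit side (dirDeriv (B.normal x₀) (B.layerPotential (B.K1 k) σ)) x₀
        (side.sign * (B.curvature x₀ : ℂ) * σ x₀ + B.bdryOp (B.bdryKernel k 1 0) σ x₀) ∧
      B.HasSideLimit side (dirDeriv (B.normal x₀) (B.layerPotential (B.K2 k) σ)) x₀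
        (-side.sign / 2 * σ x₀ + B.bdryOp (B.bdryKernel k 1 1) σ x₀) := by
  have h00 := B.hasSideLimit_layerPotential hG 0 hx₀ side hσ
  have h01 := B.hasSideLimit_layerPotential hG 1 hx₀ side hσ
  have h10 := B.hasSideLimit_dirDeriv_layerPotential hG 0 hx₀ side hσ
  have h11 := B.hasSideLimit_dirDeriv_layerPotential hG 1 hx₀ side hσ
  have e00 : (B.jumpCoeff side.realSign 0 0 x₀ : ℂ) = -side.sign / 2 := by
    simp [jumpCoeff, side.ofReal_realSign]
  have e01 : (B.jumpCoeff side.realSign 0 1 x₀ : ℂ) = 0 := by simp [jumpCoeff]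
  have e10 : (B.jumpCoeff side.realSign 1 0 x₀ : ℂ) = side.sign * B.curvature x₀ := by
    simp [jumpCoeff, side.ofReal_realSign]
  have e11 : (B.jumpCoeff side.realSign 1 1 x₀ : ℂ) = -side.sign / 2 := by
    simp [jumpCoeff, side.ofReal_realSign]
  rw [e00] at h00
  rw [e01, zero_mul, zero_add] at h01
  rw [e10] at h10
  rw [e11] at h11
  exact ⟨h00, h01, h10, h11⟩

theorem hasSideLimit_representation {k : ℝ} {Q : FlexuralProfile}
    (hG : ∀ x y, flexuralGreen k x y = Q.φ₀ (‖x - y‖ ^ 2)) {ρ : (Plane → ℂ) × (Plane → ℂ)}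
    (h₁ : B.IsC1Density ρ.1) (h₂ : B.IsC1Density ρ.2) {x₀ : Plane} (hx₀ : x₀ ∈ B.bdry)
    (side : Side) :
    B.HasSideLimit side (B.representation k ρ) x₀
        (B.jumpPart side ρ x₀ + B.integralPart k ρ x₀).1 ∧
      B.HasSideLimit side (dirDeriv (B.normal x₀) (B.representation k ρ)) x₀
        (B.jumpPart side ρ x₀ + B.integralPart k ρ x₀).2 := by
  obtain ⟨a1, -, c1, -⟩ := B.jump_relations hG h₁ hx₀ side
  obtain ⟨-, b2, -, d2⟩ := B.jump_relations hG h₂ hx₀ side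
  constructor
  · have h := Tendsto.add a1 b2
    rw [add_assoc] at h
    exact h
  · have h := Tendsto.add c1 d2
    have e : (B.jumpPart side ρ x₀ + B.integralPart k ρ x₀).2
        = side.sign * (B.curvature x₀ : ℂ) * ρ.1 x₀ + B.bdryOp (B.bdryKernel k 1 0) ρ.1 x₀
          + (-side.sign / 2 * ρ.2 x₀ + B.bdryOp (B.bdryKernel k 1 1) ρ.2 x₀) := by
      simp only [jumpPart, integralPart, Prod.snd_add]
      ring
    rw [e]
    refine h.congr' ?_
    -- Splitting `fderiv` of the sum requires both potentials to be differentiable, which holds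
    -- along the approach as it leaves the boundary.
    filter_upwards [B.eventually_approach_notMem_bdry side hx₀] with t ht
    have d1 : DifferentiableAt ℝ (B.layerPotential (B.K1 k) ρ.1) _ :=
      (B.differentiableAt_layerPotential_and_dirDeriv hG 0 h₁.integrable ht).1
    have d2 : DifferentiableAt ℝ (B.layerPotential (B.K2 k) ρ.2) _ :=
      (B.differentiableAt_layerPotential_and_dirDeriv hG 1 h₂.integrable ht).1
    change _ = fderiv ℝ (B.layerPotential (B.K1 k) ρ.1 + B.layerPotential (B.K2 k) ρ.2) _ _
    rw [fderiv_add d1 d2]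
    rfl

theorem layerPotential_off_bdry {k : ℝ} {Q : FlexuralProfile}
    (hG : ∀ x y, flexuralGreen k x y = Q.φ₀ (‖x - y‖ ^ 2)) {σ : Plane → ℂ}
    (hσ : Integrable σ B.arcLength) {x : Plane} (hx : x ∉ B.bdry) :
    Integrable (fun y => B.K1 k x y * σ y) B.arcLength ∧
      Integrable (fun y => B.K2 k x y * σ y) B.arcLength ∧
      DifferentiableAt ℝ (B.layerPotential (B.K1 k) σ) x ∧
      DifferentiableAt ℝ (B.layerPotential (B.K2 k) σ) x :=
  ⟨B.integrable_mul_of_continuousOn (B.continuousOn_bdryKernel_zero hG 0 hx) hσ,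
    B.integrable_mul_of_continuousOn (B.continuousOn_bdryKernel_zero hG 1 hx) hσ,
    (B.differentiableAt_layerPotential_and_dirDeriv hG 0 hσ hx).1,
    (B.differentiableAt_layerPotential_and_dirDeriv hG 1 hσ hx).1⟩

end PlateGeometry

end

noncomputable section

/-! ### Compactness and the second kind structure -/

/-- The evaluation map `σ ↦ (x ↦ Φ x σ)` of a continuous family of functionals on a compact
space. -/
def evalFamily {X E : Type*} [TopologicalSpace X] [CompactSpace X] [NormedAddCommGroup E]
    [NormedSpace ℂ E] (Φ : C(X, E →L[ℂ] ℂ)) : E →ₗ[ℂ] BoundedContinuousFunction X ℂ where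
  toFun σ := BoundedContinuousFunction.mkOfCompact ⟨fun x => Φ x σ, by fun_prop⟩
  map_add' σ τ := by ext x; simp
  map_smul' c σ := by ext x; simp

/-- Arzelà–Ascoli: the images of the unit ball are bounded by `‖Φ‖` and equicontinuous, because `Φ`
is continuous in operator norm. -/
theorem isCompactOperator_evalFamily {X E : Type*} [TopologicalSpace X] [CompactSpace X]
    [NormedAddCommGroup E] [NormedSpace ℂ E] (Φ : C(X, E →L[ℂ] ℂ)) :
    IsCompactOperator (evalFamily Φ) := by
  refine ⟨closure (evalFamily Φ '' Metric.ball 0 1), ?_,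
    mem_of_superset (Metric.ball_mem_nhds 0 one_pos)
      fun σ hσ => subset_closure (mem_image_of_mem _ hσ)⟩
  refine BoundedContinuousFunction.arzela_ascoli (Metric.closedBall 0 ‖Φ‖)
    (isCompact_closedBall 0 _) _ ?_ ?_
  · rintro _ x ⟨σ, hσ, rfl⟩
    rw [mem_closedBall_zero_iff]
    have h1 : ‖σ‖ ≤ 1 := (mem_ball_zero_iff.1 hσ).le
    calc ‖Φ x σ‖ ≤ ‖Φ x‖ * ‖σ‖ := (Φ x).le_opNorm σ
      _ ≤ ‖Φ‖ * 1 := by gcongr; exact Φ.norm_coe_le_norm x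
      _ = ‖Φ‖ := mul_one _
  · intro x₀
    rw [Metric.equicontinuousAt_iff_right]
    intro ε hε
    filter_upwards [Metric.tendsto_nhds.1 (Φ.continuous.tendsto x₀) ε hε] with x hx
    rintro ⟨_, σ, hσ, rfl⟩
    have h1 : ‖σ‖ ≤ 1 := (mem_ball_zero_iff.1 hσ).le
    change dist (Φ x₀ σ) (Φ x σ) < ε
    calc dist (Φ x₀ σ) (Φ x σ) = ‖(Φ x₀ - Φ x) σ‖ := by rw [dist_eq_norm]; simp
      _ ≤ ‖Φ x₀ - Φ x‖ * ‖σ‖ := (Φ x₀ - Φ x).le_opNorm σ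
      _ ≤ ‖Φ x₀ - Φ x‖ * 1 := by gcongr
      _ < ε := by rwa [mul_one, ← dist_eq_norm, dist_comm]

namespace PlateGeometry

variable {M : ℕ} (B : PlateGeometry M)

instance compactSpace_bdry : CompactSpace B.bdry := isCompact_iff_compactSpace.1 B.isCompact_bdry

/-- Extension by zero of a function on `∂Ω`. -/
def extendZero (f : B.bdry → ℂ) : Plane → ℂ := Function.extend Subtype.val f 0

theorem extendZero_apply (f : B.bdry → ℂ) (x : B.bdry) : B.extendZero f x = f x :=
  Subtype.val_injective.extend_apply f 0 x

theorem continuousOn_extendZero {f : B.bdry → ℂ} (hf : Continuous f) :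
    ContinuousOn (B.extendZero f) B.bdry := by
  rw [continuousOn_iff_continuous_domRestrict]
  refine hf.congr fun x => ?_
  rw [Set.domRestrict_apply, extendZero_apply]

theorem memLp_of_continuousOn {f : Plane → ℂ} (hf : ContinuousOn f B.bdry) :
    MemLp f 2 B.arcLength := by
  obtain ⟨C, hC⟩ := B.isCompact_bdry.exists_bound_of_continuousOn hf
  exact MemLp.of_bound (B.aestronglyMeasurable_of_continuousOn hf) C (B.ae_mem_bdry.mono hC)

/-- The inclusion of the continuous functions on `∂Ω` into `L²(∂Ω)`. -/
def toLpBdry : BoundedContinuousFunction B.bdry ℂ →L[ℂ] Lp ℂ 2 B.arcLength :=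
  LinearMap.mkContinuous
    { toFun := fun f => (B.memLp_of_continuousOn (B.continuousOn_extendZero f.continuous)).toLp _
      map_add' := fun f g => by
        rw [← MemLp.toLp_add]
        refine MemLp.toLp_congr _ _ ?_
        filter_upwards [B.ae_mem_bdry] with x hx
        have h := fun f => B.extendZero_apply f ⟨x, hx⟩
        simp only at h
        simp [h]
      map_smul' := fun c f => by
        rw [RingHom.id_apply, ← MemLp.toLp_const_smul]
        refine MemLp.toLp_congr _ _ ?_
        filter_upwards [B.ae_mem_bdry] with x hx
        have h := fun f => B.extendZero_apply f ⟨x, hx⟩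
        simp only at h
        simp [h] }
    ((B.arcLength.real univ) ^ ((2 : ENNReal).toReal⁻¹)) fun f => by
      refine Lp.norm_le_of_ae_bound (norm_nonneg f) ?_
      filter_upwards [MemLp.coeFn_toLp (B.memLp_of_continuousOn
        (B.continuousOn_extendZero f.continuous)), B.ae_mem_bdry] with x hx hxb
      have h := fun f => B.extendZero_apply f ⟨x, hxb⟩
      simp only at h
      rw [LinearMap.coe_mk, AddHom.coe_mk, hx, h]
      exact f.norm_coe_le_norm _

theorem toLpBdry_ae (f : BoundedContinuousFunction B.bdry ℂ) :
    B.toLpBdry f =ᵐ[B.arcLength] B.extendZero f :=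
  MemLp.coeFn_toLp (B.memLp_of_continuousOn (B.continuousOn_extendZero f.continuous))

/-- The functionals `σ ↦ ∫ K(x, y) σ(y) dS(y)` on `L²(∂Ω)`. -/
def kernelFunctional (K : C(B.bdry × B.bdry, ℂ)) : C(B.bdry, Lp ℂ 2 B.arcLength →L[ℂ] ℂ) where
  -- The inner product is conjugate linear in its first slot, so the kernel is conjugated
  -- beforehand.
  toFun x := innerSL ℂ (B.toLpBdry (BoundedContinuousFunction.mkOfCompact (star (K.curry x))))
  continuous_toFun := by
    have h : Continuous fun x => star (K.curry x) := continuous_star.comp K.curry.continuous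
    have h2 := (ContinuousMap.linearIsometryBoundedOfCompact B.bdry ℂ ℂ).continuous.comp h
    exact (innerSL ℂ).continuous.comp (B.toLpBdry.continuous.comp h2)

theorem kernelFunctional_apply (K : C(B.bdry × B.bdry, ℂ)) {K' : Plane × Plane → ℂ}
    (hK : ∀ x y : B.bdry, K (x, y) = K' (x, y)) (x : B.bdry) (σ : Lp ℂ 2 B.arcLength) :
    B.kernelFunctional K x σ = ∫ y, K' (x, y) * σ y ∂B.arcLength := by
  change inner ℂ _ σ = _
  rw [L2.inner_def]
  refine integral_congr_ae ?_
  filter_upwards [B.toLpBdry_ae (BoundedContinuousFunction.mkOfCompact (star (K.curry x))),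
    B.ae_mem_bdry] with y hy hyb
  have h := fun f => B.extendZero_apply f ⟨y, hyb⟩
  simp only at h
  rw [hy, h, RCLike.inner_apply]
  simp [hK, mul_comm]

/-- The operator factors as a compact map from `L²` into continuous functions, followed by the
bounded inclusion into `L²`. -/
theorem exists_compact_kernelOperator {K : Plane × Plane → ℂ}
    (hK : ContinuousOn K (B.bdry ×ˢ B.bdry)) :
    ∃ T : Lp ℂ 2 B.arcLength →L[ℂ] Lp ℂ 2 B.arcLength, IsCompactOperator T ∧
      ∀ σ : Lp ℂ 2 B.arcLength, ∀ᵐ x ∂B.arcLength, T σ x = ∫ y, K (x, y) * σ y ∂B.arcLength := by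
  let K' : C(B.bdry × B.bdry, ℂ) := ⟨fun p => K (p.1, p.2), hK.comp_continuous (by fun_prop)
    fun p => ⟨p.1.2, p.2.2⟩⟩
  have hc := isCompactOperator_evalFamily (B.kernelFunctional K')
  let T := ContinuousLinearMap.mkOfIsCompactOperator hc
  refine ⟨B.toLpBdry.comp T, hc.clm_comp B.toLpBdry, fun σ => ?_⟩
  filter_upwards [B.toLpBdry_ae (T σ), B.ae_mem_bdry] with x hx hxb
  have h := fun f => B.extendZero_apply f ⟨x, hxb⟩
  simp only at h
  rw [ContinuousLinearMap.comp_apply, hx, h]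
  exact B.kernelFunctional_apply K' (fun _ _ => rfl) ⟨x, hxb⟩ σ

theorem exists_mul_operator {f : Plane → ℂ} (hf : ContinuousOn f B.bdry) :
    ∃ T : Lp ℂ 2 B.arcLength →L[ℂ] Lp ℂ 2 B.arcLength,
      ∀ σ : Lp ℂ 2 B.arcLength, ∀ᵐ x ∂B.arcLength, T σ x = f x * σ x := by
  obtain ⟨C, hC⟩ := B.isCompact_bdry.exists_bound_of_continuousOn hf
  have hb : ∀ σ : Lp ℂ 2 B.arcLength, ∀ᵐ x ∂B.arcLength, ‖f x * σ x‖ ≤ C * ‖σ x‖ := fun σ => by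
    filter_upwards [B.ae_mem_bdry] with x hx
    rw [norm_mul]
    gcongr
    exact hC x hx
  have hm : ∀ σ : Lp ℂ 2 B.arcLength, MemLp (fun x => f x * σ x) 2 B.arcLength := fun σ =>
    (Lp.memLp σ).of_le_mul ((B.aestronglyMeasurable_of_continuousOn hf).mul
      (Lp.aestronglyMeasurable σ)) (hb σ)
  refine ⟨LinearMap.mkContinuous
    { toFun := fun σ => (hm σ).toLp _
      map_add' := fun σ τ => by
        rw [← MemLp.toLp_add]
        refine MemLp.toLp_congr _ _ ?_
        filter_upwards [Lp.coeFn_add σ τ] with x hx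
        change f x * _ = f x * σ x + f x * τ x
        rw [hx, Pi.add_apply, mul_add]
      map_smul' := fun c σ => by
        rw [RingHom.id_apply, ← MemLp.toLp_const_smul]
        refine MemLp.toLp_congr _ _ ?_
        filter_upwards [Lp.coeFn_smul c σ] with x hx
        simp only [hx, Pi.smul_apply, smul_eq_mul]
        ring } C fun σ => ?_, fun σ => ?_⟩
  · refine Lp.norm_le_mul_norm_of_ae_le_mul ?_
    filter_upwards [hb σ, (hm σ).coeFn_toLp] with x hx hx2
    rw [LinearMap.coe_mk, AddHom.coe_mk, hx2]
    exact hx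
  · exact (hm σ).coeFn_toLp

end PlateGeometry

/-- The triangular operator `(a, b) ↦ (-s/2 a, s T a - s/2 b)` with `s² = 1`. -/
def triangularEquiv {E : Type*} [NormedAddCommGroup E] [NormedSpace ℂ E] (T : E →L[ℂ] E) {s : ℂ}
    (hs : s * s = 1) : (E × E) ≃L[ℂ] (E × E) :=
  ContinuousLinearEquiv.equivOfInverse
    (((-s / 2) • ContinuousLinearMap.fst ℂ E E).prod
      (s • T.comp (ContinuousLinearMap.fst ℂ E E) - (s / 2) • ContinuousLinearMap.snd ℂ E E))
    -- Since `s² = 1`, the inverse of `-s/2` is `-2s`. Back substitution in the second row gives the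
    -- entry `-4s T`.
    (((-2 * s) • ContinuousLinearMap.fst ℂ E E).prod
      ((-4 * s) • T.comp (ContinuousLinearMap.fst ℂ E E)
        - (2 * s) • ContinuousLinearMap.snd ℂ E E))
    (fun p => by
      refine Prod.ext ?_ ?_
      · simp only [ContinuousLinearMap.prod_apply, smul_apply,
          ContinuousLinearMap.coe_fst', smul_smul]
        rw [show -2 * s * (-s / 2) = 1 by linear_combination hs, one_smul]
      · simp only [ContinuousLinearMap.prod_apply, smul_apply,
          sub_apply, ContinuousLinearMap.comp_apply,
          ContinuousLinearMap.coe_fst', ContinuousLinearMap.coe_snd', smul_smul, map_smul,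
          smul_sub]
        rw [show -4 * s * (-s / 2) = 2 by linear_combination 2 * hs,
          show 2 * s * s = 2 by linear_combination 2 * hs,
          show 2 * s * (s / 2) = 1 by linear_combination hs, one_smul]
        abel)
    (fun p => by
      refine Prod.ext ?_ ?_
      · simp only [ContinuousLinearMap.prod_apply, smul_apply,
          ContinuousLinearMap.coe_fst', smul_smul]
        rw [show -s / 2 * (-2 * s) = 1 by linear_combination hs, one_smul]
      · simp only [ContinuousLinearMap.prod_apply, smul_apply,
          sub_apply, ContinuousLinearMap.comp_apply,
          ContinuousLinearMap.coe_fst', ContinuousLinearMap.coe_snd', smul_smul, map_smul,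
          smul_sub]
        rw [show s * (-2 * s) = -2 by linear_combination -2 * hs,
          show s / 2 * (-4 * s) = -2 by linear_combination -2 * hs,
          show s / 2 * (2 * s) = 1 by linear_combination hs, one_smul]
        abel)

theorem triangularEquiv_apply {E : Type*} [NormedAddCommGroup E] [NormedSpace ℂ E]
    (T : E →L[ℂ] E) {s : ℂ} (hs : s * s = 1) (p : E × E) :
    triangularEquiv T hs p = ((-s / 2) • p.1, s • T p.1 - (s / 2) • p.2) := rfl

theorem exists_compact_matrixOperator {E : Type*} [NormedAddCommGroup E] [NormedSpace ℂ E]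
    {T : Fin 2 → Fin 2 → E →L[ℂ] E} (hT : ∀ a b, IsCompactOperator (T a b)) :
    ∃ C : (E × E) →L[ℂ] (E × E), IsCompactOperator C ∧
      ∀ p, C p = (T 0 0 p.1 + T 0 1 p.2, T 1 0 p.1 + T 1 1 p.2) := by
  have h0 : ∀ a b : Fin 2, IsCompactOperator fun p : E × E => T a b (![p.1, p.2] b) := by
    intro a b
    fin_cases b
    · exact (hT a 0).comp_clm (ContinuousLinearMap.fst ℂ E E)
    · exact (hT a 1).comp_clm (ContinuousLinearMap.snd ℂ E E)
  have h1 : ∀ a, IsCompactOperator fun p : E × E => T a 0 p.1 + T a 1 p.2 := fun a =>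
    (h0 a 0).add (h0 a 1)
  refine ⟨((T 0 0).comp (ContinuousLinearMap.fst ℂ E E)
    + (T 0 1).comp (ContinuousLinearMap.snd ℂ E E)).prod
    ((T 1 0).comp (ContinuousLinearMap.fst ℂ E E)
    + (T 1 1).comp (ContinuousLinearMap.snd ℂ E E)), ?_, fun p => rfl⟩
  have h2 := ((h1 0).clm_comp (ContinuousLinearMap.inl ℂ E E)).add
    ((h1 1).clm_comp (ContinuousLinearMap.inr ℂ E E))
  refine (congrArg IsCompactOperator (funext fun p => Prod.ext ?_ ?_)).mpr h2 <;> simp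

namespace PlateGeometry

variable {M : ℕ} (B : PlateGeometry M)

/-- Multiplication by the curvature is bounded, since `κ` is continuous on a compact set, so the
triangular matrix is invertible. On `L²` densities, which are integrable, `bdryOp` agrees with the
integral against the extended kernel, so the compact operators represent it almost everywhere. -/
theorem isSecondKind {k : ℝ} {Q : FlexuralProfile}
    (hG : ∀ x y, flexuralGreen k x y = Q.φ₀ (‖x - y‖ ^ 2)) {J : (Plane → ℂ) × (Plane → ℂ) →
      Plane → ℂ × ℂ} {s : ℂ} (hs : s * s = 1)
    (hJ : ∀ ρ x, J ρ x = (-s / 2 * ρ.1 x,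
      s * (B.curvature x : ℂ) * ρ.1 x - s / 2 * ρ.2 x)) :
    IsSecondKind B.arcLength J (B.integralPart k) := by
  obtain ⟨A, hA⟩ := B.exists_mul_operator (f := fun x => (B.curvature x : ℂ))
    (Complex.continuous_ofReal.comp_continuousOn B.continuousOn_curvature)
  choose T hTc hT using fun a b => B.exists_compact_kernelOperator (B.continuousOn_kerExt Q a b)
  obtain ⟨C, hC, hCT⟩ := exists_compact_matrixOperator hTc
  refine ⟨triangularEquiv A hs, C, hC, fun ρ => ?_, fun ρ => ?_⟩
  · rw [triangularEquiv_apply]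
    filter_upwards [hA ρ.1, Lp.coeFn_smul (-s / 2) ρ.1, Lp.coeFn_smul s (A ρ.1),
      Lp.coeFn_smul (s / 2) ρ.2, Lp.coeFn_sub (s • A ρ.1) ((s / 2) • ρ.2)] with x h1 h2 h3 h4 h5
    rw [hJ, h2, h5]
    simp only [Pi.sub_apply, h3, h4, Pi.smul_apply, h1, smul_eq_mul, mul_assoc]
  · rw [hCT]
    filter_upwards [hT 0 0 ρ.1, hT 0 1 ρ.2, hT 1 0 ρ.1, hT 1 1 ρ.2,
      Lp.coeFn_add (T 0 0 ρ.1) (T 0 1 ρ.2), Lp.coeFn_add (T 1 0 ρ.1) (T 1 1 ρ.2),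
      B.ae_mem_bdry] with x h1 h2 h3 h4 h5 h6 hx
    have i1 : Integrable ρ.1 B.arcLength := (Lp.memLp ρ.1).integrable one_le_two
    have i2 : Integrable ρ.2 B.arcLength := (Lp.memLp ρ.2).integrable one_le_two
    rw [h5, h6]
    simp only [integralPart, Pi.add_apply, h1, h2, h3, h4, B.bdryOp_eq hG _ _ i1 hx,
      B.bdryOp_eq hG _ _ i2 hx]

end PlateGeometry

end

/-! ### The main theorem, assembled from one choice of radial profile. -/

theorem theorem1 {M : ℕ} (B : PlateGeometry M) (k : ℝ) (hk : 0 < k) :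
    -- the boundary kernels are continuous
    (∀ i j : Fin 2, B.IsContinuousKernel (B.bdryKernel k i j)) ∧
    -- the boundary operators are well defined on square integrable densities
    (∀ σ : Plane → ℂ, MemLp σ 2 B.arcLength → ∀ x₀ ∈ B.bdry, ∀ i j : Fin 2,
      ∃ v, B.HasPV (B.bdryKernel k i j) σ x₀ v) ∧
    -- the layer potentials are well defined and differentiable off the boundary
    (∀ σ : Plane → ℂ, B.IsC1Density σ → ∀ x ∉ B.bdry,
      Integrable (fun y => B.K1 k x y * σ y) B.arcLength ∧
      Integrable (fun y => B.K2 k x y * σ y) B.arcLength ∧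
      DifferentiableAt ℝ (B.layerPotential (B.K1 k) σ) x ∧
      DifferentiableAt ℝ (B.layerPotential (B.K2 k) σ) x) ∧
    -- the jump relations
    (∀ σ : Plane → ℂ, B.IsC1Density σ → ∀ x₀ ∈ B.bdry, ∀ side : Side,
      B.HasSideLimit side (B.layerPotential (B.K1 k) σ) x₀
        (-side.sign / 2 * σ x₀ + B.bdryOp (B.bdryKernel k 0 0) σ x₀) ∧
      B.HasSideLimit side (B.layerPotential (B.K2 k) σ) x₀
        (B.bdryOp (B.bdryKernel k 0 1) σ x₀) ∧
      B.HasSideLimit side (dirDeriv (B.normal x₀) (B.layerPotential (B.K1 k) σ)) x₀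
        (side.sign * (B.curvature x₀ : ℂ) * σ x₀ + B.bdryOp (B.bdryKernel k 1 0) σ x₀) ∧
      B.HasSideLimit side (dirDeriv (B.normal x₀) (B.layerPotential (B.K2 k) σ)) x₀
        (-side.sign / 2 * σ x₀ + B.bdryOp (B.bdryKernel k 1 1) σ x₀)) ∧
    -- the boundary values of the representation give the boundary integral systems
    (∀ ρ : (Plane → ℂ) × (Plane → ℂ), B.IsC1Density ρ.1 → B.IsC1Density ρ.2 →
      ∀ x₀ ∈ B.bdry, ∀ side : Side,
      B.HasSideLimit side (B.representation k ρ) x₀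
        (B.jumpPart side ρ x₀ + B.integralPart k ρ x₀).1 ∧
      B.HasSideLimit side (dirDeriv (B.normal x₀) (B.representation k ρ)) x₀
        (B.jumpPart side ρ x₀ + B.integralPart k ρ x₀).2) ∧
    -- both systems are second kind
    (∀ side : Side, IsSecondKind B.arcLength (B.jumpPart side) (B.integralPart k)) := by
  obtain ⟨Q, hG⟩ := exists_flexuralProfile k hk
  exact ⟨B.isContinuousKernel_bdryKernel hG,
    fun σ hσ x₀ hx₀ i j => ⟨_, B.hasPV_bdryKernel hG i j (hσ.integrable one_le_two) hx₀⟩,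
    fun σ hσ x hx => B.layerPotential_off_bdry hG hσ.integrable hx,
    fun σ hσ x₀ hx₀ side => B.jump_relations hG hσ hx₀ side,
    fun ρ h₁ h₂ x₀ hx₀ side => B.hasSideLimit_representation hG h₁ h₂ hx₀ side,
    fun side => B.isSecondKind hG side.sign_mul_sign fun _ _ => rfl⟩
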